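/- **Proposition 3.2.** Let $d\ge 1$, $\omega>0$, $T=2\pi/\omega$, $K(t)=\frac2T\big(\cos(\omega t)-\frac14\big)$, $\langle x\rangle=(1+|x|^2)^{1/2}$. For $s\in\mathbb{R}$ and $p\in\{0,1,2,\dots\}$ let $L^2_s(\mathbb{R}^d)$ be the space of (complex-valued) $f$ with $\|f\|_{L^2_s}=\|\langle x\rangle^s f\|_{L^2(\mathbb{R}^d)}<\infty$, and $H^p_s(\mathbb{R}^d)$ the space of $f$ whose weak derivatives $\partial^\alpha f$, $|\alpha|\le p$, lie in $L^2_s(\mathbb{R}^d)$, with norm $\|f\|_{H^p_s}=\big(\sum_{|\alpha|\le p}\|\partial^\alpha f\|_{L^2_s}^2\big)^{1/2}$; thus $H^0_s=L^2_s$. For $v\in C_0^\infty(\mathbb{R}^d)$ and $f\in L^2(\mathbb{R}^d)$ put $\Pi v=\int_0^T K(t)\,w(\cdot,t)\,dt$, where $w\in C^2([0,T];L^2(\mathbb{R}^d))$ is the solution of $$\partial_t^2 w=\Delta w-f(x)\cos(\omega t),\qquad w(x,0)=v(x),\qquad \partial_t w(x,0)=0\qquad\text{on }\mathbb{R}^d\times[0,T],$$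 and let $\mathcal{S}$ be the operator $\Pi$ for $f=0$. 1. For every $s\in\mathbb{R}$ and every integer $p\ge 0$, $\mathcal{S}$ extends uniquely from $C_0^\infty(\mathbb{R}^d)$ to a bounded linear operator $L^2_s(\mathbb{R}^d)\to L^2_s(\mathbb{R}^d)$ and to a bounded linear operator $H^p_s(\mathbb{R}^d)\to H^p_s(\mathbb{R}^d)$; the second is the restriction of the first. 2. For every $v\in L^2(\mathbb{R}^d)$, with the convention $\hat v(\xi)=\int_{\mathbb{R}^d} v(x)e^{-2\pi i\xi\cdot x}\,dx$ for the Fourier transform, $$\widehat{\mathcal{S}v}(\xi)=\beta(2\pi|\xi|)\,\hat v(\xi)\quad\text{for a.e. }\xi,\qquad \beta(\lambda)=\int_0^T K(t)\cos(\lambda t)\,dt .$$ 3. Let $t>\frac12$ and $f\in L^2_t(\mathbb{R}^d)$. For all $s\in\mathbb{R}$ and integers $p\ge 0$ the operator $\Pi$ extends from $C_0^\infty(\mathbb{R}^d)$ to a continuous affine operator defined on all of $H^p_s(\mathbb{R}^d)$, with values in $H^q_r(\mathbb{R}^d)$ for all integers $0\le q\le\min(p,2)$ and all real $r\le\min(s,t)$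 (in particular in $H^p_s(\mathbb{R}^d)$ if $p\le2$ and $s\le t$), and for each such $q,r$ it is the only continuous map $H^p_s(\mathbb{R}^d)\to H^q_r(\mathbb{R}^d)$ that extends $\Pi$. Moreover, if $u\in H^2_{-t}(\mathbb{R}^d)$ is the outgoing solution of $\Delta u+\omega^2u=f$, that is, the limit in $H^2_{-t}(\mathbb{R}^d)$, as $z\to\omega^2$ with $\operatorname{Im} z>0$, of the solutions $u_z\in L^2(\mathbb{R}^d)$ of $\Delta u_z+zu_z=f$, then $$\Pi v=\mathcal{S}(v-u)+u\qquad\text{for all } v\in H^p_s(\mathbb{R}^d),$$ where $\mathcal{S}$ acts on $v-u\in L^2_\sigma(\mathbb{R}^d)$, for any $\sigma\le\min(s,-t)$. -/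

import Mathlib

open MeasureTheory Set Filter Topology
open scoped SchwartzMap FourierTransform LineDeriv Laplacian ENNReal

noncomputable section

namespace Waveholtz

/-- The space `ℝ^d` with the Euclidean norm. -/
abbrev E (d : ℕ) := EuclideanSpace ℝ (Fin d)

/-! ### Weighted Lebesgue and Sobolev spaces -/

/-- The measure `⟨x⟩^{2s} dx`, where `⟨x⟩ = (1 + |x|²)^{1/2}`. -/
def weightMeasure (d : ℕ) (s : ℝ) : Measure (E d) :=
  volume.withDensity fun x => ENNReal.ofReal ((1 + ‖x‖ ^ 2) ^ s)

/-- The weighted space `L²_s(ℝ^d)`, with norm `(∫ |f|² ⟨x⟩^{2s} dx)^{1/2}`.  The weight is positive,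
so that the classes modulo null sets are those of Lebesgue measure. -/
abbrev L2s (d : ℕ) (s : ℝ) := Lp ℂ 2 (weightMeasure d s)

/-- Multi-indices `α ∈ ℕ^d` with `|α| = α₁ + ⋯ + α_d ≤ p`
(all their entries are then at most `p`). -/
abbrev MultiIndex (d p : ℕ) := {α : Fin d → Fin (p + 1) // ∑ i, (α i : ℕ) ≤ p}

/-- The multi-index `0`. -/
def MultiIndex.zero (d p : ℕ) : MultiIndex d p := ⟨fun _ => 0, by simp⟩

/-- `∂^α φ = ∂₁^{α₁} ⋯ ∂_d^{α_d} φ` for a Schwartz function `φ`. -/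
def partialDeriv {d : ℕ} (α : Fin d → ℕ) (φ : 𝓢(E d, ℂ)) : 𝓢(E d, ℂ) :=
  (List.finRange d).foldr
    (fun i ψ => (fun χ : 𝓢(E d, ℂ) => ∂_{EuclideanSpace.single i (1 : ℝ)} χ)^[α i] ψ) φ

/-- `g = ∂^α f` in the weak sense.  Used for `f`, `g` in weighted spaces `L²_s` only: these are
tempered distributions, so that all Schwartz functions are admissible as test functions. -/
def HasWeakDeriv {d : ℕ} (α : Fin d → ℕ) (f g : E d → ℂ) : Prop :=
  ∀ φ : 𝓢(E d, ℂ),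
    ∫ x, f x * partialDeriv α φ x = (-1 : ℂ) ^ (∑ i, α i) * ∫ x, g x * φ x

lemma weightMeasure_absolutelyContinuous (d : ℕ) (s : ℝ) :
    (volume : Measure (E d)) ≪ weightMeasure d s := by
  refine withDensity_absolutelyContinuous' (by fun_prop) (ae_of_all _ fun x => ?_)
  have : (0 : ℝ) < (1 + ‖x‖ ^ 2) ^ s := Real.rpow_pos_of_pos (by positivity) s
  simpa using this

/-- The product of an `L²_s` function and a Schwartz function is integrable. -/
lemma integrable_mul_schwartz {d : ℕ} {s : ℝ} (f : L2s d s) (φ : 𝓢(E d, ℂ)) :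
    Integrable (fun x => f x * φ x) := by
  have hpos : ∀ (r : ℝ) (x : E d), (0 : ℝ) < (1 + ‖x‖ ^ 2) ^ r :=
    fun r x => Real.rpow_pos_of_pos (by positivity) r
  have hm : Measurable fun x : E d => ENNReal.ofReal ((1 + ‖x‖ ^ 2) ^ s) := by fun_prop
  have htop : ∀ᵐ x : E d, ENNReal.ofReal ((1 + ‖x‖ ^ 2) ^ s) < ⊤ :=
    ae_of_all _ fun x => ENNReal.ofReal_lt_top
  let w : E d → ℂ := fun x => (((1 + ‖x‖ ^ 2) ^ (-s) : ℝ) : ℂ)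
  have hw : Continuous w := by
    refine Complex.continuous_ofReal.comp (Continuous.rpow_const (by fun_prop) fun x => Or.inl ?_)
    positivity
  have h2 : MemLp (fun x => w x * φ x) 2 (weightMeasure d s) := by
    rw [memLp_two_iff_integrable_sq_norm (by fun_prop), weightMeasure,
      integrable_withDensity_iff_integrable_smul' hm htop]
    let ψ : 𝓢(E d, ℂ) := SchwartzMap.smulLeftCLM ℂ (fun x : E d => (1 + ‖x‖ ^ 2) ^ (-s / 2)) φ
    have hψ : Integrable fun x => ‖ψ x‖ ^ 2 :=
      (memLp_two_iff_integrable_sq_norm ψ.continuous.aestronglyMeasurable).1 (ψ.memLp 2)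
    refine hψ.congr (ae_of_all _ fun x => ?_)
    have e1 : (1 + ‖x‖ ^ 2 : ℝ) ^ (-s) = ((1 + ‖x‖ ^ 2) ^ (-s / 2)) ^ 2 := by
      rw [← Real.rpow_natCast ((1 + ‖x‖ ^ 2 : ℝ) ^ (-s / 2)) 2, ← Real.rpow_mul (by positivity)]
      norm_num
    have e2 : (1 + ‖x‖ ^ 2 : ℝ) ^ s * (1 + ‖x‖ ^ 2) ^ (-s) = 1 := by
      rw [← Real.rpow_add (by positivity)]; simp
    have e3 : ψ x = ((1 + ‖x‖ ^ 2 : ℝ) ^ (-s / 2)) • φ x := by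
      refine SchwartzMap.smulLeftCLM_apply_apply ?_ φ x
      exact Function.hasTemperateGrowth_one_add_norm_sq_rpow (E d) (-s / 2)
    simp only [e3, norm_smul, norm_mul, w, Complex.norm_real, Real.norm_eq_abs,
      abs_of_pos (hpos _ x), ENNReal.toReal_ofReal (hpos s x).le, smul_eq_mul]
    calc ((1 + ‖x‖ ^ 2 : ℝ) ^ (-s / 2) * ‖φ x‖) ^ 2
        = (1 + ‖x‖ ^ 2) ^ (-s) * ‖φ x‖ ^ 2 := by rw [e1]; ring
      _ = ((1 + ‖x‖ ^ 2) ^ s * (1 + ‖x‖ ^ 2) ^ (-s)) * ((1 + ‖x‖ ^ 2) ^ (-s) * ‖φ x‖ ^ 2) := by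
          rw [e2, one_mul]
      _ = _ := by ring
  have h3 := (integrable_withDensity_iff_integrable_smul' hm htop).1
    (MemLp.integrable_mul (Lp.memLp f) h2)
  refine h3.congr (ae_of_all _ fun x => ?_)
  have e2 : (1 + ‖x‖ ^ 2 : ℝ) ^ s * (1 + ‖x‖ ^ 2) ^ (-s) = 1 := by
    rw [← Real.rpow_add (by positivity)]; simp
  have e3 : (((1 + ‖x‖ ^ 2 : ℝ) ^ s : ℝ) : ℂ) * (((1 + ‖x‖ ^ 2) ^ (-s) : ℝ) : ℂ) = 1 := by
    exact_mod_cast e2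
  simp only [Pi.mul_apply, ENNReal.toReal_ofReal (hpos s x).le, Complex.real_smul, w]
  calc _ = ((((1 + ‖x‖ ^ 2 : ℝ) ^ s : ℝ) : ℂ) * (((1 + ‖x‖ ^ 2) ^ (-s) : ℝ) : ℂ)) *
        (f x * φ x) := by ring
    _ = _ := by rw [e3, one_mul]

lemma integral_add_mul {d : ℕ} {s : ℝ} (f g : L2s d s) (φ : 𝓢(E d, ℂ)) :
    ∫ x, (f + g : L2s d s) x * φ x = (∫ x, f x * φ x) + ∫ x, g x * φ x := by
  rw [← integral_add (integrable_mul_schwartz f φ) (integrable_mul_schwartz g φ)]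
  refine integral_congr_ae ?_
  filter_upwards [(weightMeasure_absolutelyContinuous d s).ae_le (Lp.coeFn_add f g)] with x hx
  rw [hx, Pi.add_apply, add_mul]

lemma integral_smul_mul {d : ℕ} {s : ℝ} (c : ℂ) (f : L2s d s) (φ : 𝓢(E d, ℂ)) :
    ∫ x, (c • f : L2s d s) x * φ x = c * ∫ x, f x * φ x := by
  rw [← integral_const_mul]
  refine integral_congr_ae ?_
  filter_upwards [(weightMeasure_absolutelyContinuous d s).ae_le (Lp.coeFn_smul c f)] with x hx
  rw [hx, Pi.smul_apply, smul_eq_mul, mul_assoc]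

lemma integral_zero_mul {d : ℕ} {s : ℝ} (φ : 𝓢(E d, ℂ)) :
    ∫ x, (0 : L2s d s) x * φ x = 0 := by
  simpa using integral_smul_mul (0 : ℂ) (0 : L2s d s) φ

/-- The weighted Sobolev space `H^p_s(ℝ^d)`.  An element is the family `(∂^α f)_{|α| ≤ p}` of the
weak derivatives, all in `L²_s`, of a function `f` (the member of the family at `α = 0`); the norm
is `(∑_{|α| ≤ p} ‖∂^α f‖²_{L²_s})^{1/2}`. -/
def sobolev (d p : ℕ) (s : ℝ) : Submodule ℂ (PiLp 2 fun _ : MultiIndex d p => L2s d s) where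
  carrier := {F | ∀ α : MultiIndex d p,
    HasWeakDeriv (fun i => (α.1 i : ℕ)) (F (MultiIndex.zero d p)) (F α)}
  add_mem' := by
    intro F G hF hG α φ
    simp only [PiLp.add_apply, integral_add_mul, hF α φ, hG α φ]
    ring
  zero_mem' := by
    intro α φ
    simp only [PiLp.zero_apply, integral_zero_mul, mul_zero]
  smul_mem' := by
    intro c F hF α φ
    simp only [PiLp.smul_apply, integral_smul_mul, hF α φ]
    ring

abbrev Hps (d p : ℕ) (s : ℝ) := ↥(sobolev d p s)

/-- The element of `L²_s` underlying an element of `H^p_s`. -/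
def Hps.toL2s {d p : ℕ} {s : ℝ} (F : Hps d p s) : L2s d s := F.1 (MultiIndex.zero d p)

/-! ### The wave equation and the Waveholtz operator -/

/-- The period `T = 2π/ω`. -/
def period (ω : ℝ) : ℝ := 2 * Real.pi / ω

/-- `K(t) = (2/T) (cos(ωt) - 1/4)`. -/
def kernel (ω t : ℝ) : ℝ := 2 / period ω * (Real.cos (ω * t) - 1 / 4)

/-- `β(λ) = ∫₀^T K(t) cos(λt) dt`. -/
def beta (ω l : ℝ) : ℝ := ∫ t in (0 : ℝ)..period ω, kernel ω t * Real.cos (l * t)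

/-- `w ∈ C²([0,T]; L²(ℝ^d))` solves
`∂ₜ²w = Δw - f(x) cos(ωt)`, `w(0) = v`, `∂ₜw(0) = 0`, for `0 ≤ t ≤ T`, the Laplacian being taken
in the sense of (tempered) distributions. -/
def IsWaveSolution {d : ℕ} (ω : ℝ) (f v : E d → ℂ)
    (w : ℝ → Lp ℂ 2 (volume : Measure (E d))) : Prop :=
  ∃ w' w'' : ℝ → Lp ℂ 2 (volume : Measure (E d)),
    (∀ t ∈ Icc 0 (period ω), HasDerivWithinAt w (w' t) (Icc 0 (period ω)) t) ∧
    (∀ t ∈ Icc 0 (period ω), HasDerivWithinAt w' (w'' t) (Icc 0 (period ω)) t) ∧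
    ContinuousOn w'' (Icc 0 (period ω)) ∧
    w 0 =ᵐ[volume] v ∧ w' 0 = 0 ∧
    ∀ t ∈ Icc 0 (period ω), ∀ φ : 𝓢(E d, ℂ),
      ∫ x, w'' t x * φ x = (∫ x, w t x * (Δ φ) x) - Real.cos (ω * t) * ∫ x, f x * φ x

/-- `g = Πv`, i.e. `g = ∫₀^T K(t) w(·,t) dt`, where `w` solves the wave equation with forcing
`f(x) cos(ωt)` and initial data `(v, 0)`.  For `f = 0` this is `g = 𝒮v`. -/
def IsPi {d : ℕ} (ω : ℝ) (f v g : E d → ℂ) : Prop :=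
  ∃ w : ℝ → Lp ℂ 2 (volume : Measure (E d)), IsWaveSolution ω f v w ∧
    g =ᵐ[volume] (∫ t in (0 : ℝ)..period ω, kernel ω t • w t : Lp ℂ 2 (volume : Measure (E d)))

/-- The map `A : X → Y`, between spaces `X`, `Y` whose elements have underlying functions `fX`, `fY`
on `ℝ^d`, extends the operator `Π` with forcing `f` defined on `C_0^∞(ℝ^d) ⊆ X`. -/
def ExtendsPi {d : ℕ} (ω : ℝ) (f : E d → ℂ) {X Y : Type} (fX : X → E d → ℂ) (fY : Y → E d → ℂ)
    (A : X → Y) : Prop :=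
  ∀ v : E d → ℂ, ContDiff ℝ (⊤ : ℕ∞) v → HasCompactSupport v →
    ∃ V : X, fX V =ᵐ[volume] v ∧ IsPi ω f v (fY (A V))

/-! ### Outgoing solutions of the Helmholtz equation -/

/-- `u` is the outgoing solution of `Δu + ω²u = f`, `f ∈ L²_t(ℝ^d)` (limiting absorption):
it is the limit in `H²_{-t}(ℝ^d)`, as `z → ω²` with `Im z > 0`, of the solutions `u_z ∈ L²(ℝ^d)` of
`Δu_z + z u_z = f`, i.e. of `u_z = -(-Δ - z)⁻¹ f`. -/
def IsOutgoing {d : ℕ} (ω t : ℝ) (f : L2s d t) (u : Hps d 2 (-t)) : Prop :=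
  ∃ U : ℂ → Hps d 2 (-t),
    (∀ z : ℂ, 0 < z.im → MemLp (U z).toL2s 2 (volume : Measure (E d)) ∧
      ∀ φ : 𝓢(E d, ℂ), ∫ x, (U z).toL2s x * ((Δ φ) x + z * φ x) = ∫ x, f x * φ x) ∧
    Tendsto U (𝓝[{z : ℂ | 0 < z.im}] ((ω : ℂ) ^ 2)) (𝓝 u)

end Waveholtz

end

open Waveholtz

open MeasureTheory Set Filter Topology
open scoped SchwartzMap FourierTransform LineDeriv Laplacian ENNReal

noncomputable section

namespace Waveholtz

/-! ### Weighted `L²` spaces -/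

/-! On the Fourier side the solution with `f = 0` is `cos(t√-Δ) v`, so `𝒮 = ∫₀^T K(t) cos(t√-Δ) dt`
is the multiplier with symbol `β(2π|ξ|)`. A bounded symbol gives boundedness on `L²` only. On `L²_s`
the reason is finite propagation speed: in bounded time waves travel a bounded distance, over which
the weight changes by a bounded factor. The proof expresses this by a weighted energy estimate
(`energy_le_of_nonpos`). The pair `P = cos(t√-Δ)φ`, `Q_j = ∂_j (sin(t√-Δ)/√-Δ) φ` solves `P' = ∑ ∂_j
Q_j`, `Q_j' = ∂_j P`; integration by parts in `L²_s` leaves only terms with the bounded logarithmic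
derivative of the weight, and Gronwall closes the argument for `s ≤ 0`. Transposition gives `s ≥ 0`
(`wave_bounds`). Integrating in time, every symbol `∫₀^A h(a) cos(2π|ξ|a) da` with continuous `h` is
bounded on all `L²_s` (`cosInt_bounds`), with a constant that sees `h` only through `∫ |h|`.

Multipliers commute with derivatives, so they act on `H^p_s` componentwise. Uniqueness of the
extensions needs test functions to be dense in `H^p_s`. Powers of the averages `sin(ε√-Δ)/(ε√-Δ)`
regularise: they tend to the identity, and each factor absorbs one derivative by the energy estimate
(`toH_denseRange`). Cutoffs then give compact support (`dense_testFunctions`). That `Π` is well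
defined rests on uniqueness for the wave equation, proved by pairing with backward solutions
(`IsWaveSolution.eqOn`).

With forcing, `Πv = 𝒮v + m(D) f`, where `m(λ) = (β(λ) - 1)/(λ² - ω²)`. The singularity at `λ = ω` is
only apparent: two integrations by parts write `m` as a cosine integral of a continuous kernel
(`mSym_eq`), so `m(D)` is again bounded on every weighted space. The identity `(Δ + ω²) m(D) = 1 -
𝒮` controls `Δ m(D)`, and weighted elliptic estimates turn this into `m(D) : L²_t → H²_t`. The same
identity yields `m(D) f = m(D)(Δ + ω²)u = u - 𝒮u` for the outgoing solution
(`IsOutgoing.incl_ext_mSym`), hence `Πv = 𝒮(v - u) + u`. -/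

/-- The weight `⟨x⟩^{2s}`. -/
def wt {d : ℕ} (s : ℝ) (x : E d) : ℝ := (1 + ‖x‖ ^ 2) ^ s

lemma wt_pos {d : ℕ} (s : ℝ) (x : E d) : 0 < wt s x := Real.rpow_pos_of_pos (by positivity) s

lemma wt_add {d : ℕ} (s r : ℝ) (x : E d) : wt (s + r) x = wt s x * wt r x :=
  Real.rpow_add (by positivity) s r

lemma wt_mul_neg {d : ℕ} (s : ℝ) (x : E d) : wt s x * wt (-s) x = 1 := by
  rw [← wt_add]; simp [wt]

lemma wt_le {d : ℕ} {s r : ℝ} (h : r ≤ s) (x : E d) : wt r x ≤ wt s x :=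
  Real.rpow_le_rpow_of_exponent_le (by nlinarith [sq_nonneg ‖x‖]) h

lemma continuous_wt {d : ℕ} (s : ℝ) : Continuous (wt s : E d → ℝ) :=
  Continuous.rpow_const (by fun_prop) fun x => Or.inl (by positivity)

lemma wt_temperate {d : ℕ} (s : ℝ) : Function.HasTemperateGrowth (wt s : E d → ℝ) :=
  Function.hasTemperateGrowth_one_add_norm_sq_rpow (E d) s

lemma weightMeasure_eq (d : ℕ) (s : ℝ) :
    weightMeasure d s = volume.withDensity fun x => ENNReal.ofReal (wt s x) := rfl

lemma measurable_ofReal_wt {d : ℕ} (s : ℝ) :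
    Measurable fun x : E d => ENNReal.ofReal (wt s x) :=
  (continuous_wt s).measurable.ennreal_ofReal

lemma weightMeasure_absolutelyContinuous_volume (d : ℕ) (s : ℝ) :
    weightMeasure d s ≪ (volume : Measure (E d)) := withDensity_absolutelyContinuous _ _

lemma ae_volume_of_ae_weightMeasure {d : ℕ} {s : ℝ} {p : E d → Prop}
    (h : ∀ᵐ x ∂(weightMeasure d s), p x) : ∀ᵐ x, p x :=
  (weightMeasure_absolutelyContinuous d s).ae_le h

lemma ae_weightMeasure_of_ae_volume {d : ℕ} {s : ℝ} {p : E d → Prop}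
    (h : ∀ᵐ x, p x) : ∀ᵐ x ∂(weightMeasure d s), p x :=
  (weightMeasure_absolutelyContinuous_volume d s).ae_le h

lemma L2s_ext {d : ℕ} {s : ℝ} {f g : L2s d s} (h : f =ᵐ[volume] g) : f = g :=
  Lp.ext (ae_weightMeasure_of_ae_volume h)

lemma weightMeasure_mono {d : ℕ} {s r : ℝ} (h : r ≤ s) :
    weightMeasure d r ≤ weightMeasure d s :=
  withDensity_mono (ae_of_all _ fun x => ENNReal.ofReal_le_ofReal (wt_le h x))

lemma weightMeasure_zero (d : ℕ) : weightMeasure d 0 = volume := by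
  simp [weightMeasure]

lemma weightMeasure_le_volume {d : ℕ} {s : ℝ} (h : s ≤ 0) : weightMeasure d s ≤ volume := by
  rw [← weightMeasure_zero]; exact weightMeasure_mono h

lemma volume_le_weightMeasure {d : ℕ} {s : ℝ} (h : 0 ≤ s) : volume ≤ weightMeasure d s := by
  rw [← weightMeasure_zero]; exact weightMeasure_mono h

lemma integral_weightMeasure {d : ℕ} {s : ℝ} {F : Type*} [NormedAddCommGroup F] [NormedSpace ℝ F]
    (f : E d → F) : ∫ x, f x ∂(weightMeasure d s) = ∫ x, wt s x • f x := by
  rw [weightMeasure_eq, integral_withDensity_eq_integral_toReal_smul (measurable_ofReal_wt s)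
    (ae_of_all _ fun x => ENNReal.ofReal_lt_top)]
  simp [ENNReal.toReal_ofReal (wt_pos s _).le]

lemma integrable_weightMeasure {d : ℕ} {s : ℝ} {F : Type*} [NormedAddCommGroup F]
    [NormedSpace ℝ F] (f : E d → F) :
    Integrable f (weightMeasure d s) ↔ Integrable (fun x => wt s x • f x) := by
  rw [weightMeasure_eq, integrable_withDensity_iff_integrable_smul' (measurable_ofReal_wt s)
    (ae_of_all _ fun x => ENNReal.ofReal_lt_top)]
  simp [ENNReal.toReal_ofReal (wt_pos s _).le]

instance (d : ℕ) (s : ℝ) : IsFiniteMeasureOnCompacts (weightMeasure d s) := by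
  refine ⟨fun K hK => ?_⟩
  have h : IntegrableOn (fun x : E d => wt s x) K :=
    (continuous_wt s).continuousOn.integrableOn_compact hK
  rw [weightMeasure_eq, withDensity_apply _ hK.measurableSet]
  have := h.lintegral_lt_top
  exact this

/-- The weight grows at most polynomially, so a larger negative power of `1 + ‖x‖` compensates it.
This puts Schwartz functions into `L²_s` for every real `s`. -/
instance (d : ℕ) (s : ℝ) : (weightMeasure d s).HasTemperateGrowth := by
  obtain ⟨k, C, hC⟩ : ∃ (k : ℕ) (C : ℝ), ∀ x : E d, ‖wt s x‖ ≤ C * (1 + ‖x‖) ^ k := by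
    obtain ⟨k, C, hC⟩ := (wt_temperate (d := d) s).2 0
    exact ⟨k, C, fun x => by simpa using hC x⟩
  refine ⟨⟨(volume : Measure (E d)).integrablePower + k, ?_⟩⟩
  rw [integrable_weightMeasure]
  refine ((volume : Measure (E d)).integrable_pow_neg_integrablePower.const_mul C).mono' ?_ ?_
  · refine Continuous.aestronglyMeasurable ?_
    refine (continuous_wt s).smul (Continuous.rpow_const (by fun_prop) fun x => Or.inl ?_)
    positivity
  · refine ae_of_all _ fun x => ?_
    have h1 : (0 : ℝ) < 1 + ‖x‖ := by positivity
    rw [norm_smul, Nat.cast_add, neg_add, Real.rpow_add h1, Real.norm_of_nonneg (r := _ * _)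
      (by positivity), Real.rpow_neg h1.le (k : ℝ), Real.rpow_natCast]
    calc ‖wt s x‖ * ((1 + ‖x‖) ^ (-((volume : Measure (E d)).integrablePower : ℝ)) *
          ((1 + ‖x‖) ^ k)⁻¹)
        ≤ (C * (1 + ‖x‖) ^ k) * ((1 + ‖x‖) ^ (-((volume : Measure (E d)).integrablePower : ℝ)) *
          ((1 + ‖x‖) ^ k)⁻¹) := by gcongr; exact hC x
      _ = _ := by field_simp

/-- The embedding of the Schwartz space into `L²_s`. -/
def toL {d : ℕ} (s : ℝ) : 𝓢(E d, ℂ) →L[ℂ] L2s d s :=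
  SchwartzMap.toLpCLM ℂ ℂ 2 (weightMeasure d s)

lemma toL_coe {d : ℕ} (s : ℝ) (φ : 𝓢(E d, ℂ)) : toL s φ =ᵐ[volume] φ :=
  ae_volume_of_ae_weightMeasure (SchwartzMap.coeFn_toLp φ 2 (weightMeasure d s))

lemma toL_dense {d : ℕ} (s : ℝ) : DenseRange (toL s : 𝓢(E d, ℂ) → L2s d s) :=
  SchwartzMap.denseRange_toLpCLM (F := ℂ) (μ := weightMeasure d s) ENNReal.ofNat_ne_top

attribute [irreducible] toL

/-- Multiplication of a Schwartz function by a real function of temperate growth. -/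
def mulS {d : ℕ} (g : E d → ℝ) : 𝓢(E d, ℂ) →L[ℂ] 𝓢(E d, ℂ) :=
  SchwartzMap.smulLeftCLM ℂ (fun x => (g x : ℂ))

lemma ofReal_temperate {d : ℕ} {g : E d → ℝ} (hg : g.HasTemperateGrowth) :
    Function.HasTemperateGrowth (fun x => (g x : ℂ)) :=
  Function.HasTemperateGrowth.comp Function.Complex.hasTemperateGrowth_ofReal hg

lemma mulS_apply {d : ℕ} {g : E d → ℝ} (hg : g.HasTemperateGrowth) (φ : 𝓢(E d, ℂ)) (x : E d) :
    mulS g φ x = g x * φ x :=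
  SchwartzMap.smulLeftCLM_apply_apply (ofReal_temperate hg) φ x

attribute [irreducible] mulS

/-- Complex conjugation of Schwartz functions. -/
def conjS {d : ℕ} (φ : 𝓢(E d, ℂ)) : 𝓢(E d, ℂ) :=
  SchwartzMap.postcompCLM (𝕜 := ℝ) (Complex.conjCLE : ℂ →L[ℝ] ℂ) φ

lemma conjS_apply {d : ℕ} (φ : 𝓢(E d, ℂ)) (x : E d) : conjS φ x = starRingEnd ℂ (φ x) := rfl

lemma inner_toL {d : ℕ} (s : ℝ) (φ : 𝓢(E d, ℂ)) (f : L2s d s) :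
    inner ℂ (toL s φ) f = ∫ x, f x * (mulS (wt s) (conjS φ)) x := by
  rw [L2.inner_def, integral_weightMeasure]
  refine integral_congr_ae ?_
  filter_upwards [toL_coe s φ] with x hx
  rw [hx, mulS_apply (wt_temperate s), conjS_apply]
  simp only [RCLike.inner_apply, Complex.real_smul]
  ring

lemma inner_toL_toL {d : ℕ} (s : ℝ) (φ ψ : 𝓢(E d, ℂ)) :
    inner ℂ (toL s φ) (toL s ψ) = ∫ x, ψ x * (mulS (wt s) (conjS φ)) x := by
  rw [inner_toL]
  refine integral_congr_ae ?_
  filter_upwards [toL_coe s ψ] with x hx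
  rw [hx]

lemma norm_toL_sq {d : ℕ} (s : ℝ) (φ : 𝓢(E d, ℂ)) :
    ‖toL s φ‖ ^ 2 = ∫ x, wt s x * ‖φ x‖ ^ 2 := by
  have h : ((‖toL s φ‖ ^ 2 : ℝ) : ℂ) = ((∫ x, wt s x * ‖φ x‖ ^ 2 : ℝ) : ℂ) := by
    rw [← integral_complex_ofReal, Complex.ofReal_pow]
    refine (inner_self_eq_norm_sq_to_K (𝕜 := ℂ) (toL s φ)).symm.trans ?_
    rw [inner_toL_toL]
    refine integral_congr_ae (ae_of_all _ fun x => ?_)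
    simp only [mulS_apply (wt_temperate s), conjS_apply]
    push_cast
    rw [← Complex.mul_conj']
    ring
  exact_mod_cast h

lemma integrable_wt_norm_sq {d : ℕ} (s : ℝ) (φ : 𝓢(E d, ℂ)) :
    Integrable fun x => wt s x * ‖φ x‖ ^ 2 := by
  have := (memLp_two_iff_integrable_sq_norm (by fun_prop)).1 (φ.memLp 2 (weightMeasure d s))
  exact (integrable_weightMeasure _).1 this

lemma norm_toL_le_of_norm_le {d : ℕ} {s r C : ℝ} (hC : 0 ≤ C) {φ ψ : 𝓢(E d, ℂ)}
    (h : ∀ x, wt s x * ‖φ x‖ ^ 2 ≤ C ^ 2 * (wt r x * ‖ψ x‖ ^ 2)) : ‖toL s φ‖ ≤ C * ‖toL r ψ‖ := by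
  refine le_of_sq_le_sq ?_ (by positivity) |>.trans le_rfl
  rw [mul_pow, norm_toL_sq, norm_toL_sq, ← integral_const_mul]
  exact integral_mono (integrable_wt_norm_sq s φ) ((integrable_wt_norm_sq r ψ).const_mul _) h

lemma norm_toL_eq_of_norm_eq {d : ℕ} {s r : ℝ} {φ ψ : 𝓢(E d, ℂ)}
    (h : ∀ x, wt s x * ‖φ x‖ ^ 2 = wt r x * ‖ψ x‖ ^ 2) : ‖toL s φ‖ = ‖toL r ψ‖ := by
  refine (sq_eq_sq₀ (norm_nonneg _) (norm_nonneg _)).1 ?_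
  rw [norm_toL_sq, norm_toL_sq]
  simp only [h]

/-- The Schwartz function representing the pairing with `φ` as an inner product. -/
def dualS {d : ℕ} (s : ℝ) (φ : 𝓢(E d, ℂ)) : 𝓢(E d, ℂ) := mulS (wt (-s)) (conjS φ)

lemma dualS_apply {d : ℕ} (s : ℝ) (φ : 𝓢(E d, ℂ)) (x : E d) :
    dualS s φ x = wt (-s) x * starRingEnd ℂ (φ x) := by
  rw [dualS, mulS_apply (wt_temperate _), conjS_apply]

/-- The pairing `f ↦ ∫ f φ` on `L²_s`. -/
def pair {d : ℕ} (s : ℝ) (φ : 𝓢(E d, ℂ)) : L2s d s →L[ℂ] ℂ := innerSL ℂ (toL s (dualS s φ))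

lemma pair_apply {d : ℕ} (s : ℝ) (φ : 𝓢(E d, ℂ)) (f : L2s d s) :
    pair s φ f = ∫ x, f x * φ x := by
  rw [pair, innerSL_apply_apply, inner_toL]
  refine integral_congr_ae (ae_of_all _ fun x => ?_)
  simp only [mulS_apply (wt_temperate _), conjS_apply, dualS_apply, map_mul, Complex.conj_ofReal,
    Complex.conj_conj]
  have : ((wt s x : ℝ) : ℂ) * ((wt (-s) x : ℝ) : ℂ) = 1 := by exact_mod_cast wt_mul_neg s x
  rw [← mul_assoc ((wt s x : ℝ) : ℂ), this, one_mul]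

/-- The factor `⟨x⟩^{-2s}` turns the `L²_{-s}` norm exactly into the `L²_s` norm. Through it
`L²_{-s}` acts as the dual of `L²_s` for the unweighted pairing `∫ f φ`, in which even multipliers
are their own transposes. -/
lemma norm_toL_dualS {d : ℕ} (s : ℝ) (φ : 𝓢(E d, ℂ)) : ‖toL s (dualS s φ)‖ = ‖toL (-s) φ‖ := by
  refine norm_toL_eq_of_norm_eq fun x => ?_
  rw [dualS_apply, norm_mul, Complex.norm_real, RCLike.norm_conj, Real.norm_of_nonneg (wt_pos _ _).le]
  linear_combination wt (-s) x * ‖φ x‖ ^ 2 * wt_mul_neg s x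

lemma norm_integral_mul_le {d : ℕ} (s : ℝ) (φ ψ : 𝓢(E d, ℂ)) :
    ‖∫ x, φ x * ψ x‖ ≤ ‖toL s φ‖ * ‖toL (-s) ψ‖ := by
  have h : ∫ x, φ x * ψ x = pair s ψ (toL s φ) := by
    rw [pair_apply]
    refine integral_congr_ae ?_
    filter_upwards [toL_coe s φ] with x hx
    rw [hx]
  rw [h, pair, innerSL_apply_apply, mul_comm, ← norm_toL_dualS]
  exact norm_inner_le_norm _ _

lemma pair_toL {d : ℕ} (s : ℝ) (φ ψ : 𝓢(E d, ℂ)) : pair s ψ (toL s φ) = ∫ x, φ x * ψ x := by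
  rw [pair_apply]
  refine integral_congr_ae ?_
  filter_upwards [toL_coe s φ] with x hx
  rw [hx]

lemma L2s_locallyIntegrable {d : ℕ} {s : ℝ} (f : L2s d s) : LocallyIntegrable f := by
  have h : LocallyIntegrable (fun x => wt s x • f x) := by
    refine locallyIntegrable_iff.2 fun K hK => ?_
    have h1 : IntegrableOn f K (weightMeasure d s) :=
      ((Lp.memLp f).locallyIntegrable one_le_two).integrableOn_isCompact hK
    rw [← integrable_indicator_iff hK.measurableSet, integrable_weightMeasure] at h1
    rw [← integrable_indicator_iff hK.measurableSet]
    refine h1.congr (ae_of_all _ fun x => ?_)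
    by_cases hx : x ∈ K <;> simp [hx]
  have h2 := (locallyIntegrableOn_univ.2 h).continuousOn_smul isOpen_univ.isLocallyClosed
    (continuous_wt (-s)).continuousOn
  refine (locallyIntegrableOn_univ.1 h2).congr (ae_of_all _ fun x => ?_)
  simp only [smul_smul]
  rw [mul_comm, wt_mul_neg, one_smul]

lemma ae_eq_of_integral_mul_schwartz {d : ℕ} {f g : E d → ℂ} (hf : LocallyIntegrable f)
    (hg : LocallyIntegrable g) (h : ∀ φ : 𝓢(E d, ℂ), ∫ x, f x * φ x = ∫ x, g x * φ x) :
    f =ᵐ[volume] g := by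
  refine ae_eq_of_integral_contDiff_smul_eq hf hg fun η hη hc => ?_
  have h1 : HasCompactSupport (Complex.ofRealCLM ∘ η) := hc.comp_left rfl
  have h2 : ContDiff ℝ (⊤ : ℕ∞) (Complex.ofRealCLM ∘ η) := by fun_prop
  have := h (h1.toSchwartzMap h2)
  simpa [mul_comm] using this

/-- Identities in `L²_s` are thereby checked against Schwartz functions, on which multipliers and
derivatives are explicit. -/
lemma L2s_ext_of_pair {d : ℕ} {s : ℝ} {f g : L2s d s} (h : ∀ φ, pair s φ f = pair s φ g) :
    f = g := by
  refine L2s_ext (ae_eq_of_integral_mul_schwartz (L2s_locallyIntegrable f)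
    (L2s_locallyIntegrable g) fun φ => ?_)
  rw [← pair_apply, ← pair_apply, h]

/-- The inclusion of `L²(ν)` into `L²(μ)` for `μ ≤ ν`. -/
def lpMono {α : Type*} [MeasurableSpace α] {μ ν : Measure α} (h : μ ≤ ν) :
    Lp ℂ 2 ν →L[ℂ] Lp ℂ 2 μ :=
  LinearMap.mkContinuous
    { toFun := fun f => ((Lp.memLp f).mono_measure h).toLp f
      map_add' := fun f g => by
        refine Lp.ext ?_
        filter_upwards [MemLp.coeFn_toLp ((Lp.memLp (f + g)).mono_measure h),
          Lp.coeFn_add (((Lp.memLp f).mono_measure h).toLp f)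
            (((Lp.memLp g).mono_measure h).toLp g),
          MemLp.coeFn_toLp ((Lp.memLp f).mono_measure h),
          MemLp.coeFn_toLp ((Lp.memLp g).mono_measure h),
          (Measure.absolutelyContinuous_of_le h).ae_le (Lp.coeFn_add f g)] with x h1 h2 h3 h4 h5
        rw [h1, h2, Pi.add_apply, h3, h4, h5, Pi.add_apply]
      map_smul' := fun c f => by
        refine Lp.ext ?_
        filter_upwards [MemLp.coeFn_toLp ((Lp.memLp (c • f)).mono_measure h),
          Lp.coeFn_smul c (((Lp.memLp f).mono_measure h).toLp f),
          MemLp.coeFn_toLp ((Lp.memLp f).mono_measure h),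
          (Measure.absolutelyContinuous_of_le h).ae_le (Lp.coeFn_smul c f)] with x h1 h2 h3 h5
        rw [h1, RingHom.id_apply, h2, Pi.smul_apply, h3, h5, Pi.smul_apply] } 1 fun f => by
    rw [one_mul]
    change ‖((Lp.memLp f).mono_measure h).toLp f‖ ≤ ‖f‖
    rw [Lp.norm_toLp]
    exact ENNReal.toReal_mono (Lp.eLpNorm_ne_top f) (eLpNorm_mono_measure _ h)

lemma lpMono_coe {α : Type*} [MeasurableSpace α] {μ ν : Measure α} (h : μ ≤ ν) (f : Lp ℂ 2 ν) :
    lpMono h f =ᵐ[μ] f := MemLp.coeFn_toLp ((Lp.memLp f).mono_measure h)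

/-- The inclusion `L²_s ⊆ L²_r` for `r ≤ s`. -/
def incl {d : ℕ} {s r : ℝ} (h : r ≤ s) : L2s d s →L[ℂ] L2s d r := lpMono (weightMeasure_mono h)

lemma incl_coe {d : ℕ} {s r : ℝ} (h : r ≤ s) (f : L2s d s) : incl h f =ᵐ[volume] f :=
  ae_volume_of_ae_weightMeasure (lpMono_coe (weightMeasure_mono h) f)

lemma pair_congr {d : ℕ} {s r : ℝ} (φ : 𝓢(E d, ℂ)) {f : L2s d s} {g : L2s d r}
    (h : f =ᵐ[volume] g) : pair s φ f = pair r φ g := by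
  rw [pair_apply, pair_apply]
  refine integral_congr_ae ?_
  filter_upwards [h] with x hx
  rw [hx]

lemma incl_toL {d : ℕ} {s r : ℝ} (h : r ≤ s) (φ : 𝓢(E d, ℂ)) : incl h (toL s φ) = toL r φ :=
  L2s_ext (((incl_coe h _).trans (toL_coe s φ)).trans (toL_coe r φ).symm)

/-! ### Integration by parts in weighted spaces -/

/-- The `j`-th unit vector. -/
abbrev ev {d : ℕ} (j : Fin d) : E d := EuclideanSpace.single j (1 : ℝ)

/-- The logarithmic derivative of the weight in the `j`-th direction. -/
def logw {d : ℕ} (s : ℝ) (j : Fin d) (x : E d) : ℝ := 2 * s * inner ℝ x (ev j) * wt (-1) x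

lemma logw_temperate {d : ℕ} (s : ℝ) (j : Fin d) : (logw s j).HasTemperateGrowth := by
  have := wt_temperate (d := d) (-1)
  unfold logw
  fun_prop

/-- Since `|x| ≤ 1 + |x|²`, differentiating the weight costs only a bounded factor. All the weighted
estimates below rest on this. -/
lemma abs_logw_le {d : ℕ} (s : ℝ) (j : Fin d) (x : E d) : |logw s j x| ≤ 2 * |s| := by
  have h1 : |inner ℝ x (ev j)| ≤ ‖x‖ := by
    simpa using abs_real_inner_le_norm x (ev j)
  have h2 : ‖x‖ * wt (-1) x ≤ 1 := by
    rw [wt, Real.rpow_neg_one, ← div_eq_mul_inv, div_le_one (by positivity)]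
    nlinarith [sq_nonneg (‖x‖ - 1)]
  rw [logw, abs_mul, abs_mul, abs_mul, abs_two, abs_of_pos (wt_pos _ _)]
  have := mul_le_mul_of_nonneg_right h1 (wt_pos (-1) x).le
  have h3 := abs_nonneg s
  calc 2 * |s| * |inner ℝ x (ev j)| * wt (-1) x
      = 2 * |s| * (|inner ℝ x (ev j)| * wt (-1) x) := by ring
    _ ≤ 2 * |s| * 1 := by gcongr; linarith
    _ = _ := by ring

lemma hasFDerivAt_wt {d : ℕ} (s : ℝ) (x : E d) :
    HasFDerivAt (wt s) (wt s x • ((2 * s * wt (-1) x) • innerSL ℝ x)) x := by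
  have h0 : HasFDerivAt (fun y : E d => 1 + ‖y‖ ^ 2) (2 • innerSL ℝ x) x :=
    (hasStrictFDerivAt_norm_sq x).hasFDerivAt.const_add 1
  have h1 := h0.rpow_const (p := s) (Or.inl (by positivity))
  refine h1.congr_fderiv ?_
  ext y
  have e : (1 + ‖x‖ ^ 2 : ℝ) ^ (s - 1) = wt s x * wt (-1) x := by rw [← wt_add]; rfl
  simp only [smul_apply, smul_eq_mul, e, innerSL_apply_apply, nsmul_eq_mul]
  push_cast
  ring

lemma lineDeriv_mulS {d : ℕ} {g : E d → ℝ} (hg : g.HasTemperateGrowth) {g' : E d → ℝ}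
    (hg' : g'.HasTemperateGrowth) (m : E d) (h : ∀ x, fderiv ℝ g x m = g' x) (φ : 𝓢(E d, ℂ)) :
    ∂_{m} (mulS g φ) = mulS g' φ + mulS g (∂_{m} φ) := by
  ext x
  have hgd : DifferentiableAt ℝ g x := (hg.1.differentiable (by simp)).differentiableAt
  have e : (mulS g φ : E d → ℂ) = fun x => g x • φ x := by
    ext x; rw [mulS_apply hg]; simp
  rw [SchwartzMap.lineDerivOp_apply_eq_fderiv, e, fderiv_fun_smul hgd φ.differentiableAt]
  simp only [add_apply, mulS_apply hg, mulS_apply hg',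
    SchwartzMap.lineDerivOp_apply_eq_fderiv, ← h]
  simp [add_comm]

lemma lineDeriv_conjS {d : ℕ} (m : E d) (φ : 𝓢(E d, ℂ)) : ∂_{m} (conjS φ) = conjS (∂_{m} φ) := by
  ext x
  rw [SchwartzMap.lineDerivOp_apply_eq_fderiv]
  have e : (conjS φ : E d → ℂ) = (Complex.conjCLE : ℂ →L[ℝ] ℂ) ∘ φ := rfl
  rw [e, (((Complex.conjCLE : ℂ →L[ℝ] ℂ).hasFDerivAt).comp x φ.differentiableAt.hasFDerivAt).fderiv]
  rw [conjS_apply, SchwartzMap.lineDerivOp_apply_eq_fderiv]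
  rfl

lemma mulS_logw_le {d : ℕ} (s : ℝ) (j : Fin d) (φ : 𝓢(E d, ℂ)) :
    ‖toL s (mulS (logw s j) φ)‖ ≤ 2 * |s| * ‖toL s φ‖ := by
  refine norm_toL_le_of_norm_le (by positivity) fun x => ?_
  rw [mulS_apply (logw_temperate s j), norm_mul, Complex.norm_real, Real.norm_eq_abs]
  have h1 := abs_logw_le s j x
  have h2 : |logw s j x| ^ 2 ≤ (2 * |s|) ^ 2 := by gcongr
  have h3 := (wt_pos s x).le
  calc wt s x * (|logw s j x| * ‖φ x‖) ^ 2 = |logw s j x| ^ 2 * (wt s x * ‖φ x‖ ^ 2) := by ring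
    _ ≤ _ := by gcongr

/-- Integration by parts in `L²_s`. -/
lemma inner_lineDeriv {d : ℕ} (s : ℝ) (j : Fin d) (φ ψ : 𝓢(E d, ℂ)) :
    inner ℂ (toL s (∂_{ev j} φ)) (toL s ψ) =
      -inner ℂ (toL s φ) (toL s (∂_{ev j} ψ)) -
        inner ℂ (toL s φ) (toL s (mulS (logw s j) ψ)) := by
  have hw : ∀ x : E d, fderiv ℝ (wt s) x (ev j) = (fun x => wt s x * logw s j x) x := fun x => by
    rw [(hasFDerivAt_wt s x).fderiv]
    simp only [smul_apply, innerSL_apply_apply, smul_eq_mul, logw]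
    ring
  have hwt := wt_temperate (d := d) s
  have hl := logw_temperate s j
  have hwl : (fun x : E d => wt s x * logw s j x).HasTemperateGrowth := by fun_prop
  have key := SchwartzMap.integral_mul_lineDerivOp_right_eq_neg_left (μ := volume) (mulS (wt s) ψ)
    (conjS φ) (ev j)
  rw [lineDeriv_mulS hwt hwl _ hw, lineDeriv_conjS] at key
  rw [inner_toL_toL, inner_toL_toL, inner_toL_toL, ← integral_neg, ← integral_sub]
  · rw [← integral_neg] at key
    convert key using 1
    · refine integral_congr_ae (ae_of_all _ fun x => ?_)
      simp only [mulS_apply hwt]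
      ring
    · refine integral_congr_ae (ae_of_all _ fun x => ?_)
      simp only [mulS_apply hwt, mulS_apply hl, add_apply, mulS_apply hwl]
      push_cast
      ring
  · exact (SchwartzMap.integrable (SchwartzMap.pairing (ContinuousLinearMap.mul ℂ ℂ) (∂_{ev j} ψ)
      (mulS (wt s) (conjS φ)))).neg
  · exact SchwartzMap.integrable (SchwartzMap.pairing (ContinuousLinearMap.mul ℂ ℂ)
      (mulS (logw s j) ψ) (mulS (wt s) (conjS φ)))

/-! ### Radial symbols -/

/-- The radial symbol `∫₀^A h(τ) cos(2π|ξ|τ) dτ`. -/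
def cosInt {d : ℕ} (h : ℝ → ℝ) (A : ℝ) (ξ : E d) : ℝ :=
  ∫ τ in (0 : ℝ)..A, h τ * Real.cos (2 * Real.pi * ‖ξ‖ * τ)

/-- The function is `sin(lτ)/l` in a form that also makes sense at `l = 0`. -/
lemma hasDerivAt_mul_sinc (l t : ℝ) :
    HasDerivAt (fun τ : ℝ => τ * Real.sinc (l * τ)) (Real.cos (l * t)) t := by
  rcases eq_or_ne l 0 with rfl | hl
  · simpa using hasDerivAt_id' t
  · have e : (fun τ : ℝ => τ * Real.sinc (l * τ)) = fun τ => Real.sin (l * τ) / l := by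
      ext τ
      rcases eq_or_ne τ 0 with rfl | hτ
      · simp
      · rw [Real.sinc_of_ne_zero (by positivity)]
        field_simp
    rw [e]
    have h := ((hasDerivAt_id t).const_mul l).sin.div_const l
    simp only [id, mul_one] at h
    rwa [mul_div_cancel_right₀ _ hl] at h

/-- The cosine is even, so its composition with the norm is differentiable at the origin as well,
where `1 - cos` is quadratically small. Elsewhere `sinc` absorbs the division by `‖ξ‖`. -/
lemma hasFDerivAt_cos_norm {d : ℕ} (τ : ℝ) (ξ : E d) :
    HasFDerivAt (fun ξ : E d => Real.cos (2 * Real.pi * ‖ξ‖ * τ))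
      (-((2 * Real.pi) ^ 2 * τ * (τ * Real.sinc (2 * Real.pi * ‖ξ‖ * τ))) • innerSL ℝ ξ) ξ := by
  rcases eq_or_ne ξ 0 with rfl | hξ
  · simp only [map_zero, smul_zero]
    rw [hasFDerivAt_iff_isLittleO_nhds_zero]
    simp only [norm_zero, zero_add, mul_zero, zero_mul, Real.cos_zero,
      zero_apply, sub_zero]
    refine Asymptotics.IsBigO.trans_isLittleO (g := fun x : E d => ‖x‖ ^ 2) ?_ ?_
    · refine Asymptotics.IsBigO.of_bound ((2 * Real.pi * τ) ^ 2 / 2) (.of_forall fun x => ?_)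
      rw [Real.norm_eq_abs, abs_sub_comm, abs_of_nonneg (by linarith [Real.cos_le_one (2 * Real.pi * ‖x‖ * τ)]),
        Real.norm_of_nonneg (by positivity)]
      have := Real.one_sub_sq_div_two_le_cos (x := 2 * Real.pi * ‖x‖ * τ)
      nlinarith
    · have h1 : (fun x : E d => ‖x‖ ^ 2) =o[𝓝 0] fun x => ‖x‖ ^ 1 :=
        Asymptotics.isLittleO_norm_pow_norm_pow one_lt_two
      exact Asymptotics.isLittleO_norm_right.1 (by simpa using h1)
  · have hn : 0 < ‖ξ‖ := norm_pos_iff.2 hξ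
    have h0 : HasFDerivAt (fun x : E d => ‖x‖) (‖ξ‖⁻¹ • innerSL ℝ ξ) ξ := by
      have h1 := (hasStrictFDerivAt_norm_sq ξ).hasFDerivAt.sqrt (by positivity)
      simp only [Real.sqrt_sq (norm_nonneg _)] at h1
      refine h1.congr_fderiv ?_
      ext y
      simp
      field_simp
    have h2 := ((h0.const_mul (2 * Real.pi)).mul_const τ).cos
    refine h2.congr_fderiv ?_
    ext y
    simp only [smul_apply, smul_eq_mul, innerSL_apply_apply]
    rcases eq_or_ne τ 0 with rfl | hτ
    · simp
    · rw [Real.sinc_of_ne_zero (by positivity)]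
      field_simp

/-- The function `τ ↦ ∫_τ^A b h(b) db`. -/
def cosIntNext (h : ℝ → ℝ) (A τ : ℝ) : ℝ := ∫ b in τ..A, b * h b

lemma hasDerivAt_cosIntNext {h : ℝ → ℝ} (hh : Continuous h) (A τ : ℝ) :
    HasDerivAt (cosIntNext h A) (-(τ * h τ)) τ := by
  have hc : Continuous fun b => b * h b := by fun_prop
  exact intervalIntegral.integral_hasDerivAt_left (hc.intervalIntegrable _ _)
    (hc.stronglyMeasurableAtFilter _ _) hc.continuousAt

lemma continuous_cosIntNext {h : ℝ → ℝ} (hh : Continuous h) (A : ℝ) :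
    Continuous (cosIntNext h A) :=
  continuous_iff_continuousAt.2 fun τ => (hasDerivAt_cosIntNext hh A τ).continuousAt

/-- Integration by parts without boundary terms: `cosIntNext h A` vanishes at `A`, and `τ sinc(lτ)`
vanishes at `0`. -/
lemma integral_mul_sinc {h : ℝ → ℝ} (hh : Continuous h) (A l : ℝ) :
    ∫ τ in (0 : ℝ)..A, h τ * τ * (τ * Real.sinc (l * τ)) =
      ∫ τ in (0 : ℝ)..A, cosIntNext h A τ * Real.cos (l * τ) := by
  have hc := continuous_cosIntNext hh A
  have hc' : Continuous fun τ : ℝ => -(τ * h τ) := by fun_prop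
  have hc'' : Continuous fun τ : ℝ => Real.cos (l * τ) := by fun_prop
  rw [intervalIntegral.integral_mul_deriv_eq_deriv_mul (fun x _ => hasDerivAt_cosIntNext hh A x)
    (fun x _ => hasDerivAt_mul_sinc l x) (hc'.intervalIntegrable _ _) (hc''.intervalIntegrable _ _)]
  simp only [cosIntNext, intervalIntegral.integral_same, zero_mul, mul_zero, sub_zero, zero_sub,
    ← intervalIntegral.integral_neg]
  refine intervalIntegral.integral_congr fun τ _ => ?_
  ring

/-- Up to the linear factor `ξ`, the gradient is again a cosine integral, of the kernel `cosIntNext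
h A`. The class of symbols is thus stable under differentiation, and the non-smoothness of `‖ξ‖` at
the origin never enters. -/
lemma hasFDerivAt_cosInt {d : ℕ} {h : ℝ → ℝ} (hh : Continuous h) (A : ℝ) (ξ : E d) :
    HasFDerivAt (cosInt h A)
      ((-(2 * Real.pi) ^ 2 * cosInt (cosIntNext h A) A ξ) • innerSL ℝ ξ) ξ := by
  have hsinc : Continuous Real.sinc := Real.continuous_sinc
  have h1 : HasFDerivAt (cosInt h A) (∫ τ in (0 : ℝ)..A,
      h τ • (-((2 * Real.pi) ^ 2 * τ * (τ * Real.sinc (2 * Real.pi * ‖ξ‖ * τ))) • innerSL ℝ ξ)) ξ := by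
    refine (intervalIntegral.hasFDerivAt_integral_of_dominated_of_fderiv_le
      (F := fun ξ τ => h τ * Real.cos (2 * Real.pi * ‖ξ‖ * τ))
      (F' := fun (ξ : E d) τ => h τ • (-((2 * Real.pi) ^ 2 * τ *
        (τ * Real.sinc (2 * Real.pi * ‖ξ‖ * τ))) • innerSL ℝ ξ))
      (bound := fun τ => |h τ| * ((2 * Real.pi) ^ 2 * |τ| * |τ| * (‖ξ‖ + 1)))
      (Metric.ball_mem_nhds ξ one_pos) ?_ ?_ ?_ ?_ ?_ ?_)
    · refine .of_forall fun x => Continuous.aestronglyMeasurable (by fun_prop)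
    · exact Continuous.intervalIntegrable (by fun_prop) _ _
    · exact Continuous.aestronglyMeasurable (by fun_prop)
    · refine ae_of_all _ fun τ _ x hx => ?_
      rw [norm_smul, norm_smul, innerSL_apply_norm, norm_neg, norm_mul, norm_mul, norm_mul]
      have hx' : ‖x‖ ≤ ‖ξ‖ + 1 := by
        have := norm_sub_norm_le x ξ
        have := mem_ball_iff_norm.1 hx
        linarith
      have h3 : ‖Real.sinc (2 * Real.pi * ‖x‖ * τ)‖ ≤ 1 := by
        simpa using Real.abs_sinc_le_one _
      simp only [Real.norm_eq_abs] at h3 ⊢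
      rw [abs_of_nonneg (by positivity : (0:ℝ) ≤ (2 * Real.pi) ^ 2)]
      have h4 : |τ| * |Real.sinc (2 * Real.pi * ‖x‖ * τ)| ≤ |τ| :=
        mul_le_of_le_one_right (abs_nonneg _) h3
      gcongr
    · exact Continuous.intervalIntegrable (by fun_prop) _ _
    · exact ae_of_all _ fun τ _ x _ => (hasFDerivAt_cos_norm τ x).const_mul (h τ)
  refine h1.congr_fderiv ?_
  simp only [smul_smul]
  rw [intervalIntegral.integral_smul_const]
  congr 1
  rw [cosInt, ← integral_mul_sinc hh, ← intervalIntegral.integral_const_mul]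
  refine intervalIntegral.integral_congr fun τ _ => ?_
  ring

lemma abs_cosInt_le {d : ℕ} {h : ℝ → ℝ} (hh : Continuous h) {A : ℝ} (hA : 0 ≤ A) (ξ : E d) :
    |cosInt h A ξ| ≤ ∫ τ in (0 : ℝ)..A, |h τ| := by
  rw [cosInt]
  refine (intervalIntegral.abs_integral_le_integral_abs hA).trans ?_
  refine intervalIntegral.integral_mono_on hA (Continuous.intervalIntegrable (by fun_prop) _ _)
    (Continuous.intervalIntegrable (by fun_prop) _ _) fun τ _ => ?_
  rw [abs_mul]
  exact mul_le_of_le_one_right (abs_nonneg _) (Real.abs_cos_le_one _)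

/-- Induction on the order, for all kernels at once since the gradient involves another kernel.
Leibniz' rule is applied to the product of the new symbol with the linear map `ξ ↦ ⟨ξ, ·⟩`. -/
lemma cosInt_bound_aux {d : ℕ} {A : ℝ} (hA : 0 ≤ A) (n : ℕ) : ∀ h : ℝ → ℝ, Continuous h →
    ContDiff ℝ n (cosInt h A : E d → ℝ) ∧
      ∀ m ≤ n, ∃ (k : ℕ) (C : ℝ), ∀ ξ : E d,
        ‖iteratedFDeriv ℝ m (cosInt h A) ξ‖ ≤ C * (1 + ‖ξ‖) ^ k := by
  induction n with
  | zero =>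
    intro h hh
    have hc : Continuous (cosInt h A : E d → ℝ) :=
      continuous_iff_continuousAt.2 fun ξ => (hasFDerivAt_cosInt hh A ξ).continuousAt
    refine ⟨contDiff_zero.2 hc, fun m hm => ⟨0, ∫ τ in (0 : ℝ)..A, |h τ|, fun ξ => ?_⟩⟩
    obtain rfl : m = 0 := by omega
    simpa using abs_cosInt_le hh hA ξ
  | succ n ih =>
    intro h hh
    obtain ⟨ih1, ih2⟩ := ih _ (continuous_cosIntNext hh A)
    have hf : fderiv ℝ (cosInt h A : E d → ℝ) = fun ξ =>
        (-(2 * Real.pi) ^ 2 * cosInt (cosIntNext h A) A ξ) • innerSL ℝ ξ :=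
      funext fun ξ => (hasFDerivAt_cosInt hh A ξ).fderiv
    have hcd : ContDiff ℝ (n + 1 : ℕ) (cosInt h A : E d → ℝ) := by
      push_cast
      refine contDiff_succ_iff_fderiv.2 ⟨fun ξ => (hasFDerivAt_cosInt hh A ξ).differentiableAt,
        by simp, ?_⟩
      rw [hf]
      exact (contDiff_const.mul ih1).smul (innerSL ℝ).contDiff
    refine ⟨hcd, fun m hm => ?_⟩
    rcases m with _ | m
    · exact ⟨0, ∫ τ in (0 : ℝ)..A, |h τ|, fun ξ => by simpa using abs_cosInt_le hh hA ξ⟩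
    have hm' : m ≤ n := by omega
    have hL : Function.HasTemperateGrowth (fun ξ : E d => innerSL ℝ ξ) :=
      (innerSL ℝ (E := E d)).hasTemperateGrowth
    obtain ⟨k₂, C₂, hC₂0, hC₂⟩ := hL.norm_iteratedFDeriv_le_uniform m
    choose k C hkC using ih2
    -- Only the orders up to `m` occur; the sums of their exponents and of their constants serve all
    -- of them simultaneously.
    let K := ∑ i ∈ (Finset.range (m + 1)).attach,
      k i.1 ((Nat.lt_succ_iff.1 (Finset.mem_range.1 i.2)).trans hm')
    let C' := ∑ i ∈ (Finset.range (m + 1)).attach,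
      |C i.1 ((Nat.lt_succ_iff.1 (Finset.mem_range.1 i.2)).trans hm')|
    have hb : ∀ i ≤ m, ∀ ξ : E d,
        ‖iteratedFDeriv ℝ i (cosInt (cosIntNext h A) A) ξ‖ ≤ C' * (1 + ‖ξ‖) ^ K := by
      intro i hi ξ
      have hir : i ∈ Finset.range (m + 1) := Finset.mem_range.2 (by omega)
      refine (hkC i (hi.trans hm') ξ).trans ?_
      have h1 : k i (hi.trans hm') ≤ K := Finset.single_le_sum
        (f := fun i : (Finset.range (m + 1)) =>
          k i.1 ((Nat.lt_succ_iff.1 (Finset.mem_range.1 i.2)).trans hm'))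
        (fun _ _ => Nat.zero_le _) (Finset.mem_attach _ ⟨i, hir⟩)
      have h2 : |C i (hi.trans hm')| ≤ C' := Finset.single_le_sum
        (f := fun i : (Finset.range (m + 1)) =>
          |C i.1 ((Nat.lt_succ_iff.1 (Finset.mem_range.1 i.2)).trans hm')|)
        (fun _ _ => abs_nonneg _) (Finset.mem_attach _ ⟨i, hir⟩)
      have h3 : (1 : ℝ) ≤ 1 + ‖ξ‖ := by linarith [norm_nonneg ξ]
      calc C i (hi.trans hm') * (1 + ‖ξ‖) ^ k i (hi.trans hm')
          ≤ |C i (hi.trans hm')| * (1 + ‖ξ‖) ^ k i (hi.trans hm') := by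
            gcongr; exact le_abs_self _
        _ ≤ C' * (1 + ‖ξ‖) ^ K := by gcongr
    have hC'0 : 0 ≤ C' := Finset.sum_nonneg fun _ _ => abs_nonneg _
    refine ⟨K + k₂, (2 * Real.pi) ^ 2 * ∑ i ∈ Finset.range (m + 1), (m.choose i : ℝ) * C' * C₂,
      fun ξ => ?_⟩
    rw [← norm_iteratedFDeriv_fderiv, hf]
    have e : (fun ξ : E d => (-(2 * Real.pi) ^ 2 * cosInt (cosIntNext h A) A ξ) • innerSL ℝ ξ) =
        (-(2 * Real.pi) ^ 2 : ℝ) • fun ξ : E d => cosInt (cosIntNext h A) A ξ • innerSL ℝ ξ := by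
      ext ξ; simp [mul_assoc]
    have hsm : ContDiff ℝ m fun ξ : E d => cosInt (cosIntNext h A) A ξ • innerSL ℝ ξ :=
      (ih1.of_le (by exact_mod_cast hm')).smul (innerSL ℝ).contDiff
    rw [e, iteratedFDeriv_const_smul_apply hsm.contDiffAt, norm_smul, norm_neg,
      Real.norm_of_nonneg (by positivity), mul_assoc]
    gcongr
    refine (ContinuousLinearMap.norm_iteratedFDeriv_le_of_bilinear_of_le_one
      (ContinuousLinearMap.lsmul ℝ ℝ) (n := m) (N := n) ih1
        ((innerSL ℝ (E := E d)).contDiff) ξ (by exact_mod_cast hm') ContinuousLinearMap.opNorm_lsmul_le).trans ?_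
    · rw [Finset.sum_mul]
      refine Finset.sum_le_sum fun i hi => ?_
      have hi' : i ≤ m := Nat.lt_succ_iff.1 (Finset.mem_range.1 hi)
      calc _ ≤ (m.choose i : ℝ) * (C' * (1 + ‖ξ‖) ^ K) * (C₂ * (1 + ‖ξ‖) ^ k₂) := by
            gcongr
            · exact hb i hi' ξ
            · exact hC₂ (m - i) (Nat.sub_le _ _) ξ
        _ = _ := by rw [pow_add]; ring

lemma cosInt_temperate {d : ℕ} {h : ℝ → ℝ} (hh : Continuous h) {A : ℝ} (hA : 0 ≤ A) :
    (cosInt h A : E d → ℝ).HasTemperateGrowth := by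
  refine ⟨contDiff_infty.2 fun n => (cosInt_bound_aux hA n h hh).1, fun n => ?_⟩
  exact (cosInt_bound_aux hA n h hh).2 n le_rfl

/-- The symbol of `-Δ`. -/
def lapSym {d : ℕ} (ξ : E d) : ℝ := (2 * Real.pi * ‖ξ‖) ^ 2

lemma lapSym_temperate {d : ℕ} : (lapSym : E d → ℝ).HasTemperateGrowth := by
  have : (lapSym : E d → ℝ) = fun ξ => (2 * Real.pi) ^ 2 * ‖ξ‖ ^ 2 := by
    ext ξ; rw [lapSym, mul_pow]
  rw [this]
  have := Function.hasTemperateGrowth_norm_sq (E d)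
  fun_prop

/-- The symbol `cos(2π|ξ|t)`. -/
def cosSym {d : ℕ} (t : ℝ) (ξ : E d) : ℝ := Real.cos (2 * Real.pi * ‖ξ‖ * t)

lemma integral_sub_mul_cos (l t : ℝ) :
    l ^ 2 * ∫ a in (0 : ℝ)..t, (t - a) * Real.cos (l * a) = 1 - Real.cos (l * t) := by
  have h : ∀ a ∈ uIcc (0 : ℝ) t, HasDerivAt (fun a => (t - a) * (l * Real.sin (l * a)) -
      Real.cos (l * a)) (l ^ 2 * ((t - a) * Real.cos (l * a))) a := fun a _ => by
    have hl : HasDerivAt (fun a => l * a) l a := by simpa using (hasDerivAt_id a).const_mul l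
    have h1 := (((hasDerivAt_id a).const_sub t).mul (hl.sin.const_mul l)).sub hl.cos
    refine h1.congr_deriv ?_
    simp only [id_eq]
    ring
  rw [← intervalIntegral.integral_const_mul,
    intervalIntegral.integral_eq_sub_of_hasDerivAt h
      (Continuous.intervalIntegrable (by fun_prop) _ _)]
  simp
  ring

/-- Taylor's formula with integral remainder reduces the cosine, which is a value at one time and
not an integral over time, to a polynomial times a cosine integral. Temperate growth follows. -/
lemma cosSym_eq {d : ℕ} (t : ℝ) (ξ : E d) :
    cosSym t ξ = 1 - lapSym ξ * cosInt (fun a => t - a) t ξ := by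
  rw [lapSym, cosInt, integral_sub_mul_cos, cosSym]; ring

lemma cosSym_temperate {d : ℕ} {t : ℝ} (ht : 0 ≤ t) : (cosSym t : E d → ℝ).HasTemperateGrowth := by
  have h1 := cosInt_temperate (d := d) (h := fun a => t - a) (by fun_prop) ht
  have h2 := lapSym_temperate (d := d)
  have h3 := (Function.HasTemperateGrowth.const (E := E d) (1 : ℝ)).sub (h2.mul h1)
  exact (funext fun ξ => cosSym_eq t ξ : (cosSym t : E d → ℝ) = _) ▸ h3

/-! ### Fourier multipliers on Schwartz functions -/

/-- The Fourier multiplier with real symbol `g`. -/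
def op {d : ℕ} (g : E d → ℝ) : 𝓢(E d, ℂ) →L[ℂ] 𝓢(E d, ℂ) :=
  SchwartzMap.fourierMultiplierCLM ℂ (fun ξ => (g ξ : ℂ))

attribute [irreducible] op

lemma schwartz_ext_fourier {d : ℕ} {φ ψ : 𝓢(E d, ℂ)} (h : ∀ ξ, (𝓕 φ : 𝓢(E d, ℂ)) ξ = (𝓕 ψ : 𝓢(E d, ℂ)) ξ) : φ = ψ := by
  have h1 : (𝓕 φ : 𝓢(E d, ℂ)) = 𝓕 ψ := SchwartzMap.ext h
  have h2 : (𝓕⁻ (𝓕 φ : 𝓢(E d, ℂ)) : 𝓢(E d, ℂ)) = 𝓕⁻ (𝓕 ψ : 𝓢(E d, ℂ)) := by rw [h1]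
  simpa using h2

lemma fourier_op {d : ℕ} {g : E d → ℝ} (hg : g.HasTemperateGrowth) (φ : 𝓢(E d, ℂ)) (ξ : E d) :
    (𝓕 (op g φ) : 𝓢(E d, ℂ)) ξ = g ξ * (𝓕 φ : 𝓢(E d, ℂ)) ξ := by
  rw [op, SchwartzMap.fourierMultiplierCLM_apply, FourierTransform.fourier_fourierInv_eq,
    SchwartzMap.smulLeftCLM_apply_apply (ofReal_temperate hg), smul_eq_mul]

lemma fourier_lineDeriv {d : ℕ} (m : E d) (φ : 𝓢(E d, ℂ)) (ξ : E d) :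
    (𝓕 (∂_{m} φ) : 𝓢(E d, ℂ)) ξ = 2 * Real.pi * Complex.I * inner ℝ ξ m * (𝓕 φ : 𝓢(E d, ℂ)) ξ := by
  have hm : (fun x : E d => inner ℝ x m).HasTemperateGrowth := by fun_prop
  rw [SchwartzMap.fourier_lineDerivOp_eq, smul_apply, SchwartzMap.smulLeftCLM_apply_apply hm]
  simp [mul_assoc]

lemma fourier_laplacian {d : ℕ} (φ : 𝓢(E d, ℂ)) (ξ : E d) :
    (𝓕 (Δ φ) : 𝓢(E d, ℂ)) ξ = -(lapSym ξ : ℂ) * (𝓕 φ : 𝓢(E d, ℂ)) ξ := by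
  have h := Function.hasTemperateGrowth_norm_sq (E d)
  have h' : (‖·‖ ^ 2 : E d → ℝ).HasTemperateGrowth := h
  rw [SchwartzMap.laplacian_eq_fourierMultiplierCLM, FourierTransform.fourier_smul,
    SchwartzMap.fourierMultiplierCLM_apply, FourierTransform.fourier_fourierInv_eq, smul_apply,
    SchwartzMap.smulLeftCLM_apply_apply h', lapSym]
  simp only [Complex.real_smul, mul_pow]
  push_cast
  ring

lemma op_op {d : ℕ} {g h : E d → ℝ} (hg : g.HasTemperateGrowth) (hh : h.HasTemperateGrowth)
    (φ : 𝓢(E d, ℂ)) : op g (op h φ) = op (fun ξ => g ξ * h ξ) φ := by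
  have hgh : (fun ξ => g ξ * h ξ).HasTemperateGrowth := by fun_prop
  refine schwartz_ext_fourier fun ξ => ?_
  rw [fourier_op hg, fourier_op hh, fourier_op hgh]
  push_cast
  ring

lemma op_lineDeriv {d : ℕ} {g : E d → ℝ} (hg : g.HasTemperateGrowth) (m : E d) (φ : 𝓢(E d, ℂ)) :
    op g (∂_{m} φ) = ∂_{m} (op g φ) := by
  refine schwartz_ext_fourier fun ξ => ?_
  rw [fourier_op hg, fourier_lineDeriv, fourier_lineDeriv, fourier_op hg]
  ring

lemma op_laplacian {d : ℕ} {g : E d → ℝ} (hg : g.HasTemperateGrowth) (φ : 𝓢(E d, ℂ)) :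
    op g (Δ φ) = Δ (op g φ) := by
  refine schwartz_ext_fourier fun ξ => ?_
  rw [fourier_op hg, fourier_laplacian, fourier_laplacian, fourier_op hg]
  ring

lemma lineDeriv_comm {d : ℕ} (m n : E d) (φ : 𝓢(E d, ℂ)) : ∂_{m} (∂_{n} φ) = ∂_{n} (∂_{m} φ) := by
  refine schwartz_ext_fourier fun ξ => ?_
  simp only [fourier_lineDeriv]
  ring

lemma lineDeriv_laplacian {d : ℕ} (m : E d) (φ : 𝓢(E d, ℂ)) : ∂_{m} (Δ φ) = Δ (∂_{m} φ) := by
  refine schwartz_ext_fourier fun ξ => ?_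
  simp only [fourier_lineDeriv, fourier_laplacian]
  ring

lemma laplacian_eq_sum_lineDeriv {d : ℕ} (φ : 𝓢(E d, ℂ)) :
    Δ φ = ∑ j : Fin d, ∂_{ev j} (∂_{ev j} φ) := by
  rw [SchwartzMap.laplacian_eq_sum (EuclideanSpace.basisFun (Fin d) ℝ)]
  simp

/-- Moving the Fourier transform across the bilinear pairing reflects the frequency; evenness of the
symbol undoes the reflection. -/
lemma op_symm {d : ℕ} {g : E d → ℝ} (hg : g.HasTemperateGrowth) (he : ∀ ξ, g (-ξ) = g ξ)
    (φ ψ : 𝓢(E d, ℂ)) : ∫ x, op g φ x * ψ x = ∫ x, φ x * op g ψ x := by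
  have hneg : ∀ (χ : 𝓢(E d, ℂ)) (ξ : E d), (𝓕⁻ χ : 𝓢(E d, ℂ)) ξ = (𝓕 χ : 𝓢(E d, ℂ)) (-ξ) := fun χ ξ => by
    rw [SchwartzMap.fourierInv_coe, SchwartzMap.fourier_coe, Real.fourierInv_eq_fourier_neg]
  have h1 : ∀ χ ξ, SchwartzMap.smulLeftCLM ℂ (fun ξ => (g ξ : ℂ)) χ ξ = g ξ * χ ξ := fun χ ξ => by
    rw [SchwartzMap.smulLeftCLM_apply_apply (ofReal_temperate hg), smul_eq_mul]
  rw [op, SchwartzMap.fourierMultiplierCLM_apply, SchwartzMap.fourierMultiplierCLM_apply,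
    SchwartzMap.integral_fourierInv_mul_eq, ← SchwartzMap.integral_fourierInv_mul_eq φ]
  rw [← integral_neg_eq_self]
  refine integral_congr_ae (ae_of_all _ fun ξ => ?_)
  simp only [h1, hneg, neg_neg, he]
  ring

lemma integral_mul_lineDeriv {d : ℕ} (m : E d) (φ ψ : 𝓢(E d, ℂ)) :
    ∫ x, φ x * (∂_{m} ψ) x = -∫ x, (∂_{m} φ) x * ψ x :=
  SchwartzMap.integral_mul_lineDerivOp_right_eq_neg_left φ ψ m

lemma integral_mul_laplacian {d : ℕ} (φ ψ : 𝓢(E d, ℂ)) :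
    ∫ x, φ x * (Δ ψ) x = ∫ x, (Δ φ) x * ψ x :=
  SchwartzMap.integral_mul_laplacian_right_eq_left φ ψ

lemma cosInt_neg {d : ℕ} (h : ℝ → ℝ) (A : ℝ) (ξ : E d) : cosInt h A (-ξ) = cosInt h A ξ := by
  simp [cosInt]

lemma cosSym_neg {d : ℕ} (t : ℝ) (ξ : E d) : cosSym t (-ξ) = cosSym t ξ := by
  simp [cosSym]

/-! ### Dominated convergence and differentiation in `L²` -/

lemma norm_sq_Lp {α : Type*} [MeasurableSpace α] {μ : Measure α} (f : Lp ℂ 2 μ) :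
    ‖f‖ ^ 2 = ∫ x, ‖f x‖ ^ 2 ∂μ := by
  have h : ((‖f‖ ^ 2 : ℝ) : ℂ) = ((∫ x, ‖f x‖ ^ 2 ∂μ : ℝ) : ℂ) := by
    rw [← integral_complex_ofReal, Complex.ofReal_pow]
    refine (inner_self_eq_norm_sq_to_K (𝕜 := ℂ) f).symm.trans ?_
    rw [L2.inner_def]
    refine integral_congr_ae (ae_of_all _ fun x => ?_)
    simp only [RCLike.inner_apply]
    push_cast
    rw [← Complex.mul_conj']
  exact_mod_cast h

/-- Dominated convergence for `‖a i - a₀‖²`, with majorant `4 b²`. The representatives `a i` are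
fixed functions, so that limits can be taken at every point rather than almost everywhere. -/
lemma tendsto_Lp_of_dominated {α ι : Type*} [MeasurableSpace α] {μ : Measure α} {l : Filter ι}
    [l.IsCountablyGenerated] {F : ι → Lp ℂ 2 μ} {f : Lp ℂ 2 μ} {a : ι → α → ℂ} {a₀ : α → ℂ}
    {b : α → ℝ} (hb : MemLp b 2 μ) (hF : ∀ᶠ i in l, F i =ᵐ[μ] a i) (hf : f =ᵐ[μ] a₀)
    (hbound : ∀ᶠ i in l, ∀ x, ‖a i x‖ ≤ b x) (hlim : ∀ x, Tendsto (fun i => a i x) l (𝓝 (a₀ x))) :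
    Tendsto F l (𝓝 f) := by
  rcases l.eq_or_neBot with rfl | hl
  · exact tendsto_bot
  have hb0 : ∀ x, ‖a₀ x‖ ≤ b x := fun x =>
    le_of_tendsto (hlim x).norm (hbound.mono fun i hi => hi x)
  rw [tendsto_iff_norm_sub_tendsto_zero]
  have key : Tendsto (fun i => ‖F i - f‖ ^ 2) l (𝓝 0) := by
    have h1 : ∀ i, ‖F i - f‖ ^ 2 = ∫ x, ‖(F i - f : Lp ℂ 2 μ) x‖ ^ 2 ∂μ := fun i => norm_sq_Lp _
    simp only [h1]
    have h2 : (0 : ℝ) = ∫ _, (0 : ℝ) ∂μ := by simp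
    have hae : ∀ᶠ i in l, ∀ᵐ x ∂μ, (F i - f : Lp ℂ 2 μ) x = a i x - a₀ x := by
      filter_upwards [hF] with i hi
      filter_upwards [hi, hf, Lp.coeFn_sub (F i) f] with x h3 h4 h5
      rw [h5, Pi.sub_apply, h3, h4]
    have hcong : (fun i => ∫ x, ‖(F i - f : Lp ℂ 2 μ) x‖ ^ 2 ∂μ) =ᶠ[l]
        fun i => ∫ x, ‖a i x - a₀ x‖ ^ 2 ∂μ := by
      filter_upwards [hae] with i hi
      refine integral_congr_ae ?_
      filter_upwards [hi] with x hx
      rw [hx]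
    rw [tendsto_congr' hcong, h2]
    refine tendsto_integral_filter_of_dominated_convergence (fun x => 4 * b x ^ 2) ?_ ?_ ?_ ?_
    · filter_upwards [hF] with i hi
      have h6 : AEStronglyMeasurable (a i) μ := (Lp.aestronglyMeasurable (F i)).congr hi
      have h7 : AEStronglyMeasurable a₀ μ := (Lp.aestronglyMeasurable f).congr hf
      exact (h6.sub h7).norm.pow 2
    · filter_upwards [hbound] with i hi
      refine ae_of_all _ fun x => ?_
      rw [Real.norm_of_nonneg (by positivity)]
      have h8 : ‖a i x - a₀ x‖ ≤ 2 * b x := (norm_sub_le _ _).trans (by linarith [hi x, hb0 x])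
      calc ‖a i x - a₀ x‖ ^ 2 ≤ (2 * b x) ^ 2 := by gcongr
        _ = _ := by ring
    · exact hb.integrable_sq.const_mul 4
    · refine ae_of_all _ fun x => ?_
      have := (tendsto_iff_norm_sub_tendsto_zero.1 (hlim x)).pow 2
      simpa using this
  have := key.sqrt
  simpa [Real.sqrt_sq (norm_nonneg _)] using this

/-- By the mean value inequality on the convex set `s`, a bound for the pointwise derivatives also
dominates the difference quotients. -/
lemma hasDerivWithinAt_Lp {α : Type*} [MeasurableSpace α] {μ : Measure α} {s : Set ℝ}
    (hs : Convex ℝ s) {A : ℝ → Lp ℂ 2 μ} {A' : Lp ℂ 2 μ} {a a' : ℝ → α → ℂ} {b : α → ℝ}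
    (hb : MemLp b 2 μ) {t : ℝ} (ht : t ∈ s) (hA : ∀ u ∈ s, A u =ᵐ[μ] a u) (hA' : A' =ᵐ[μ] a' t)
    (hd : ∀ x, ∀ u ∈ s, HasDerivWithinAt (fun u => a u x) (a' u x) s u)
    (hbound : ∀ u ∈ s, ∀ x, ‖a' u x‖ ≤ b x) : HasDerivWithinAt A A' s t := by
  rw [hasDerivWithinAt_iff_tendsto_slope]
  have hmem : ∀ᶠ u in 𝓝[s \ {t}] t, u ∈ s \ {t} := self_mem_nhdsWithin
  refine tendsto_Lp_of_dominated (a := fun u x => slope (fun u => a u x) t u) hb ?_ hA' ?_ ?_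
  · filter_upwards [hmem] with u hu
    filter_upwards [hA u hu.1, hA t ht, Lp.coeFn_smul ((u - t)⁻¹) (A u - A t),
      Lp.coeFn_sub (A u) (A t)] with x h1 h2 h3 h4
    rw [slope_def_module, h3, Pi.smul_apply, h4, Pi.sub_apply, h1, h2, slope_def_module]
  · filter_upwards [hmem] with u hu x
    have h1 := hs.norm_image_sub_le_of_norm_hasDerivWithin_le (hd x) (fun v hv => hbound v hv x)
      ht hu.1
    rw [slope_def_module, norm_smul, norm_inv]
    have h2 : 0 < ‖u - t‖ := norm_pos_iff.2 (sub_ne_zero.2 hu.2)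
    rw [inv_mul_le_iff₀ h2]
    linarith
  · intro x
    exact hasDerivWithinAt_iff_tendsto_slope.1 (hd x t ht)

/-! ### The weighted energy estimate -/

/-- A Schwartz function as an element of `L²`. -/
def toL2 {d : ℕ} : 𝓢(E d, ℂ) →L[ℂ] Lp ℂ 2 (volume : Measure (E d)) :=
  SchwartzMap.toLpCLM ℂ ℂ 2 volume

lemma toL2_coe {d : ℕ} (φ : 𝓢(E d, ℂ)) : toL2 φ =ᵐ[volume] φ := SchwartzMap.coeFn_toLp φ 2 volume

lemma toL2_eq_fourierInv {d : ℕ} (φ : 𝓢(E d, ℂ)) :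
    toL2 φ = FourierTransform.fourierInvCLM ℂ (Lp ℂ 2 (volume : Measure (E d)))
      (toL2 (𝓕 φ : 𝓢(E d, ℂ))) := by
  change φ.toLp 2 volume = 𝓕⁻ ((𝓕 φ : 𝓢(E d, ℂ)).toLp 2 volume)
  rw [SchwartzMap.toLp_fourierInv_eq, FourierTransform.fourierInv_fourier_eq]

attribute [irreducible] toL2

lemma toL_eq_lpMono {d : ℕ} {s : ℝ} (hs : s ≤ 0) (φ : 𝓢(E d, ℂ)) :
    toL s φ = lpMono (weightMeasure_le_volume hs) (toL2 φ) := by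
  have h : lpMono (weightMeasure_le_volume hs) (toL2 φ) =ᵐ[volume] toL2 φ :=
    ae_volume_of_ae_weightMeasure (lpMono_coe (weightMeasure_le_volume hs) _)
  exact L2s_ext ((toL_coe s φ).trans ((toL2_coe φ).symm.trans h.symm))

lemma inner_self_ofReal {H : Type*} [NormedAddCommGroup H] [InnerProductSpace ℂ H] (x : H) :
    inner ℂ x x = ((‖x‖ ^ 2 : ℝ) : ℂ) := by
  rw [Complex.ofReal_pow]
  exact inner_self_eq_norm_sq_to_K x

lemma clm_comp_hasDerivWithinAt {F G : Type*} [NormedAddCommGroup F] [NormedSpace ℂ F]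
    [NormedSpace ℝ F] [NormedAddCommGroup G] [NormedSpace ℂ G] [NormedSpace ℝ G]
    [LinearMap.CompatibleSMul F G ℝ ℂ] (L : F →L[ℂ] G) {f : ℝ → F} {f' : F} {s : Set ℝ}
    {t : ℝ} (h : HasDerivWithinAt f f' s t) : HasDerivWithinAt (fun u => L (f u)) (L f') s t :=
  (L.restrictScalars ℝ).hasFDerivAt.comp_hasDerivWithinAt t h

lemma memLp_mul_schwartz {d : ℕ} {B : E d → ℝ} (hB : B.HasTemperateGrowth) (hB0 : ∀ ξ, 0 ≤ B ξ)
    (φ : 𝓢(E d, ℂ)) : MemLp (fun ξ => B ξ * ‖φ ξ‖) 2 volume := by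
  refine ((mulS B φ).memLp 2 volume).norm.ae_eq (ae_of_all _ fun ξ => ?_)
  simp only [mulS_apply hB, norm_mul, Complex.norm_real, Real.norm_of_nonneg (hB0 ξ)]

/-- On the Fourier side the operators are multiplications and the derivative is taken pointwise; the
inverse Fourier transform is continuous on `L²` and carries it back. The majorant `B` may grow
polynomially, because it is multiplied by a Schwartz function. -/
lemma hasDerivWithinAt_toL2_op {d : ℕ} {s : Set ℝ} (hs : Convex ℝ s) {g g' : ℝ → E d → ℝ}
    {B : E d → ℝ} (hB : B.HasTemperateGrowth) (hg : ∀ t ∈ s, (g t).HasTemperateGrowth)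
    (hg' : ∀ t ∈ s, (g' t).HasTemperateGrowth)
    (hd : ∀ ξ, ∀ t ∈ s, HasDerivWithinAt (fun t => g t ξ) (g' t ξ) s t)
    (hb : ∀ t ∈ s, ∀ ξ, |g' t ξ| ≤ B ξ) (φ : 𝓢(E d, ℂ)) {t : ℝ} (ht : t ∈ s) :
    HasDerivWithinAt (fun t => toL2 (op (g t) φ)) (toL2 (op (g' t) φ)) s t := by
  have hB0 : ∀ ξ, 0 ≤ B ξ := fun ξ => (abs_nonneg _).trans (hb t ht ξ)
  have h1 : HasDerivWithinAt (fun t => toL2 (𝓕 (op (g t) φ) : 𝓢(E d, ℂ)))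
      (toL2 (𝓕 (op (g' t) φ) : 𝓢(E d, ℂ))) s t := by
    refine hasDerivWithinAt_Lp hs (a := fun t ξ => g t ξ * (𝓕 φ : 𝓢(E d, ℂ)) ξ)
      (a' := fun t ξ => g' t ξ * (𝓕 φ : 𝓢(E d, ℂ)) ξ)
      (memLp_mul_schwartz hB hB0 (𝓕 φ)) ht ?_ ?_ ?_ ?_
    · intro u hu
      filter_upwards [toL2_coe (𝓕 (op (g u) φ) : 𝓢(E d, ℂ))] with ξ hξ
      rw [hξ, fourier_op (hg u hu)]
    · filter_upwards [toL2_coe (𝓕 (op (g' t) φ) : 𝓢(E d, ℂ))] with ξ hξ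
      rw [hξ, fourier_op (hg' t ht)]
    · intro ξ u hu
      exact (hd ξ u hu).ofReal_comp.mul_const _
    · intro u hu ξ
      rw [norm_mul, Complex.norm_real]
      exact mul_le_mul_of_nonneg_right (hb u hu ξ) (norm_nonneg _)
  have h2 := clm_comp_hasDerivWithinAt
    (FourierTransform.fourierInvCLM ℂ (Lp ℂ 2 (volume : Measure (E d)))) h1
  simpa only [← toL2_eq_fourierInv] using h2

/-- The symbol `sin(2π|ξ|t) / (2π|ξ|)`. -/
def sinSym {d : ℕ} (t : ℝ) : E d → ℝ := cosInt (fun _ => 1) t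

lemma sinSym_temperate {d : ℕ} {t : ℝ} (ht : 0 ≤ t) : (sinSym t : E d → ℝ).HasTemperateGrowth :=
  cosInt_temperate continuous_const ht

lemma sinSym_neg {d : ℕ} (t : ℝ) (ξ : E d) : sinSym t (-ξ) = sinSym t ξ := cosInt_neg _ _ _

lemma hasDerivAt_sinSym {d : ℕ} (ξ : E d) (t : ℝ) :
    HasDerivAt (fun t => sinSym t ξ) (cosSym t ξ) t := by
  have hc : Continuous fun τ : ℝ => 1 * Real.cos (2 * Real.pi * ‖ξ‖ * τ) := by fun_prop
  have := intervalIntegral.integral_hasDerivAt_right (hc.intervalIntegrable 0 t)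
    (hc.stronglyMeasurableAtFilter _ _) hc.continuousAt
  simpa [sinSym, cosInt, cosSym] using this

lemma lapSym_mul_sinSym {d : ℕ} (t : ℝ) (ξ : E d) :
    lapSym ξ * sinSym t ξ = 2 * Real.pi * ‖ξ‖ * Real.sin (2 * Real.pi * ‖ξ‖ * t) := by
  have h : ∀ a ∈ uIcc (0 : ℝ) t, HasDerivAt (fun a => 2 * Real.pi * ‖ξ‖ *
      Real.sin (2 * Real.pi * ‖ξ‖ * a)) (lapSym ξ * (1 * Real.cos (2 * Real.pi * ‖ξ‖ * a))) a := by
    intro a _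
    have hl : HasDerivAt (fun a => 2 * Real.pi * ‖ξ‖ * a) (2 * Real.pi * ‖ξ‖) a := by
      simpa using (hasDerivAt_id a).const_mul (2 * Real.pi * ‖ξ‖)
    refine (hl.sin.const_mul _).congr_deriv ?_
    rw [lapSym]; ring
  rw [sinSym, cosInt, ← intervalIntegral.integral_const_mul,
    intervalIntegral.integral_eq_sub_of_hasDerivAt h
      (Continuous.intervalIntegrable (by fun_prop) _ _)]
  simp

lemma hasDerivAt_cosSym {d : ℕ} (ξ : E d) (t : ℝ) :
    HasDerivAt (fun t => cosSym t ξ) (-lapSym ξ * sinSym t ξ) t := by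
  have hl : HasDerivAt (fun a => 2 * Real.pi * ‖ξ‖ * a) (2 * Real.pi * ‖ξ‖) t := by
    simpa using (hasDerivAt_id t).const_mul (2 * Real.pi * ‖ξ‖)
  refine hl.cos.congr_deriv ?_
  rw [neg_mul (lapSym ξ), lapSym_mul_sinSym]
  ring

lemma abs_lapSym_mul_sinSym_le {d : ℕ} (t : ℝ) (ξ : E d) :
    |-lapSym ξ * sinSym t ξ| ≤ 1 + lapSym ξ := by
  rw [neg_mul, abs_neg, lapSym_mul_sinSym, abs_mul, lapSym,
    abs_of_nonneg (by positivity : 0 ≤ 2 * Real.pi * ‖ξ‖)]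
  have h1 := Real.abs_sin_le_one (2 * Real.pi * ‖ξ‖ * t)
  have h2 : 0 ≤ 2 * Real.pi * ‖ξ‖ := by positivity
  nlinarith [sq_nonneg (2 * Real.pi * ‖ξ‖ - 1)]

lemma one_add_lapSym_temperate {d : ℕ} :
    (fun ξ : E d => 1 + lapSym ξ).HasTemperateGrowth := by
  have := lapSym_temperate (d := d)
  fun_prop

lemma neg_lapSym_mul_sinSym_temperate {d : ℕ} {t : ℝ} (ht : 0 ≤ t) :
    (fun ξ : E d => -lapSym ξ * sinSym t ξ).HasTemperateGrowth := by
  have h1 := lapSym_temperate (d := d)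
  have h2 := sinSym_temperate (d := d) ht
  have h3 : (fun ξ : E d => -lapSym ξ * sinSym t ξ) = -(lapSym * sinSym t) := by
    ext ξ; simp
  rw [h3]
  exact (h1.mul h2).neg

lemma op_neg_lapSym_mul_sinSym {d : ℕ} {t : ℝ} (ht : 0 ≤ t) (φ : 𝓢(E d, ℂ)) :
    op (fun ξ : E d => -lapSym ξ * sinSym t ξ) φ = Δ (op (sinSym t) φ) := by
  refine schwartz_ext_fourier fun ξ => ?_
  rw [fourier_op (neg_lapSym_mul_sinSym_temperate ht), fourier_laplacian,
    fourier_op (sinSym_temperate ht)]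
  push_cast
  ring

lemma hasDerivWithinAt_cos_op {d : ℕ} (A : ℝ) (φ : 𝓢(E d, ℂ)) {t : ℝ} (ht : t ∈ Icc 0 A) :
    HasDerivWithinAt (fun t => toL2 (op (cosSym t) φ)) (toL2 (Δ (op (sinSym t) φ))) (Icc 0 A) t := by
  rw [← op_neg_lapSym_mul_sinSym ht.1]
  exact hasDerivWithinAt_toL2_op (convex_Icc 0 A) one_add_lapSym_temperate
    (g' := fun t ξ => -lapSym ξ * sinSym t ξ)
    (fun t ht => cosSym_temperate ht.1) (fun t ht => neg_lapSym_mul_sinSym_temperate ht.1)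
    (fun ξ t _ => (hasDerivAt_cosSym ξ t).hasDerivWithinAt)
    (fun t _ ξ => abs_lapSym_mul_sinSym_le t ξ) φ ht

lemma hasDerivWithinAt_sin_op {d : ℕ} (A : ℝ) (φ : 𝓢(E d, ℂ)) {t : ℝ} (ht : t ∈ Icc 0 A) :
    HasDerivWithinAt (fun t => toL2 (op (sinSym t) φ)) (toL2 (op (cosSym t) φ)) (Icc 0 A) t :=
  hasDerivWithinAt_toL2_op (convex_Icc 0 A) (Function.HasTemperateGrowth.const 1)
    (fun _ ht => sinSym_temperate ht.1) (fun _ ht => cosSym_temperate ht.1)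
    (fun ξ t _ => (hasDerivAt_sinSym ξ t).hasDerivWithinAt)
    (fun _ _ _ => Real.abs_cos_le_one _) φ ht

lemma op_zero_sym {d : ℕ} (φ : 𝓢(E d, ℂ)) : op (fun _ => (0 : ℝ)) φ = 0 := by
  simp [op]

lemma op_one_sym {d : ℕ} (φ : 𝓢(E d, ℂ)) : op (fun _ => (1 : ℝ)) φ = φ := by
  simp [op]

lemma op_cosSym_zero {d : ℕ} (φ : 𝓢(E d, ℂ)) : op (cosSym 0) φ = φ := by
  have : (cosSym 0 : E d → ℝ) = fun _ => 1 := by ext; simp [cosSym]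
  rw [this, op_one_sym]

lemma op_sinSym_zero {d : ℕ} (φ : 𝓢(E d, ℂ)) : op (sinSym 0) φ = 0 := by
  have : (sinSym 0 : E d → ℝ) = fun _ => 0 := by ext; simp [sinSym, cosInt]
  rw [this, op_zero_sym]

/-- In the derivative of the energy, integration by parts cancels `⟨P, ∂_j Q_j⟩` against `⟨∂_j P,
Q_j⟩` up to the term with the logarithmic derivative of the weight, which the energy itself bounds;
Gronwall's inequality then applies. With `s ≤ 0` the space `L²` embeds in `L²_s`, so time
derivatives known in `L²` hold in `L²_s`. -/
lemma energy_le_of_nonpos {d : ℕ} {s : ℝ} (hs : s ≤ 0) {A : ℝ} (φ : 𝓢(E d, ℂ)) {t : ℝ}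
    (ht : t ∈ Icc 0 A) :
    ‖toL s (op (cosSym t) φ)‖ ^ 2 + ∑ j : Fin d, ‖toL s (∂_{ev j} (op (sinSym t) φ))‖ ^ 2 ≤
      ‖toL s φ‖ ^ 2 * Real.exp (2 * |s| * (d + 1) * t) := by
  set P : ℝ → L2s d s := fun t => toL s (op (cosSym t) φ) with hP
  set q : Fin d → ℝ → 𝓢(E d, ℂ) := fun j t => ∂_{ev j} (op (sinSym t) φ) with hq
  set Q : Fin d → ℝ → L2s d s := fun j t => toL s (q j t) with hQ
  set e : ℝ → ℝ := fun t => ‖P t‖ ^ 2 + ∑ j, ‖Q j t‖ ^ 2 with he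
  have hP' : ∀ t ∈ Icc 0 A, HasDerivWithinAt P (∑ j, toL s (∂_{ev j} (q j t))) (Icc 0 A) t := by
    intro t ht
    have h1 := clm_comp_hasDerivWithinAt (lpMono (weightMeasure_le_volume hs))
      (hasDerivWithinAt_cos_op A φ ht)
    simp only [← toL_eq_lpMono hs] at h1
    rwa [laplacian_eq_sum_lineDeriv, map_sum] at h1
  have hQ' : ∀ j, ∀ t ∈ Icc 0 A,
      HasDerivWithinAt (Q j) (toL s (∂_{ev j} (op (cosSym t) φ))) (Icc 0 A) t := by
    intro j t ht
    have h1 := clm_comp_hasDerivWithinAt (lpMono (weightMeasure_le_volume hs))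
      (hasDerivWithinAt_sin_op A (∂_{ev j} φ) ht)
    simp only [← toL_eq_lpMono hs] at h1
    rw [op_lineDeriv (cosSym_temperate ht.1)] at h1
    refine h1.congr (fun u hu => ?_) ?_
    · rw [op_lineDeriv (sinSym_temperate hu.1)]
    · rw [op_lineDeriv (sinSym_temperate ht.1)]
  let D : ℝ → ℂ := fun t => ∑ j, inner ℂ (P t) (toL s (mulS (logw s j) (q j t)))
  have he' : ∀ t ∈ Icc 0 A, HasDerivWithinAt e (-2 * (D t).re) (Icc 0 A) t := by
    intro t ht
    have h1 := ((hP' t ht).inner ℂ (hP' t ht)).add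
      (HasDerivWithinAt.fun_sum (u := Finset.univ) fun j _ => (hQ' j t ht).inner ℂ (hQ' j t ht))
    have h2 := (Complex.reCLM.hasFDerivAt.comp_hasDerivWithinAt t h1)
    refine (h2.congr_deriv ?_).congr_of_mem (fun u _ => ?_) ht
    · have h3 : ∀ j, inner ℂ (toL s (∂_{ev j} (op (cosSym t) φ))) (Q j t) =
          -inner ℂ (P t) (toL s (∂_{ev j} (q j t))) -
            inner ℂ (P t) (toL s (mulS (logw s j) (q j t))) := fun j =>
        inner_lineDeriv s j _ _
      have h4 : ∀ j, (inner ℂ (Q j t) (toL s (∂_{ev j} (op (cosSym t) φ)))).re =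
          (inner ℂ (toL s (∂_{ev j} (op (cosSym t) φ))) (Q j t)).re := fun j => by
        rw [← inner_conj_symm, Complex.conj_re]
      have h5 : (inner ℂ (∑ j, toL s (∂_{ev j} (q j t))) (P t)).re =
          (inner ℂ (P t) (∑ j, toL s (∂_{ev j} (q j t)))).re := by
        rw [← inner_conj_symm, Complex.conj_re]
      simp only [Complex.reCLM_apply, Complex.add_re, Complex.re_sum, h5, h4, h3, inner_sum, D,
        Complex.sub_re, Complex.neg_re, Finset.sum_add_distrib, Finset.sum_sub_distrib,
        Finset.sum_neg_distrib]
      ring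
    · simp only [he, Function.comp_apply, Complex.reCLM_apply, Pi.add_apply, Complex.add_re,
        Complex.re_sum]
      congr 1
      · exact (inner_self_eq_norm_sq (𝕜 := ℂ) (P u)).symm
      · exact Finset.sum_congr rfl fun j _ => (inner_self_eq_norm_sq (𝕜 := ℂ) (Q j u)).symm
  -- Young's inequality bounds the `j`-th term by `|s| (‖P‖² + ‖Q_j‖²)`. Summation counts `‖P‖²`
  -- with multiplicity `d`, and `d + 1` is a convenient common factor.
  have hbound : ∀ t, -2 * (D t).re ≤ 2 * |s| * (d + 1) * e t := by
    intro t
    have h1 : -2 * (D t).re ≤ 2 * ‖D t‖ := by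
      have := Complex.abs_re_le_norm (D t)
      have := neg_abs_le (D t).re
      linarith
    have h2 : ‖D t‖ ≤ ∑ j, |s| * (‖P t‖ ^ 2 + ‖Q j t‖ ^ 2) := by
      refine (norm_sum_le _ _).trans (Finset.sum_le_sum fun j _ => ?_)
      refine (norm_inner_le_norm _ _).trans ?_
      have h3 := mul_le_mul_of_nonneg_left (mulS_logw_le s j (q j t)) (norm_nonneg (P t))
      refine h3.trans ?_
      have h4 := abs_nonneg s
      have h5 := mul_nonneg h4 (sq_nonneg (‖P t‖ - ‖Q j t‖))
      simp only [hQ] at h5 ⊢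
      nlinarith
    have h6 : ∑ j, |s| * (‖P t‖ ^ 2 + ‖Q j t‖ ^ 2) ≤ |s| * ((d + 1) * e t) := by
      rw [← Finset.mul_sum, Finset.sum_add_distrib]
      refine mul_le_mul_of_nonneg_left ?_ (abs_nonneg s)
      have h7 : 0 ≤ ∑ j, ‖Q j t‖ ^ 2 := Finset.sum_nonneg fun _ _ => sq_nonneg _
      have h8 := sq_nonneg ‖P t‖
      have h9 : (0 : ℝ) ≤ d := Nat.cast_nonneg d
      simp only [he, Finset.sum_const, Finset.card_univ, Fintype.card_fin, nsmul_eq_mul]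
      nlinarith [mul_nonneg h9 h7]
    linarith
  have hcont : ContinuousOn e (Icc 0 A) := fun t ht => (he' t ht).continuousWithinAt
  have h0 : e 0 ≤ ‖toL s φ‖ ^ 2 := by
    simp [he, hP, hQ, hq, op_cosSym_zero, op_sinSym_zero]
  have hA := le_gronwallBound_of_liminf_deriv_right_le (f' := fun t => -2 * (D t).re) (ε := 0)
    (K := 2 * |s| * (d + 1)) hcont (fun x hx r hr => ?_) h0
    (fun x _ => by simpa using hbound x) t ht
  · rw [gronwallBound_ε0, sub_zero] at hA
    exact hA
  · refine HasDerivWithinAt.liminf_right_slope_le ?_ hr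
    exact (he' x ⟨hx.1, hx.2.le⟩).mono_of_mem_nhdsWithin (Icc_mem_nhdsGE_of_mem hx)

/-- Testing `T φ` against `ψ = ⟨x⟩^{2s}` times its conjugate gives the square of its norm, and `ψ`
has the same norm in `L²_{-s}`. Moving `T` onto `ψ` and dividing by the norm of `T φ` transfers the
bound from `-s` to `s`. -/
lemma norm_toL_le_of_dual {d : ℕ} {s K : ℝ} (hK0 : 0 ≤ K) {T T' : 𝓢(E d, ℂ) → 𝓢(E d, ℂ)}
    (hT : ∀ φ ψ, ∫ x, T φ x * ψ x = ∫ x, φ x * T' ψ x)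
    (hK : ∀ ψ, ‖toL (-s) (T' ψ)‖ ≤ K * ‖toL (-s) ψ‖) (φ : 𝓢(E d, ℂ)) :
    ‖toL s (T φ)‖ ≤ K * ‖toL s φ‖ := by
  set ψ := mulS (wt s) (conjS (T φ)) with hψ
  have h1 : ‖toL (-s) ψ‖ = ‖toL s (T φ)‖ := by
    have := norm_toL_dualS (-s) (T φ)
    rwa [dualS, neg_neg] at this
  have h2 : ‖toL s (T φ)‖ ^ 2 ≤ ‖toL s φ‖ * (K * ‖toL s (T φ)‖) := by
    have h3 : ((‖toL s (T φ)‖ ^ 2 : ℝ) : ℂ) = ∫ x, φ x * T' ψ x := by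
      rw [← hT, hψ, ← inner_self_ofReal, inner_toL_toL]
    calc ‖toL s (T φ)‖ ^ 2 = ‖((‖toL s (T φ)‖ ^ 2 : ℝ) : ℂ)‖ := by
          rw [Complex.norm_real, Real.norm_of_nonneg (by positivity)]
      _ ≤ ‖toL s φ‖ * ‖toL (-s) (T' ψ)‖ := by rw [h3]; exact norm_integral_mul_le s φ (T' ψ)
      _ ≤ ‖toL s φ‖ * (K * ‖toL (-s) ψ‖) := by gcongr; exact hK ψ
      _ = _ := by rw [h1]
  have h4 : 0 ≤ ‖toL s (T φ)‖ := norm_nonneg _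
  have h5 : 0 ≤ K * ‖toL s φ‖ := mul_nonneg hK0 (norm_nonneg _)
  clear_value ψ
  generalize ‖toL s (T φ)‖ = a at h2 h4 ⊢
  by_contra! hcon
  nlinarith

/-- `cos(t√-Δ)` and `∂_j sin(t√-Δ)/√-Δ` are bounded on `L²_s`. -/
theorem wave_bounds (d : ℕ) (s A : ℝ) : ∃ K : ℝ, 0 ≤ K ∧ ∀ t ∈ Icc 0 A, ∀ φ : 𝓢(E d, ℂ),
    ‖toL s (op (cosSym t) φ)‖ ≤ K * ‖toL s φ‖ ∧
      ∀ j : Fin d, ‖toL s (∂_{ev j} (op (sinSym t) φ))‖ ≤ K * ‖toL s φ‖ := by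
  have main : ∀ s ≤ 0, ∃ K : ℝ, 0 ≤ K ∧ ∀ t ∈ Icc 0 A, ∀ φ : 𝓢(E d, ℂ),
      ‖toL s (op (cosSym t) φ)‖ ≤ K * ‖toL s φ‖ ∧
        ∀ j : Fin d, ‖toL s (∂_{ev j} (op (sinSym t) φ))‖ ≤ K * ‖toL s φ‖ := by
    intro s hs
    -- The constant is the square root of the Gronwall factor at the final time `A`.
    refine ⟨Real.exp (|s| * (d + 1) * A), (Real.exp_pos _).le, fun t ht φ => ?_⟩
    have h1 := energy_le_of_nonpos hs φ ht
    have h2 : ‖toL s φ‖ ^ 2 * Real.exp (2 * |s| * (d + 1) * t) ≤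
        (Real.exp (|s| * (d + 1) * A) * ‖toL s φ‖) ^ 2 := by
      rw [mul_pow, mul_comm, ← Real.exp_nat_mul]
      have : 2 * |s| * (d + 1) * t ≤ (2 : ℕ) * (|s| * (d + 1) * A) := by
        push_cast
        have h3 : 0 ≤ 2 * |s| * ((d : ℝ) + 1) := by positivity
        nlinarith [mul_le_mul_of_nonneg_left ht.2 h3]
      gcongr
    have h3 : ∀ j : Fin d, ‖toL s (∂_{ev j} (op (sinSym t) φ))‖ ^ 2 ≤
        ∑ j : Fin d, ‖toL s (∂_{ev j} (op (sinSym t) φ))‖ ^ 2 := fun j =>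
      Finset.single_le_sum (f := fun j => ‖toL s (∂_{ev j} (op (sinSym t) φ))‖ ^ 2)
        (fun _ _ => sq_nonneg _) (Finset.mem_univ j)
    have h4 : 0 ≤ ∑ j : Fin d, ‖toL s (∂_{ev j} (op (sinSym t) φ))‖ ^ 2 :=
      Finset.sum_nonneg fun _ _ => sq_nonneg _
    refine ⟨le_of_sq_le_sq (by linarith) (by positivity), fun j =>
      le_of_sq_le_sq ?_ (by positivity)⟩
    have := sq_nonneg ‖toL s (op (cosSym t) φ)‖
    linarith [h3 j]
  rcases le_total s 0 with hs | hs
  · exact main s hs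
  -- For `s ≥ 0` the estimate at `-s` is transposed. The cosine is its own transpose; the other
  -- operator changes sign, because `∂_j` does.
  · obtain ⟨K, hK0, hK⟩ := main (-s) (by linarith)
    refine ⟨K, hK0, fun t ht φ => ⟨?_, fun j => ?_⟩⟩
    · exact norm_toL_le_of_dual hK0 (T := op (cosSym t)) (T' := op (cosSym t))
        (op_symm (cosSym_temperate ht.1) (cosSym_neg t)) (fun ψ => (hK t ht ψ).1) φ
    · refine norm_toL_le_of_dual hK0 (T := fun φ => ∂_{ev j} (op (sinSym t) φ))
        (T' := fun φ => -∂_{ev j} (op (sinSym t) φ)) (fun φ ψ => ?_) (fun ψ => ?_) φ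
      · rw [← op_lineDeriv (sinSym_temperate ht.1),
          op_symm (sinSym_temperate ht.1) (sinSym_neg t)]
        simp only [neg_apply, mul_neg]
        rw [integral_neg, integral_mul_lineDeriv, neg_neg]
      · rw [map_neg, norm_neg]
        exact (hK t ht ψ).2 j

/-! ### Bounded multipliers and their extensions to `L²_s` -/

lemma hasDerivAt_cosInt {d : ℕ} {h : ℝ → ℝ} (hh : Continuous h) (ξ : E d) (t : ℝ) :
    HasDerivAt (fun t => cosInt h t ξ) (h t * cosSym t ξ) t := by
  have hc : Continuous fun τ : ℝ => h τ * Real.cos (2 * Real.pi * ‖ξ‖ * τ) := by fun_prop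
  exact intervalIntegral.integral_hasDerivAt_right (hc.intervalIntegrable 0 t)
    (hc.stronglyMeasurableAtFilter _ _) hc.continuousAt

lemma op_const_mul {d : ℕ} {g : E d → ℝ} (hg : g.HasTemperateGrowth) (c : ℝ) (φ : 𝓢(E d, ℂ)) :
    op (fun ξ => c * g ξ) φ = (c : ℂ) • op g φ := by
  have hcg : (fun ξ => c * g ξ).HasTemperateGrowth := by fun_prop
  refine schwartz_ext_fourier fun ξ => ?_
  rw [fourier_op hcg, FourierTransform.fourier_smul, smul_apply, fourier_op hg]
  push_cast
  rw [smul_eq_mul]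
  ring

/-- Multipliers `∫₀^t h(a) cos(2π|ξ|a) da` are bounded on `L²_s`. -/
theorem cosInt_bounds (d : ℕ) (s A : ℝ) : ∃ K : ℝ, 0 ≤ K ∧ ∀ h : ℝ → ℝ, Continuous h →
    ∀ t ∈ Icc 0 A, ∀ φ : 𝓢(E d, ℂ),
      ‖toL s (op (cosInt h t) φ)‖ ≤ K * (∫ a in (0 : ℝ)..t, |h a|) * ‖toL s φ‖ := by
  have main : ∀ s ≤ 0, ∃ K : ℝ, 0 ≤ K ∧ ∀ h : ℝ → ℝ, Continuous h →
      ∀ t ∈ Icc 0 A, ∀ φ : 𝓢(E d, ℂ),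
        ‖toL s (op (cosInt h t) φ)‖ ≤ K * (∫ a in (0 : ℝ)..t, |h a|) * ‖toL s φ‖ := by
    intro s hs
    obtain ⟨K, hK0, hK⟩ := wave_bounds d s A
    refine ⟨K, hK0, fun h hh t ht φ => ?_⟩
    obtain ⟨M, hM⟩ := isCompact_Icc.exists_bound_of_continuousOn (hh.continuousOn (s := Icc 0 A))
    have hderiv : ∀ u ∈ Icc 0 A, HasDerivWithinAt (fun t => toL s (op (cosInt h t) φ))
        ((h u : ℂ) • toL s (op (cosSym u) φ)) (Icc 0 A) u := by
      intro u hu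
      have h1 := clm_comp_hasDerivWithinAt (lpMono (weightMeasure_le_volume hs))
        (hasDerivWithinAt_toL2_op (convex_Icc 0 A) (g := fun t => cosInt h t)
          (g' := fun t ξ => h t * cosSym t ξ) (B := fun _ => M)
          (Function.HasTemperateGrowth.const M)
          (fun _ ht => cosInt_temperate hh ht.1)
          (fun t ht => (Function.HasTemperateGrowth.const (h t)).mul (cosSym_temperate ht.1))
          (fun ξ t _ => (hasDerivAt_cosInt hh ξ t).hasDerivWithinAt) (fun t ht ξ => ?_) φ hu)
      · simp only [← toL_eq_lpMono hs] at h1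
        rwa [op_const_mul (cosSym_temperate hu.1), map_smul] at h1
      · rw [abs_mul]
        exact (mul_le_of_le_one_right (abs_nonneg _) (Real.abs_cos_le_one _)).trans (hM t ht)
    have hB : ∀ u, HasDerivAt (fun t => K * (∫ a in (0 : ℝ)..t, |h a|) * ‖toL s φ‖)
        (K * |h u| * ‖toL s φ‖) u := by
      intro u
      have hc : Continuous fun a => |h a| := hh.abs
      exact ((intervalIntegral.integral_hasDerivAt_right (hc.intervalIntegrable 0 u)
        (hc.stronglyMeasurableAtFilter _ _) hc.continuousAt).const_mul K).mul_const _
    -- The derivative in time is `h(u) cos(u√-Δ)φ`, of norm at most `K |h(u)| ‖φ‖`. Comparison with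
    -- the primitive of this bound makes the constant depend on `h` only through `∫ |h|`, with the
    -- same `K` for all `h`.
    refine image_norm_le_of_norm_deriv_right_le_deriv_boundary
      (f := fun t => toL s (op (cosInt h t) φ)) (a := 0) (b := A)
      (f' := fun u => (h u : ℂ) • toL s (op (cosSym u) φ))
      (fun u hu => (hderiv u hu).continuousWithinAt)
      (fun u hu => (hderiv u ⟨hu.1, hu.2.le⟩).mono_of_mem_nhdsWithin (Icc_mem_nhdsGE_of_mem hu))
      (B := fun t => K * (∫ a in (0 : ℝ)..t, |h a|) * ‖toL s φ‖) ?_ (fun u => hB u) ?_ ht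
    · have : (cosInt h 0 : E d → ℝ) = fun _ => 0 := by ext; simp [cosInt]
      simp [this, op_zero_sym]
    · intro u hu
      rw [norm_smul, Complex.norm_real, Real.norm_eq_abs, mul_comm K, mul_assoc]
      gcongr
      exact (hK u ⟨hu.1, hu.2.le⟩ φ).1
  rcases le_total s 0 with hs | hs
  · exact main s hs
  · obtain ⟨K, hK0, hK⟩ := main (-s) (by linarith)
    refine ⟨K, hK0, fun h hh t ht φ => ?_⟩
    exact norm_toL_le_of_dual (mul_nonneg hK0 (intervalIntegral.integral_nonneg ht.1
      fun _ _ => abs_nonneg _)) (T := op (cosInt h t)) (T' := op (cosInt h t))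
      (op_symm (cosInt_temperate hh ht.1) (cosInt_neg h t)) (fun ψ => hK h hh t ht ψ) φ

/-- Even symbols of temperate growth whose multipliers are bounded on all the spaces `L²_s`. -/
structure BoundedSymbol {d : ℕ} (g : E d → ℝ) : Prop where
  temperate : g.HasTemperateGrowth
  even : ∀ ξ, g (-ξ) = g ξ
  bound : ∀ s : ℝ, ∃ K : ℝ, 0 ≤ K ∧ ∀ φ : 𝓢(E d, ℂ), ‖toL s (op g φ)‖ ≤ K * ‖toL s φ‖

lemma boundedSymbol_cosInt {d : ℕ} {h : ℝ → ℝ} (hh : Continuous h) {A : ℝ} (hA : 0 ≤ A) :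
    BoundedSymbol (cosInt h A : E d → ℝ) where
  temperate := cosInt_temperate hh hA
  even := cosInt_neg h A
  bound s := by
    obtain ⟨K, hK0, hK⟩ := cosInt_bounds d s A
    exact ⟨_, mul_nonneg hK0 (intervalIntegral.integral_nonneg hA fun _ _ => abs_nonneg _),
      fun φ => hK h hh A ⟨hA, le_rfl⟩ φ⟩

lemma boundedSymbol_one {d : ℕ} : BoundedSymbol (fun _ : E d => (1 : ℝ)) where
  temperate := Function.HasTemperateGrowth.const 1
  even _ := rfl
  bound s := ⟨1, zero_le_one, fun φ => by rw [op_one_sym, one_mul]⟩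

lemma BoundedSymbol.mul {d : ℕ} {g h : E d → ℝ} (hg : BoundedSymbol g) (hh : BoundedSymbol h) :
    BoundedSymbol (fun ξ => g ξ * h ξ) where
  temperate := hg.temperate.mul hh.temperate
  even ξ := by rw [hg.even, hh.even]
  bound s := by
    obtain ⟨K, hK0, hK⟩ := hg.bound s
    obtain ⟨M, hM0, hM⟩ := hh.bound s
    refine ⟨K * M, mul_nonneg hK0 hM0, fun φ => ?_⟩
    rw [← op_op hg.temperate hh.temperate, mul_assoc]
    exact (hK _).trans (mul_le_mul_of_nonneg_left (hM φ) hK0)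

lemma BoundedSymbol.pow {d : ℕ} {g : E d → ℝ} (hg : BoundedSymbol g) (n : ℕ) :
    BoundedSymbol (fun ξ => g ξ ^ n) := by
  induction n with
  | zero => simpa using boundedSymbol_one
  | succ n ih => simpa only [pow_succ] using ih.mul hg

/-- The extension to `L²_s` of a linear map on Schwartz functions. -/
def schwartzExt {d : ℕ} {F : Type*} [NormedAddCommGroup F] [NormedSpace ℂ F] [CompleteSpace F]
    (s : ℝ) (T : 𝓢(E d, ℂ) →ₗ[ℂ] F) : L2s d s →L[ℂ] F :=
  T.extendOfNorm (toL (d := d) s).toLinearMap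

lemma schwartzExt_toL {d : ℕ} {F : Type*} [NormedAddCommGroup F] [NormedSpace ℂ F]
    [CompleteSpace F] {s : ℝ} {T : 𝓢(E d, ℂ) →ₗ[ℂ] F} {K : ℝ} (hK : ∀ φ, ‖T φ‖ ≤ K * ‖toL s φ‖)
    (φ : 𝓢(E d, ℂ)) : schwartzExt s T (toL s φ) = T φ :=
  LinearMap.extendOfNorm_eq (e := (toL (d := d) s).toLinearMap) (toL_dense (d := d) s) ⟨K, hK⟩ φ

lemma norm_schwartzExt_le {d : ℕ} {F : Type*} [NormedAddCommGroup F] [NormedSpace ℂ F]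
    [CompleteSpace F] {s : ℝ} {T : 𝓢(E d, ℂ) →ₗ[ℂ] F} {K : ℝ} (hK : ∀ φ, ‖T φ‖ ≤ K * ‖toL s φ‖)
    (f : L2s d s) : ‖schwartzExt s T f‖ ≤ K * ‖f‖ :=
  LinearMap.norm_extendOfNorm_apply_le (e := (toL (d := d) s).toLinearMap) (toL_dense (d := d) s)
    K hK f

/-- The extension of a Fourier multiplier to `L²_s`. -/
def ext {d : ℕ} (s : ℝ) (g : E d → ℝ) : L2s d s →L[ℂ] L2s d s :=
  schwartzExt s (toL s ∘L op g).toLinearMap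

lemma ext_toL {d : ℕ} (s : ℝ) {g : E d → ℝ} (hg : BoundedSymbol g) (φ : 𝓢(E d, ℂ)) :
    ext s g (toL s φ) = toL s (op g φ) := by
  obtain ⟨K, -, hK⟩ := hg.bound s
  exact schwartzExt_toL (T := (toL s ∘L op g).toLinearMap) hK φ

lemma norm_ext_le {d : ℕ} (s : ℝ) {g : E d → ℝ} {K : ℝ}
    (hK : ∀ φ : 𝓢(E d, ℂ), ‖toL s (op g φ)‖ ≤ K * ‖toL s φ‖) (f : L2s d s) :
    ‖ext s g f‖ ≤ K * ‖f‖ :=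
  norm_schwartzExt_le (T := (toL s ∘L op g).toLinearMap) hK f

lemma L2s_clm_ext {d : ℕ} {s : ℝ} {F : Type*} [TopologicalSpace F] [T2Space F] {f g : L2s d s → F}
    (hf : Continuous f) (hg : Continuous g) (h : ∀ φ : 𝓢(E d, ℂ), f (toL s φ) = g (toL s φ)) :
    f = g :=
  (toL_dense (d := d) s).equalizer hf hg (funext h)

lemma pair_ext {d : ℕ} (s : ℝ) {g : E d → ℝ} (hg : BoundedSymbol g) (ψ : 𝓢(E d, ℂ))
    (f : L2s d s) : pair s ψ (ext s g f) = pair s (op g ψ) f := by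
  refine congrFun (L2s_clm_ext (f := fun f => pair s ψ (ext s g f))
    (g := fun f => pair s (op g ψ) f) ((pair s ψ).continuous.comp (ext s g).continuous)
    (pair s (op g ψ)).continuous fun φ => ?_) f
  rw [ext_toL s hg, pair_toL, pair_toL, op_symm hg.temperate hg.even]

/-- Either side is determined by the pairings `∫ f · op g φ`, in which the weight no longer occurs.
Hence the extensions to different spaces `L²_s` are one operator. -/
lemma ext_congr {d : ℕ} {s r : ℝ} {g : E d → ℝ} (hg : BoundedSymbol g) {f : L2s d s}
    {f' : L2s d r} (h : f =ᵐ[volume] f') : ext s g f =ᵐ[volume] ext r g f' := by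
  refine ae_eq_of_integral_mul_schwartz (L2s_locallyIntegrable _) (L2s_locallyIntegrable _)
    fun φ => ?_
  rw [← pair_apply, ← pair_apply, pair_ext s hg, pair_ext r hg, pair_congr _ h]

/-! ### Iterated derivatives of Schwartz functions -/

/-- The iterated derivative in the coordinate directions of a list. -/
def listDeriv {d : ℕ} (L : List (Fin d)) : 𝓢(E d, ℂ) →L[ℂ] 𝓢(E d, ℂ) :=
  L.foldr (fun i T => LineDeriv.lineDerivOpCLM ℂ 𝓢(E d, ℂ) (ev i : E d) ∘L T)
    (ContinuousLinearMap.id ℂ _)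

lemma listDeriv_nil {d : ℕ} (φ : 𝓢(E d, ℂ)) : listDeriv [] φ = φ := rfl

lemma listDeriv_cons {d : ℕ} (i : Fin d) (L : List (Fin d)) (φ : 𝓢(E d, ℂ)) :
    listDeriv (i :: L) φ = ∂_{ev i} (listDeriv L φ) := rfl

lemma listDeriv_append {d : ℕ} (L M : List (Fin d)) (φ : 𝓢(E d, ℂ)) :
    listDeriv (L ++ M) φ = listDeriv L (listDeriv M φ) := by
  induction L with
  | nil => rfl
  | cons i L ih => rw [List.cons_append, listDeriv_cons, listDeriv_cons, ih]

lemma listDeriv_lineDeriv {d : ℕ} (m : E d) (L : List (Fin d)) (φ : 𝓢(E d, ℂ)) :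
    listDeriv L (∂_{m} φ) = ∂_{m} (listDeriv L φ) := by
  induction L with
  | nil => rfl
  | cons i L ih => rw [listDeriv_cons, listDeriv_cons, ih, lineDeriv_comm]

lemma op_listDeriv {d : ℕ} {g : E d → ℝ} (hg : g.HasTemperateGrowth) (L : List (Fin d))
    (φ : 𝓢(E d, ℂ)) : op g (listDeriv L φ) = listDeriv L (op g φ) := by
  induction L with
  | nil => rfl
  | cons i L ih => rw [listDeriv_cons, listDeriv_cons, op_lineDeriv hg, ih]

lemma integral_mul_listDeriv {d : ℕ} (L : List (Fin d)) (φ ψ : 𝓢(E d, ℂ)) :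
    ∫ x, φ x * listDeriv L ψ x = (-1 : ℂ) ^ L.length * ∫ x, listDeriv L φ x * ψ x := by
  induction L generalizing φ with
  | nil => simp [listDeriv_nil]
  | cons i L ih =>
    rw [listDeriv_cons, integral_mul_lineDeriv, ih, listDeriv_lineDeriv, listDeriv_cons,
      List.length_cons, pow_succ]
    ring

/-- The list of directions, with multiplicities, belonging to a multi-index. -/
def dirList {d : ℕ} (α : Fin d → ℕ) : List (Fin d) :=
  (List.finRange d).flatMap fun i => List.replicate (α i) i

lemma length_dirList {d : ℕ} (α : Fin d → ℕ) : (dirList α).length = ∑ i, α i := by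
  rw [dirList, List.length_flatMap, Fin.sum_univ_def]
  simp

lemma listDeriv_replicate {d : ℕ} (i : Fin d) (n : ℕ) (φ : 𝓢(E d, ℂ)) :
    listDeriv (List.replicate n i) φ = (fun χ : 𝓢(E d, ℂ) => ∂_{(ev i : E d)} χ)^[n] φ := by
  induction n with
  | zero => rfl
  | succ n ih => rw [List.replicate_succ, listDeriv_cons, ih, Function.iterate_succ_apply']

/-- Lists of directions allow induction on one derivative at a time, which multi-indices do not;
this is the passage between the two. -/
lemma partialDeriv_eq {d : ℕ} (α : Fin d → ℕ) (φ : 𝓢(E d, ℂ)) :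
    partialDeriv α φ = listDeriv (dirList α) φ := by
  rw [partialDeriv, dirList]
  induction List.finRange d with
  | nil => rfl
  | cons i l ih =>
    rw [List.foldr_cons, List.flatMap_cons, listDeriv_append, ih, listDeriv_replicate]

/-! ### Weighted Sobolev spaces -/

/-- The multi-index as a function to `ℕ`. -/
abbrev MultiIndex.fn {d p : ℕ} (α : MultiIndex d p) : Fin d → ℕ := fun i => (α.1 i : ℕ)

lemma MultiIndex.zero_fn (d p : ℕ) : (MultiIndex.zero d p).fn = 0 := rfl

lemma partialDeriv_zero {d : ℕ} (φ : 𝓢(E d, ℂ)) : partialDeriv (0 : Fin d → ℕ) φ = φ := by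
  rw [partialDeriv_eq]
  have : dirList (0 : Fin d → ℕ) = [] := by
    rw [← List.length_eq_zero_iff, length_dirList]; simp
  rw [this, listDeriv_nil]

lemma mem_sobolev_iff {d p : ℕ} {s : ℝ} (F : PiLp 2 fun _ : MultiIndex d p => L2s d s) :
    F ∈ sobolev d p s ↔ ∀ (α : MultiIndex d p) (φ : 𝓢(E d, ℂ)),
      pair s (partialDeriv α.fn φ) (F (MultiIndex.zero d p)) =
        (-1 : ℂ) ^ (∑ i, α.fn i) * pair s φ (F α) := by
  simp only [pair_apply]
  rfl

lemma Hps_spec {d p : ℕ} {s : ℝ} (F : Hps d p s) (α : MultiIndex d p) (φ : 𝓢(E d, ℂ)) :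
    pair s (partialDeriv α.fn φ) F.toL2s = (-1 : ℂ) ^ (∑ i, α.fn i) * pair s φ (F.1 α) :=
  (mem_sobolev_iff F.1).1 F.2 α φ

lemma Hps_ext {d p : ℕ} {s : ℝ} {F G : Hps d p s} (h : F.toL2s = G.toL2s) : F = G := by
  refine Subtype.ext (PiLp.ext fun α => L2s_ext_of_pair fun φ => ?_)
  have h1 := Hps_spec F α φ
  rw [h, Hps_spec G α φ] at h1
  exact (mul_left_cancel₀ (pow_ne_zero _ (by norm_num)) h1).symm

/-- The projection to a component of the family of weak derivatives. -/
def comp {d p : ℕ} {s : ℝ} (α : MultiIndex d p) : Hps d p s →L[ℂ] L2s d s :=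
  PiLp.proj 2 (fun _ : MultiIndex d p => L2s d s) α ∘L (sobolev d p s).subtypeL

lemma comp_apply {d p : ℕ} {s : ℝ} (α : MultiIndex d p) (F : Hps d p s) : comp α F = F.1 α := rfl

lemma comp_zero {d p : ℕ} {s : ℝ} (F : Hps d p s) : comp (MultiIndex.zero d p) F = F.toL2s := rfl

/-- The weak derivative relations are equalities between continuous functionals. Closedness gives
completeness, which extension by density into `H^p_s` requires. -/
lemma isClosed_sobolev (d p : ℕ) (s : ℝ) :
    IsClosed (sobolev d p s : Set (PiLp 2 fun _ : MultiIndex d p => L2s d s)) := by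
  have : (sobolev d p s : Set (PiLp 2 fun _ : MultiIndex d p => L2s d s)) =
      ⋂ (α : MultiIndex d p) (φ : 𝓢(E d, ℂ)), {F |
        pair s (partialDeriv α.fn φ) (PiLp.proj 2 (𝕜 := ℂ) (fun _ : MultiIndex d p => L2s d s)
          (MultiIndex.zero d p) F) = (-1 : ℂ) ^ (∑ i, α.fn i) *
          pair s φ (PiLp.proj 2 (𝕜 := ℂ) (fun _ : MultiIndex d p => L2s d s) α F)} := by
    ext F
    simp only [SetLike.mem_coe, mem_sobolev_iff, mem_iInter, mem_ofPred_eq, PiLp.proj_apply]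
  rw [this]
  refine isClosed_iInter fun α => isClosed_iInter fun φ => isClosed_eq ?_ ?_
  · exact (pair s _ ∘L PiLp.proj 2 (𝕜 := ℂ) (fun _ : MultiIndex d p => L2s d s) _).continuous
  · exact continuous_const.mul
      (pair s _ ∘L PiLp.proj 2 (𝕜 := ℂ) (fun _ : MultiIndex d p => L2s d s) _).continuous

instance (d p : ℕ) (s : ℝ) : CompleteSpace (Hps d p s) :=
  (isClosed_sobolev d p s).completeSpace_coe

/-- A continuous linear map into `H^p_s` given by its components. -/
def mkHps {d p : ℕ} {s : ℝ} {V : Type*} [NormedAddCommGroup V] [NormedSpace ℂ V]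
    (T : MultiIndex d p → V →L[ℂ] L2s d s)
    (h : ∀ v (α : MultiIndex d p) (φ : 𝓢(E d, ℂ)),
      pair s (partialDeriv α.fn φ) (T (MultiIndex.zero d p) v) =
        (-1 : ℂ) ^ (∑ i, α.fn i) * pair s φ (T α v)) : V →L[ℂ] Hps d p s :=
  ((PiLp.continuousLinearEquiv 2 ℂ (fun _ : MultiIndex d p => L2s d s)).symm.toContinuousLinearMap ∘L
    ContinuousLinearMap.pi T).codRestrict (sobolev d p s)
      fun v => (mem_sobolev_iff _).2 fun α φ => h v α φ

/-- The extension of a Fourier multiplier to `H^p_s`. -/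
def extH {d : ℕ} (p : ℕ) (s : ℝ) {g : E d → ℝ} (hg : BoundedSymbol g) : Hps d p s →L[ℂ] Hps d p s :=
  mkHps (fun α => ext s g ∘L comp α) fun F α φ => by
    -- The multiplier moves onto the test function, where it commutes with derivatives; what remains
    -- is the weak derivative relation for `F`, tested with `op g φ`.
    simp only [ContinuousLinearMap.comp_apply, pair_ext s hg, comp_apply]
    rw [partialDeriv_eq, op_listDeriv hg.temperate, ← partialDeriv_eq]
    exact Hps_spec F α (op g φ)

lemma toL2s_extH {d : ℕ} (p : ℕ) (s : ℝ) {g : E d → ℝ} (hg : BoundedSymbol g) (F : Hps d p s) :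
    (extH p s hg F).toL2s = ext s g F.toL2s := rfl

/-- The inclusion of multi-indices of order `≤ q` in those of order `≤ p`. -/
def MultiIndex.castLE {d p q : ℕ} (h : q ≤ p) (α : MultiIndex d q) : MultiIndex d p :=
  ⟨fun i => Fin.castLE (by omega) (α.1 i), by simpa using α.2.trans h⟩

lemma MultiIndex.castLE_zero {d p q : ℕ} (h : q ≤ p) :
    (MultiIndex.zero d q).castLE h = MultiIndex.zero d p := rfl

/-- The inclusion `H^p_s ⊆ H^q_r` for `q ≤ p`, `r ≤ s`. -/
def restr {d p q : ℕ} {s r : ℝ} (hq : q ≤ p) (hr : r ≤ s) : Hps d p s →L[ℂ] Hps d q r :=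
  mkHps (fun α => incl hr ∘L comp (α.castLE hq)) fun F α φ => by
    simp only [ContinuousLinearMap.comp_apply, comp_apply, MultiIndex.castLE_zero]
    rw [pair_congr _ (incl_coe hr _), pair_congr _ (incl_coe hr _)]
    exact Hps_spec F (α.castLE hq) φ

lemma toL2s_restr {d p q : ℕ} {s r : ℝ} (hq : q ≤ p) (hr : r ≤ s) (F : Hps d p s) :
    (restr hq hr F).toL2s = incl hr F.toL2s := rfl

/-- The embedding of the Schwartz space into `H^p_s`. -/
def toH {d : ℕ} (p : ℕ) (s : ℝ) : 𝓢(E d, ℂ) →ₗ[ℂ] Hps d p s where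
  toFun φ := ⟨WithLp.toLp 2 fun α => toL s (listDeriv (dirList α.fn) φ), by
    refine (mem_sobolev_iff _).2 fun α ψ => ?_
    simp only [pair_toL, MultiIndex.zero_fn]
    rw [← partialDeriv_eq 0, partialDeriv_zero, partialDeriv_eq, integral_mul_listDeriv,
      length_dirList]⟩
  map_add' φ ψ := by
    refine Subtype.ext (PiLp.ext fun α => ?_)
    simp
  map_smul' c φ := by
    refine Subtype.ext (PiLp.ext fun α => ?_)
    simp

lemma comp_toH {d p : ℕ} (s : ℝ) (α : MultiIndex d p) (φ : 𝓢(E d, ℂ)) :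
    comp α (toH p s φ) = toL s (listDeriv (dirList α.fn) φ) := rfl

lemma toL2s_toH {d : ℕ} (p : ℕ) (s : ℝ) (φ : 𝓢(E d, ℂ)) : (toH p s φ).toL2s = toL s φ := by
  rw [← comp_zero, comp_toH, MultiIndex.zero_fn, ← partialDeriv_eq, partialDeriv_zero]

lemma norm_Hps_le {d p : ℕ} {s : ℝ} (F : Hps d p s) : ‖F‖ ≤ ∑ α, ‖comp α F‖ := by
  change ‖F.1‖ ≤ _
  rw [PiLp.norm_eq_of_L2]
  refine Real.sqrt_le_iff.2 ⟨Finset.sum_nonneg fun _ _ => norm_nonneg _, ?_⟩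
  exact Finset.sum_sq_le_sq_sum_of_nonneg fun _ _ => norm_nonneg _

lemma tendsto_Hps {d p : ℕ} {s : ℝ} {ι : Type*} {l : Filter ι} {F : ι → Hps d p s} {G : Hps d p s}
    (h : ∀ α, Tendsto (fun i => comp α (F i)) l (𝓝 (comp α G))) : Tendsto F l (𝓝 G) := by
  rw [tendsto_iff_norm_sub_tendsto_zero]
  have h1 : Tendsto (fun i => ∑ α, ‖comp α (F i - G)‖) l (𝓝 0) := by
    have h2 := tendsto_finsetSum (Finset.univ : Finset (MultiIndex d p)) fun α _ =>
      tendsto_iff_norm_sub_tendsto_zero.1 (h α)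
    simpa only [map_sub, Finset.sum_const_zero] using h2
  exact squeeze_zero (fun _ => norm_nonneg _) (fun i => norm_Hps_le _) h1

lemma toH_bound {d p : ℕ} {s : ℝ} {T : 𝓢(E d, ℂ) →L[ℂ] 𝓢(E d, ℂ)}
    (hT : ∀ L : List (Fin d), L.length ≤ p → ∃ C : ℝ, ∀ φ,
      ‖toL s (listDeriv L (T φ))‖ ≤ C * ‖toL s φ‖) :
    ∃ C : ℝ, ∀ φ, ‖(toH p s ∘ₗ T.toLinearMap) φ‖ ≤ C * ‖toL s φ‖ := by
  have h : ∀ α : MultiIndex d p, ∃ C : ℝ, ∀ φ,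
      ‖toL s (listDeriv (dirList α.fn) (T φ))‖ ≤ C * ‖toL s φ‖ := fun α =>
    hT _ ((length_dirList α.fn).trans_le α.2)
  choose C hC using h
  refine ⟨∑ α, C α, fun φ => (norm_Hps_le _).trans ?_⟩
  rw [Finset.sum_mul]
  exact Finset.sum_le_sum fun α _ => hC α φ

/-- The extension to `L²_s → H^p_s` of a smoothing operator. -/
def extToH {d : ℕ} (p : ℕ) (s : ℝ) (T : 𝓢(E d, ℂ) →L[ℂ] 𝓢(E d, ℂ)) : L2s d s →L[ℂ] Hps d p s :=
  schwartzExt s (toH p s ∘ₗ T.toLinearMap)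

lemma extToH_toL {d p : ℕ} {s : ℝ} {T : 𝓢(E d, ℂ) →L[ℂ] 𝓢(E d, ℂ)}
    (hT : ∀ L : List (Fin d), L.length ≤ p → ∃ C : ℝ, ∀ φ,
      ‖toL s (listDeriv L (T φ))‖ ≤ C * ‖toL s φ‖) (φ : 𝓢(E d, ℂ)) :
    extToH p s T (toL s φ) = toH p s (T φ) := by
  obtain ⟨C, hC⟩ := toH_bound hT
  exact schwartzExt_toL hC φ

lemma toL2s_extToH {d p : ℕ} {s : ℝ} {g : E d → ℝ} (hg : BoundedSymbol g)
    (hT : ∀ L : List (Fin d), L.length ≤ p → ∃ C : ℝ, ∀ φ,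
      ‖toL s (listDeriv L (op g φ))‖ ≤ C * ‖toL s φ‖) (f : L2s d s) :
    (extToH p s (op g) f).toL2s = ext s g f := by
  refine congrFun (L2s_clm_ext (f := fun f => comp (MultiIndex.zero d p) (extToH p s (op g) f))
    (g := ext s g) ((comp _).continuous.comp (extToH p s (op g)).continuous)
    (ext s g).continuous fun φ => ?_) f
  rw [extToH_toL hT, comp_zero, toL2s_toH, ext_toL s hg]

lemma extToH_mem_closure {d p : ℕ} {s : ℝ} {T : 𝓢(E d, ℂ) →L[ℂ] 𝓢(E d, ℂ)}
    (hT : ∀ L : List (Fin d), L.length ≤ p → ∃ C : ℝ, ∀ φ,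
      ‖toL s (listDeriv L (T φ))‖ ≤ C * ‖toL s φ‖) (f : L2s d s) :
    extToH p s T f ∈ closure (range (toH (d := d) p s)) := by
  refine map_mem_closure (extToH p s T).continuous (toL_dense (d := d) s f) ?_
  rintro _ ⟨φ, rfl⟩
  exact ⟨T φ, (extToH_toL hT φ).symm⟩

/-! ### Smoothing by averages of the wave propagator -/

/-- The symbol `sin(2π|ξ|ε) / (2π|ξ|ε)`. -/
def avgSym {d : ℕ} (ε : ℝ) : E d → ℝ := cosInt (fun _ => ε⁻¹) ε

lemma avgSym_bounded {d : ℕ} {ε : ℝ} (hε : 0 ≤ ε) : BoundedSymbol (avgSym ε : E d → ℝ) :=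
  boundedSymbol_cosInt continuous_const hε

lemma avgSym_eq {d : ℕ} (ε : ℝ) (ξ : E d) : avgSym ε ξ = ε⁻¹ * sinSym ε ξ := by
  simp [avgSym, sinSym, cosInt, intervalIntegral.integral_const_mul]

/-- The kernel `(ε - b)²/(2ε)` has second derivative `ε⁻¹` and vanishes to second order at `ε`. Two
integrations by parts therefore leave only the boundary value `1` coming from its slope at `0`. -/
lemma avgSym_sub_one {d : ℕ} {ε : ℝ} (hε : 0 < ε) (ξ : E d) :
    avgSym ε ξ - 1 = -lapSym ξ * cosInt (fun b => (ε - b) ^ 2 / (2 * ε)) ε ξ := by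
  set l := 2 * Real.pi * ‖ξ‖ with hl
  have h : ∀ a ∈ uIcc (0 : ℝ) ε, HasDerivAt (fun a => (ε - a) ^ 2 / (2 * ε) * (l * Real.sin (l * a)) -
      (ε - a) / ε * Real.cos (l * a))
      (l ^ 2 * ((ε - a) ^ 2 / (2 * ε) * Real.cos (l * a)) + ε⁻¹ * Real.cos (l * a)) a := fun a _ => by
    have hla : HasDerivAt (fun a => l * a) l a := by simpa using (hasDerivAt_id a).const_mul l
    have h0 : HasDerivAt (fun a => ε - a) (-1) a := by simpa using (hasDerivAt_id a).const_sub ε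
    have h1 := ((((h0.pow 2).div_const (2 * ε)).mul (hla.sin.const_mul l))).sub
      ((h0.div_const ε).mul hla.cos)
    refine h1.congr_deriv ?_
    simp only [Pi.pow_apply]
    field_simp
    ring
  have h2 := intervalIntegral.integral_eq_sub_of_hasDerivAt h
      (Continuous.intervalIntegrable (by fun_prop) _ _)
  rw [intervalIntegral.integral_add (Continuous.intervalIntegrable (by fun_prop) _ _)
    (Continuous.intervalIntegrable (by fun_prop) _ _), intervalIntegral.integral_const_mul] at h2
  rw [avgSym, lapSym, cosInt, cosInt, ← hl]
  have h3 : ε / ε = 1 := div_self hε.ne'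
  simp [h3] at h2
  simp only [intervalIntegral.integral_const_mul] at h2 ⊢
  linarith

lemma op_sub_one {d : ℕ} {g : E d → ℝ} (hg : g.HasTemperateGrowth) (φ : 𝓢(E d, ℂ)) :
    op (fun ξ => g ξ - 1) φ = op g φ - φ := by
  have h : (fun ξ => g ξ - 1).HasTemperateGrowth := by fun_prop
  refine schwartz_ext_fourier fun ξ => ?_
  rw [fourier_op h, sub_eq_add_neg (op g φ), FourierTransform.fourier_add, FourierTransform.fourier_neg,
    add_apply, neg_apply, fourier_op hg]
  push_cast
  ring

lemma op_avgSym_sub {d : ℕ} {ε : ℝ} (hε : 0 < ε) (φ : 𝓢(E d, ℂ)) :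
    op (avgSym ε) φ - φ = op (cosInt (fun b => (ε - b) ^ 2 / (2 * ε)) ε) (Δ φ) := by
  have hc : (cosInt (fun b => (ε - b) ^ 2 / (2 * ε)) ε : E d → ℝ).HasTemperateGrowth :=
    cosInt_temperate (by fun_prop) hε.le
  have ha := (avgSym_bounded (d := d) hε.le).temperate
  have h : (fun ξ : E d => avgSym ε ξ - 1).HasTemperateGrowth := by fun_prop
  rw [← op_sub_one ha]
  refine schwartz_ext_fourier fun ξ => ?_
  rw [fourier_op h, fourier_op hc, fourier_laplacian, avgSym_sub_one hε]
  push_cast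
  ring

/-- A sequence of widths tending to `0`. -/
def eps (n : ℕ) : ℝ := 1 / ((n : ℝ) + 1)

lemma eps_pos (n : ℕ) : 0 < eps n := by unfold eps; positivity

lemma eps_le_one (n : ℕ) : eps n ≤ 1 := by
  unfold eps
  rw [div_le_one (by positivity)]
  linarith [(Nat.cast_nonneg n : (0 : ℝ) ≤ n)]

lemma tendsto_eps : Tendsto eps atTop (𝓝 0) := tendsto_one_div_add_atTop_nhds_zero_nat

/-- The kernel of the average has mass `1` for every width, which gives a uniform bound. The kernel
of its deviation from the identity is at most `1` on `[0, ε]`, hence has mass at most `ε`; the price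
is a Laplacian on `φ`. -/
lemma avgSym_uniform (d : ℕ) (s : ℝ) : ∃ K : ℝ, 0 ≤ K ∧ ∀ n, ∀ φ : 𝓢(E d, ℂ),
    ‖toL s (op (avgSym (eps n)) φ)‖ ≤ K * ‖toL s φ‖ ∧
      ‖toL s (op (avgSym (eps n)) φ - φ)‖ ≤ eps n * (K * ‖toL s (Δ φ)‖) := by
  obtain ⟨K, hK0, hK⟩ := cosInt_bounds d s 1
  refine ⟨K, hK0, fun n φ => ⟨?_, ?_⟩⟩
  · refine (hK _ continuous_const (eps n) ⟨(eps_pos n).le, eps_le_one n⟩ φ).trans_eq ?_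
    have h := (eps_pos n).ne'
    simp [abs_of_pos (eps_pos n), h]
  · rw [op_avgSym_sub (eps_pos n)]
    refine (hK _ (by fun_prop) (eps n) ⟨(eps_pos n).le, eps_le_one n⟩ (Δ φ)).trans ?_
    have h1 : ∫ b in (0 : ℝ)..eps n, |(eps n - b) ^ 2 / (2 * eps n)| ≤ eps n := by
      have h2 : ∫ b in (0 : ℝ)..eps n, |(eps n - b) ^ 2 / (2 * eps n)| ≤
          ∫ _ in (0 : ℝ)..eps n, (1 : ℝ) := by
        have h0 := eps_pos n
        have h1 := eps_le_one n
        refine intervalIntegral.integral_mono_on h0.le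
          (Continuous.intervalIntegrable (by fun_prop) _ _)
          (Continuous.intervalIntegrable (by fun_prop) _ _) fun b hb => ?_
        rw [abs_of_nonneg (by positivity), div_le_one (by positivity)]
        nlinarith [hb.1, hb.2]
      simpa using h2
    have h3 : 0 ≤ K * ‖toL s (Δ φ)‖ := mul_nonneg hK0 (norm_nonneg _)
    calc _ = (∫ b in (0 : ℝ)..eps n, |(eps n - b) ^ 2 / (2 * eps n)|) * (K * ‖toL s (Δ φ)‖) := by
          ring
      _ ≤ _ := mul_le_mul_of_nonneg_right h1 h3

lemma tendsto_op_avgSym_pow {d : ℕ} (s : ℝ) (p : ℕ) (φ : 𝓢(E d, ℂ)) :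
    Tendsto (fun n => toL s (op (fun ξ => avgSym (eps n) ξ ^ p) φ)) atTop (𝓝 (toL s φ)) := by
  obtain ⟨K, hK0, hK⟩ := avgSym_uniform d s
  have ht : ∀ n p, (fun ξ : E d => avgSym (eps n) ξ ^ p).HasTemperateGrowth := fun n p =>
    ((avgSym_bounded (eps_pos n).le).pow p).temperate
  induction p with
  | zero => simp [op_one_sym]
  | succ p ih =>
    have ha : ∀ n, (avgSym (eps n) : E d → ℝ).HasTemperateGrowth := fun n =>
      (avgSym_bounded (eps_pos n).le).temperate
    -- Telescoping: `a^{p+1} - 1 = a (a^p - 1) + (a - 1)`, where the first term is handled by the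
    -- uniform bound and the induction hypothesis.
    have h1 : ∀ n, toL s (op (fun ξ : E d => avgSym (eps n) ξ ^ (p + 1)) φ) =
        toL s (op (avgSym (eps n)) (op (fun ξ => avgSym (eps n) ξ ^ p) φ - φ)) +
          toL s (op (avgSym (eps n)) φ - φ) + toL s φ := fun n => by
      rw [← map_add, ← map_add, map_sub, op_op (ha n) (ht n p)]
      simp only [pow_succ', sub_add_sub_cancel, sub_add_cancel]
    simp only [h1]
    have h2 : Tendsto (fun n => toL s (op (avgSym (eps n))
        (op (fun ξ => avgSym (eps n) ξ ^ p) φ - φ))) atTop (𝓝 0) := by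
      rw [tendsto_zero_iff_norm_tendsto_zero]
      have h3 := (tendsto_iff_norm_sub_tendsto_zero.1 ih).const_mul K
      rw [mul_zero] at h3
      refine squeeze_zero (fun _ => norm_nonneg _) (fun n => ?_) h3
      rw [← map_sub]
      exact (hK n _).1
    have h4 : Tendsto (fun n => toL s (op (avgSym (eps n)) φ - φ)) atTop (𝓝 0) := by
      rw [tendsto_zero_iff_norm_tendsto_zero]
      have h5 := tendsto_eps.mul_const (K * ‖toL s (Δ φ)‖)
      rw [zero_mul] at h5
      exact squeeze_zero (fun _ => norm_nonneg _) (fun n => (hK n φ).2) h5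
    simpa using (h2.add h4).add_const (toL s φ)

lemma avgSym_pow_uniform (d : ℕ) (s : ℝ) (p : ℕ) : ∃ K : ℝ, 0 ≤ K ∧ ∀ n, ∀ φ : 𝓢(E d, ℂ),
    ‖toL s (op (fun ξ => avgSym (eps n) ξ ^ p) φ)‖ ≤ K * ‖toL s φ‖ := by
  obtain ⟨K, hK0, hK⟩ := avgSym_uniform d s
  refine ⟨K ^ p, by positivity, fun n => ?_⟩
  have ha : (avgSym (eps n) : E d → ℝ).HasTemperateGrowth :=
    (avgSym_bounded (eps_pos n).le).temperate
  induction p with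
  | zero => intro φ; simp [op_one_sym]
  | succ p ih =>
    intro φ
    have h1 : op (fun ξ : E d => avgSym (eps n) ξ ^ (p + 1)) φ =
        op (avgSym (eps n)) (op (fun ξ => avgSym (eps n) ξ ^ p) φ) := by
      rw [op_op ha ((avgSym_bounded (eps_pos n).le).pow p).temperate]
      simp only [pow_succ']
    rw [h1, pow_succ', mul_assoc]
    exact ((hK n _).1).trans (mul_le_mul_of_nonneg_left (ih φ) hK0)

lemma tendsto_ext_avgSym_pow {d : ℕ} (s : ℝ) (p : ℕ) (f : L2s d s) :
    Tendsto (fun n => ext s (fun ξ => avgSym (eps n) ξ ^ p) f) atTop (𝓝 f) := by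
  obtain ⟨K, hK0, hK⟩ := avgSym_pow_uniform d s p
  rw [Metric.tendsto_atTop]
  intro δ hδ
  -- With `φ` this close to `f`, the errors on `f - φ` add up to at most `(K + 1) ‖f - φ‖ < δ/2`;
  -- the other half of `δ` is spent on `φ`.
  obtain ⟨_, ⟨φ, rfl⟩, hφ⟩ := Metric.mem_closure_iff.1 (toL_dense (d := d) s f) (δ / (2 * (K + 1)))
    (by positivity)
  obtain ⟨N, hN⟩ := Metric.tendsto_atTop.1 (tendsto_op_avgSym_pow s p φ) (δ / 2) (by positivity)
  refine ⟨N, fun n hn => ?_⟩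
  have hb := (avgSym_bounded (d := d) (eps_pos n).le).pow p
  have h1 := norm_ext_le s (hK n) (f - toL s φ)
  rw [map_sub, ext_toL s hb] at h1
  have h2 := hN n hn
  rw [dist_eq_norm] at h2 hφ ⊢
  have h3 : ext s (fun ξ => avgSym (eps n) ξ ^ p) f - f =
      (ext s (fun ξ => avgSym (eps n) ξ ^ p) f - toL s (op (fun ξ => avgSym (eps n) ξ ^ p) φ)) +
      (toL s (op (fun ξ => avgSym (eps n) ξ ^ p) φ) - toL s φ) - (f - toL s φ) := by abel
  rw [h3]
  refine (norm_sub_le _ _).trans_lt ((add_le_add_left (norm_add_le _ _) _).trans_lt ?_)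
  rw [lt_div_iff₀ (by positivity)] at hφ
  nlinarith

/-- Each of the `p` factors `ε⁻¹ sin(ε√-Δ)/√-Δ` can absorb one derivative, by the second bound of
`wave_bounds`. The constants blow up as `ε → 0`, but only boundedness for fixed `ε` is used. -/
lemma listDeriv_avgSym_pow {d : ℕ} (s : ℝ) {ε : ℝ} (hε : 0 < ε) (p : ℕ) : ∀ L : List (Fin d),
    L.length ≤ p → ∃ C : ℝ, ∀ φ : 𝓢(E d, ℂ),
      ‖toL s (listDeriv L (op (fun ξ => avgSym ε ξ ^ p) φ))‖ ≤ C * ‖toL s φ‖ := by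
  have hb := avgSym_bounded (d := d) hε.le
  induction p with
  | zero =>
    intro L hL
    obtain rfl : L = [] := by simpa using hL
    exact ⟨1, fun φ => by simp [op_one_sym, listDeriv_nil]⟩
  | succ p ih =>
    have h1 : ∀ φ : 𝓢(E d, ℂ), op (fun ξ => avgSym ε ξ ^ (p + 1)) φ =
        op (avgSym ε) (op (fun ξ => avgSym ε ξ ^ p) φ) := fun φ => by
      rw [op_op hb.temperate (hb.pow p).temperate]
      simp only [pow_succ']
    intro L hL
    rcases L with _ | ⟨i, L⟩
    · obtain ⟨C, -, hC⟩ := (hb.pow (p + 1)).bound s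
      exact ⟨C, hC⟩
    · obtain ⟨C, hC⟩ := ih L (by simpa using hL)
      obtain ⟨K, hK0, hK⟩ := wave_bounds d s ε
      refine ⟨ε⁻¹ * (K * C), fun φ => ?_⟩
      have h2 : ∀ ψ : 𝓢(E d, ℂ), op (avgSym ε) ψ = ((ε⁻¹ : ℝ) : ℂ) • op (sinSym ε) ψ := fun ψ => by
        rw [← op_const_mul (sinSym_temperate hε.le)]
        simp only [← avgSym_eq]
      rw [h1, listDeriv_cons, ← op_listDeriv hb.temperate, h2]
      have h3 : ∂_{(ev i : E d)} (((ε⁻¹ : ℝ) : ℂ) • op (sinSym ε)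
          (listDeriv L (op (fun ξ => avgSym ε ξ ^ p) φ))) =
          ((ε⁻¹ : ℝ) : ℂ) • ∂_{(ev i : E d)} (op (sinSym ε)
          (listDeriv L (op (fun ξ => avgSym ε ξ ^ p) φ))) :=
        LineDeriv.lineDerivOp_smul _ _ _
      rw [h3, map_smul, norm_smul, Complex.norm_real, Real.norm_of_nonneg (by positivity), mul_assoc]
      refine mul_le_mul_of_nonneg_left ?_ (by positivity)
      rw [mul_assoc]
      exact ((hK ε ⟨hε.le, le_rfl⟩ _).2 i).trans (mul_le_mul_of_nonneg_left (hC φ) hK0)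

/-- Componentwise convergence of the averages gives `a_n(D)^p F → F` in `H^p_s`. Each approximant
depends only on the `L²_s` function underlying `F`, through a continuous map `L²_s → H^p_s`
preserving Schwartz functions; density in `L²_s` thus puts it in the closure. -/
theorem toH_denseRange {d : ℕ} (p : ℕ) (s : ℝ) : DenseRange (toH (d := d) p s) := by
  intro F
  have hb : ∀ n, BoundedSymbol fun ξ : E d => avgSym (eps n) ξ ^ p := fun n =>
    (avgSym_bounded (eps_pos n).le).pow p
  have h1 : Tendsto (fun n => extH p s (hb n) F) atTop (𝓝 F) :=
    tendsto_Hps fun α => tendsto_ext_avgSym_pow s p (comp α F)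
  refine isClosed_closure.mem_of_tendsto h1 (.of_forall fun n => ?_)
  have hT := listDeriv_avgSym_pow (d := d) s (eps_pos n) p
  have h2 : extH p s (hb n) F = extToH p s (op fun ξ => avgSym (eps n) ξ ^ p) F.toL2s :=
    Hps_ext (by rw [toL2s_extH, toL2s_extToH (hb n) hT])
  rw [h2]
  exact extToH_mem_closure hT _

/-! ### Cutoffs -/

/-- The rescaled function `x ↦ c g(x / (n + 1))`. -/
def scaled {d : ℕ} (c : ℝ) (n : ℕ) (g : E d → ℝ) (x : E d) : ℝ := c * g (eps n • x)

lemma scaled_temperate {d : ℕ} (c : ℝ) (n : ℕ) {g : E d → ℝ} (hg : g.HasTemperateGrowth) :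
    (scaled c n g).HasTemperateGrowth := by
  have h : (fun x : E d => eps n • x).HasTemperateGrowth :=
    (eps n • ContinuousLinearMap.id ℝ (E d)).hasTemperateGrowth
  exact (Function.HasTemperateGrowth.const c).mul (hg.comp h)

lemma fderiv_scaled {d : ℕ} (c : ℝ) (n : ℕ) {g : E d → ℝ} (hg : ContDiff ℝ (⊤ : ℕ∞) g) (m x : E d) :
    fderiv ℝ (scaled c n g) x m = scaled (c * eps n) n (fun y => fderiv ℝ g y m) x := by
  have h1 : HasFDerivAt (fun x : E d => eps n • x) (eps n • ContinuousLinearMap.id ℝ (E d)) x :=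
    (eps n • ContinuousLinearMap.id ℝ (E d)).hasFDerivAt
  have h2 := ((hg.differentiable (by simp) (eps n • x)).hasFDerivAt.comp x h1).const_mul c
  have h3 : HasFDerivAt (scaled c n g) _ x := h2
  rw [h3.fderiv]
  simp [scaled]
  ring

lemma fderiv_apply_contDiff {d : ℕ} {g : E d → ℝ} (hg : ContDiff ℝ (⊤ : ℕ∞) g) (m : E d) :
    ContDiff ℝ (⊤ : ℕ∞) fun y => fderiv ℝ g y m :=
  (hg.fderiv_right (m := (⊤ : ℕ∞)) (by simp)).clm_apply contDiff_const

lemma fderiv_apply_hasCompactSupport {d : ℕ} {g : E d → ℝ} (hc : HasCompactSupport g) (m : E d) :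
    HasCompactSupport fun y => fderiv ℝ g y m :=
  hc.fderiv_apply ℝ m

/-- A derivative falling on the rescaled function produces one of the same form, with the prefactor
multiplied by `eps n ≤ 1`. The induction must therefore run over all `g`, `φ` and `|c| ≤ 1`. -/
lemma listDeriv_scaled_bound {d : ℕ} (s : ℝ) (L : List (Fin d)) : ∀ g : E d → ℝ,
    ContDiff ℝ (⊤ : ℕ∞) g → HasCompactSupport g → ∀ φ : 𝓢(E d, ℂ), ∃ C : ℝ, ∀ (n : ℕ) (c : ℝ),
      |c| ≤ 1 → ‖toL s (listDeriv L (mulS (scaled c n g) φ))‖ ≤ C := by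
  induction L with
  | nil =>
    intro g hg hc φ
    obtain ⟨M, hM⟩ := hg.continuous.bounded_above_of_compact_support hc
    have hM0 : 0 ≤ M := (norm_nonneg _).trans (hM 0)
    refine ⟨M * ‖toL s φ‖, fun n c hcn => ?_⟩
    rw [listDeriv_nil]
    refine norm_toL_le_of_norm_le hM0 fun x => ?_
    rw [mulS_apply (scaled_temperate c n (hc.hasTemperateGrowth hg)), norm_mul, Complex.norm_real,
      scaled, norm_mul]
    have h1 : ‖c‖ * ‖g (eps n • x)‖ ≤ 1 * M := by gcongr; exacts [hcn, hM _]
    have h2 := (wt_pos s x).le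
    calc wt s x * (‖c‖ * ‖g (eps n • x)‖ * ‖φ x‖) ^ 2
        ≤ wt s x * (1 * M * ‖φ x‖) ^ 2 := by gcongr
      _ = _ := by ring
  | cons i L ih =>
    intro g hg hc φ
    obtain ⟨C₁, h₁⟩ := ih _ (fderiv_apply_contDiff hg (ev i))
      (fderiv_apply_hasCompactSupport hc (ev i)) φ
    obtain ⟨C₂, h₂⟩ := ih g hg hc (∂_{(ev i : E d)} φ)
    refine ⟨C₁ + C₂, fun n c hcn => ?_⟩
    have ht := scaled_temperate c n (hc.hasTemperateGrowth hg)
    have ht' := scaled_temperate (c * eps n) n ((fderiv_apply_hasCompactSupport hc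
      (ev i)).hasTemperateGrowth (fderiv_apply_contDiff hg (ev i)))
    rw [listDeriv_cons, ← listDeriv_lineDeriv,
      lineDeriv_mulS ht ht' _ (fun x => fderiv_scaled c n hg (ev i) x), map_add, map_add]
    refine (norm_add_le _ _).trans (add_le_add (h₁ n _ ?_) (h₂ n c hcn))
    rw [abs_mul, abs_of_pos (eps_pos n)]
    exact mul_le_one₀ hcn (eps_pos n).le (eps_le_one n)

lemma cutoff_temperate {d : ℕ} (n : ℕ) {g : E d → ℝ} (hg : g.HasTemperateGrowth) :
    (fun x => (eps n)⁻¹ * (1 - g (eps n • x))).HasTemperateGrowth := by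
  have h1 := (Function.HasTemperateGrowth.const (E := E d) (eps n)⁻¹).mul
    ((Function.HasTemperateGrowth.const (E := E d) (1 : ℝ)).sub (scaled_temperate 1 n hg))
  have h2 : (fun x => (eps n)⁻¹ * (1 - g (eps n • x))) =
      (fun _ => (eps n)⁻¹) * ((fun _ => (1 : ℝ)) - scaled 1 n g) := by
    funext x
    simp [scaled]
  rw [h2]
  exact h1

/-- Where `1 - g(εx)` is nonzero, `ε⁻¹ ≤ |x|`: the division by `ε` is paid for by one more power of
the weight, that is, by the norm of `L²_{s+1}`. When a derivative falls on the cutoff, the chain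
rule cancels the `ε⁻¹`. -/
lemma listDeriv_cutoff_bound {d : ℕ} (s : ℝ) {g : E d → ℝ} (hg : ContDiff ℝ (⊤ : ℕ∞) g)
    (hc : HasCompactSupport g) (hg1 : ∀ x, ‖x‖ ≤ 1 → g x = 1) (L : List (Fin d)) :
    ∀ φ : 𝓢(E d, ℂ), ∃ C : ℝ, ∀ n : ℕ,
      ‖toL s (listDeriv L (mulS (fun x => (eps n)⁻¹ * (1 - g (eps n • x))) φ))‖ ≤ C := by
  have ht := fun n => cutoff_temperate n (hc.hasTemperateGrowth hg)
  induction L with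
  | nil =>
    intro φ
    obtain ⟨M, hM⟩ := hg.continuous.bounded_above_of_compact_support hc
    have hM0 : 0 ≤ M := (norm_nonneg _).trans (hM 0)
    refine ⟨(1 + M) * ‖toL (s + 1) φ‖, fun n => ?_⟩
    rw [listDeriv_nil]
    refine norm_toL_le_of_norm_le (by positivity) fun x => ?_
    rw [mulS_apply (ht n), norm_mul, Complex.norm_real, norm_mul, norm_inv]
    have h1 : ‖eps n‖⁻¹ * ‖1 - g (eps n • x)‖ ≤ ‖x‖ * (1 + M) := by
      rcases le_total ‖eps n • x‖ 1 with h | h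
      · rw [hg1 _ h]; simp; positivity
      · rw [norm_smul] at h
        have h2 : ‖1 - g (eps n • x)‖ ≤ 1 + M := (norm_sub_le _ _).trans (by simpa using hM _)
        have h3 : 0 < ‖eps n‖ := norm_pos_iff.2 (eps_pos n).ne'
        have h4 : ‖eps n‖⁻¹ ≤ ‖x‖ := by
          rw [inv_le_iff_one_le_mul₀ h3]; linarith
        gcongr
    have h2 := (wt_pos s x).le
    have h3 : ‖x‖ ^ 2 ≤ wt 1 x := by simp [wt]
    rw [wt_add]
    calc wt s x * (‖eps n‖⁻¹ * ‖1 - g (eps n • x)‖ * ‖φ x‖) ^ 2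
        ≤ wt s x * (‖x‖ * (1 + M) * ‖φ x‖) ^ 2 := by gcongr
      _ = wt s x * ‖x‖ ^ 2 * ((1 + M) ^ 2 * ‖φ x‖ ^ 2) := by ring
      _ ≤ wt s x * wt 1 x * ((1 + M) ^ 2 * ‖φ x‖ ^ 2) := by gcongr
      _ = _ := by ring
  | cons i L ih =>
    intro φ
    obtain ⟨C₁, h₁⟩ := listDeriv_scaled_bound s L _ (fderiv_apply_contDiff hg (ev i))
      (fderiv_apply_hasCompactSupport hc (ev i)) φ
    obtain ⟨C₂, h₂⟩ := ih (∂_{(ev i : E d)} φ)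
    refine ⟨C₁ + C₂, fun n => ?_⟩
    have ht' := scaled_temperate (-1) n ((fderiv_apply_hasCompactSupport hc
      (ev i)).hasTemperateGrowth (fderiv_apply_contDiff hg (ev i)))
    have hd : ∀ x, fderiv ℝ (fun x => (eps n)⁻¹ * (1 - g (eps n • x))) x (ev i) =
        scaled (-1) n (fun y => fderiv ℝ g y (ev i)) x := fun x => by
      have e : (fun x => (eps n)⁻¹ * (1 - g (eps n • x))) =
          fun x => (eps n)⁻¹ + scaled (-(eps n)⁻¹) n g x := by
        ext x; simp [scaled]; ring
      rw [e, fderiv_const_add, fderiv_scaled _ n hg]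
      congr 1
      have := (eps_pos n).ne'
      field_simp
    rw [listDeriv_cons, ← listDeriv_lineDeriv, lineDeriv_mulS (ht n) ht' _ hd, map_add, map_add]
    exact (norm_add_le _ _).trans (add_le_add (h₁ n _ (by simp)) (h₂ n))

/-- Test functions are dense in `H^p_s`. -/
theorem dense_testFunctions (d p : ℕ) (s : ℝ) :
    Dense (toH (d := d) p s '' {φ | HasCompactSupport φ}) := by
  have hsub : range (toH (d := d) p s) ⊆ closure (toH (d := d) p s '' {φ | HasCompactSupport φ}) := by
    rintro _ ⟨φ, rfl⟩
    let b : ContDiffBump (0 : E d) := ⟨1, 2, one_pos, one_lt_two⟩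
    have hg : ContDiff ℝ (⊤ : ℕ∞) b := b.contDiff
    have hc := b.hasCompactSupport
    have hg1 : ∀ x, ‖x‖ ≤ 1 → b x = 1 := fun x hx => b.one_of_mem_closedBall (by simpa using hx)
    have ht := fun n => scaled_temperate 1 n (hc.hasTemperateGrowth hg)
    have htend : Tendsto (fun n => toH p s (mulS (scaled 1 n b) φ)) atTop (𝓝 (toH p s φ)) := by
      refine tendsto_Hps fun α => ?_
      simp only [comp_toH]
      obtain ⟨C, hC⟩ := listDeriv_cutoff_bound s hg hc hg1 (dirList α.fn) φ
      rw [tendsto_iff_norm_sub_tendsto_zero]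
      have h1 := tendsto_eps.mul_const C
      rw [zero_mul] at h1
      refine squeeze_zero (fun _ => norm_nonneg _) (fun n => ?_) h1
      have ht' := cutoff_temperate n (hc.hasTemperateGrowth hg)
      -- The cutoff error is `eps n` times a function bounded in `H^p_s` uniformly in `n`.
      have h3 : mulS (scaled 1 n b) φ =
          φ - (eps n : ℂ) • mulS (fun x => (eps n)⁻¹ * (1 - b (eps n • x))) φ := by
        ext x
        simp only [sub_apply, smul_apply, mulS_apply ht', mulS_apply (ht n), scaled, smul_eq_mul]
        have h4 : (eps n : ℂ) ≠ 0 := by exact_mod_cast (eps_pos n).ne'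
        push_cast
        field_simp
        ring
      rw [h3, map_sub, map_sub, sub_sub_cancel_left, norm_neg, map_smul, map_smul, norm_smul,
        Complex.norm_real, Real.norm_of_nonneg (eps_pos n).le]
      exact mul_le_mul_of_nonneg_left (hC n) (eps_pos n).le
    refine mem_closure_of_tendsto htend (.of_forall fun n => ⟨_, ?_, rfl⟩)
    have h5 : HasCompactSupport (scaled 1 n b) := by
      have h6 : HasCompactSupport fun x : E d => b (eps n • x) :=
        hc.comp_smul (eps_pos n).ne'
      exact h6.mul_left
    refine h5.mono fun x hx hx' => hx ?_
    rw [mulS_apply (ht n), hx']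
    simp
  exact ((toH_denseRange p s).mono hsub).of_closure

/-! ### The symbols of the Waveholtz operator -/

lemma period_pos {ω : ℝ} (hω : 0 < ω) : 0 < period ω := by unfold period; positivity

lemma omega_mul_period {ω : ℝ} (hω : 0 < ω) : ω * period ω = 2 * Real.pi := by
  unfold period; field_simp

lemma continuous_kernel (ω : ℝ) : Continuous (kernel ω) := by unfold kernel; fun_prop

/-- The symbol `β(2π|ξ|)` of `𝒮`. -/
def sSym {d : ℕ} (ω : ℝ) : E d → ℝ := cosInt (kernel ω) (period ω)

lemma sSym_bounded {d : ℕ} {ω : ℝ} (hω : 0 < ω) : BoundedSymbol (sSym ω : E d → ℝ) :=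
  boundedSymbol_cosInt (continuous_kernel ω) (period_pos hω).le

/-- The function `a ↦ ∫_a^T K(t) sin(ω(t - a)) dt`, in closed form. -/
def forcingKernel (ω a : ℝ) : ℝ :=
  2 / period ω * (-((period ω - a) / 2) * Real.sin (ω * a) - (1 - Real.cos (ω * a)) / (4 * ω))

/-- The symbol `(β(λ) - 1) / (λ² - ω²)`, `λ = 2π|ξ|`, of the response of `Π` to the forcing. -/
def mSym {d : ℕ} (ω : ℝ) : E d → ℝ := cosInt (fun a => -(1 / ω) * forcingKernel ω a) (period ω)

lemma mSym_bounded {d : ℕ} {ω : ℝ} (hω : 0 < ω) : BoundedSymbol (mSym ω : E d → ℝ) :=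
  boundedSymbol_cosInt (by unfold forcingKernel; fun_prop) (period_pos hω).le

/-- The kernel `k = forcingKernel ω` solves `k'' + ω² k = ω K` with `k(T) = k'(T) = 0` and `k'(0) =
-ω`. Integrating the derivative of `k l sin(la) + k' cos(la)` over a period gives the identity. It
shows that `(β(λ) - 1)/(λ² - ω²)` is a cosine integral, regular also at `λ = ω`. -/
lemma mSym_eq {d : ℕ} {ω : ℝ} (hω : 0 < ω) (ξ : E d) :
    (lapSym ξ - ω ^ 2) * mSym ω ξ = sSym ω ξ - 1 := by
  set l := 2 * Real.pi * ‖ξ‖ with hl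
  set T := period ω with hT
  have hT0 : 0 < T := period_pos hω
  let k' : ℝ → ℝ := fun a => 2 / T * (Real.sin (ω * a) / 4 - (T - a) / 2 * ω * Real.cos (ω * a))
  have hw : ∀ a, HasDerivAt (fun a => ω * a) ω a := fun a => by
    simpa using (hasDerivAt_id a).const_mul ω
  have hla : ∀ a, HasDerivAt (fun a => l * a) l a := fun a => by
    simpa using (hasDerivAt_id a).const_mul l
  have hTa : ∀ a, HasDerivAt (fun a => T - a) (-1) a := fun a => by
    simpa using (hasDerivAt_id a).const_sub T
  have hk : ∀ a, HasDerivAt (forcingKernel ω) (k' a) a := fun a => by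
    have h1 := ((((hTa a).div_const 2).neg.mul (hw a).sin).sub
      (((hw a).cos.const_sub 1).div_const (4 * ω))).const_mul (2 / T)
    refine HasDerivAt.congr_deriv (f := forcingKernel ω) h1 ?_
    simp only [k', Pi.neg_apply]
    field_simp
    ring
  have hk' : ∀ a, HasDerivAt k' (ω * kernel ω a - ω ^ 2 * forcingKernel ω a) a := fun a => by
    have h1 := ((((hw a).sin.div_const 4).sub
      ((((hTa a).div_const 2).mul_const ω).mul (hw a).cos)).const_mul (2 / T))
    refine HasDerivAt.congr_deriv (f := k') h1 ?_
    simp only [kernel, forcingKernel, ← hT]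
    field_simp
    ring
  have h : ∀ a ∈ uIcc (0 : ℝ) T, HasDerivAt
      (fun a => forcingKernel ω a * (l * Real.sin (l * a)) + k' a * Real.cos (l * a))
      ((l ^ 2 - ω ^ 2) * (forcingKernel ω a * Real.cos (l * a)) +
        ω * (kernel ω a * Real.cos (l * a))) a := fun a _ => by
    have h1 := ((hk a).mul ((hla a).sin.const_mul l)).add ((hk' a).mul (hla a).cos)
    refine h1.congr_deriv ?_
    ring
  have hkc : Continuous (forcingKernel ω) := by unfold forcingKernel; fun_prop
  have hKc := continuous_kernel ω
  have h2 := intervalIntegral.integral_eq_sub_of_hasDerivAt h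
      (Continuous.intervalIntegrable (by fun_prop) _ _)
  rw [intervalIntegral.integral_add (Continuous.intervalIntegrable (by fun_prop) _ _)
    (Continuous.intervalIntegrable (by fun_prop) _ _), intervalIntegral.integral_const_mul,
    intervalIntegral.integral_const_mul] at h2
  have e1 : forcingKernel ω T = 0 := by
    rw [forcingKernel, ← hT, omega_mul_period hω]; simp
  have e2 : k' T = 0 := by
    simp only [k']; rw [omega_mul_period hω]; simp
  have e3 : k' 0 = -ω := by
    simp only [k']
    simp
    field_simp
  rw [e1, e2, e3] at h2
  simp at h2
  have e4 : mSym ω ξ = -(1 / ω) * ∫ a in (0 : ℝ)..T, forcingKernel ω a * Real.cos (l * a) := by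
    rw [mSym, cosInt, ← intervalIntegral.integral_const_mul]
    refine intervalIntegral.integral_congr fun a _ => ?_
    exact mul_assoc _ _ _
  have e5 : sSym ω ξ = ∫ a in (0 : ℝ)..T, kernel ω a * Real.cos (l * a) := rfl
  rw [e4, e5, lapSym, ← hl]
  field_simp
  linarith

/-- This is `(Δ + ω²) m(D) = 1 - 𝒮`. It serves twice: to bound `Δ m(D)`, and to identify `m(D) f`
with `u - 𝒮u`. -/
lemma laplacian_op_mSym {d : ℕ} {ω : ℝ} (hω : 0 < ω) (φ : 𝓢(E d, ℂ)) :
    Δ (op (mSym ω) φ) = φ - op (sSym ω) φ - ((ω ^ 2 : ℝ) : ℂ) • op (mSym ω) φ := by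
  have hm := (mSym_bounded (d := d) hω).temperate
  have hs := (sSym_bounded (d := d) hω).temperate
  refine schwartz_ext_fourier fun ξ => ?_
  have h1 : (𝓕 (φ - op (sSym ω) φ - ((ω ^ 2 : ℝ) : ℂ) • op (mSym ω) φ) : 𝓢(E d, ℂ)) =
      𝓕 φ - 𝓕 (op (sSym ω) φ) - ((ω ^ 2 : ℝ) : ℂ) • 𝓕 (op (mSym ω) φ) := by
    rw [sub_eq_add_neg, sub_eq_add_neg, FourierTransform.fourier_add, FourierTransform.fourier_add,
      FourierTransform.fourier_neg, FourierTransform.fourier_neg, FourierTransform.fourier_smul,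
      ← sub_eq_add_neg, ← sub_eq_add_neg]
  rw [h1, fourier_laplacian, fourier_op hm, sub_apply, sub_apply, smul_apply, fourier_op hm,
    fourier_op hs]
  have h2 : ((lapSym ξ : ℂ) - (ω : ℂ) ^ 2) * (mSym ω ξ : ℂ) = (sSym ω ξ : ℂ) - 1 := by
    exact_mod_cast mSym_eq hω ξ
  push_cast
  rw [smul_eq_mul]
  linear_combination (-(𝓕 φ : 𝓢(E d, ℂ)) ξ) * h2

/-! ### Elliptic estimates in weighted spaces -/

/-- The weighted form of `‖∇w‖² = -⟨w, Δw⟩`; the second sum comes from derivatives of the weight. -/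
lemma sum_norm_lineDeriv_sq_le {d : ℕ} (s : ℝ) (w : 𝓢(E d, ℂ)) :
    ∑ j : Fin d, ‖toL s (∂_{ev j} w)‖ ^ 2 ≤ ‖(inner ℂ (toL s w) (toL s (Δ w)) : ℂ)‖ +
      ∑ j : Fin d, 2 * |s| * ‖toL s w‖ * ‖toL s (∂_{ev j} w)‖ := by
  have h1 : ((∑ j : Fin d, ‖toL s (∂_{ev j} w)‖ ^ 2 : ℝ) : ℂ) =
      -inner ℂ (toL s w) (toL s (Δ w)) -
        ∑ j, inner ℂ (toL s w) (toL s (mulS (logw s j) (∂_{ev j} w))) := by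
    rw [laplacian_eq_sum_lineDeriv, map_sum, inner_sum, ← Finset.sum_neg_distrib,
      ← Finset.sum_sub_distrib, Complex.ofReal_sum]
    refine Finset.sum_congr rfl fun j _ => ?_
    rw [← inner_self_ofReal, inner_lineDeriv]
  have h2 : ∑ j : Fin d, ‖toL s (∂_{ev j} w)‖ ^ 2 =
      ‖((∑ j : Fin d, ‖toL s (∂_{ev j} w)‖ ^ 2 : ℝ) : ℂ)‖ := by
    rw [Complex.norm_real, Real.norm_of_nonneg (Finset.sum_nonneg fun _ _ => sq_nonneg _)]
  rw [h2, h1]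
  refine (norm_sub_le _ _).trans (add_le_add (norm_neg _).le ?_)
  refine (norm_sum_le _ _).trans (Finset.sum_le_sum fun j _ => ?_)
  refine (norm_inner_le_norm _ _).trans ?_
  have := mul_le_mul_of_nonneg_left (mulS_logw_le s j (∂_{ev j} w)) (norm_nonneg (toL s w))
  linarith

/-- Young's inequality lets half of the squared gradient in the weight term be absorbed on the left.
The bound `1 ≤ C` is recorded so that `C (‖u‖ + ‖Δu‖)` also dominates `‖Δu‖` in the next estimate.
-/
lemma norm_lineDeriv_le {d : ℕ} (s : ℝ) : ∃ C : ℝ, 1 ≤ C ∧ ∀ (u : 𝓢(E d, ℂ)) (j : Fin d),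
    ‖toL s (∂_{ev j} u)‖ ≤ C * (‖toL s u‖ + ‖toL s (Δ u)‖) := by
  refine ⟨1 + d * (2 * |s|) ^ 2, by
    have : (0 : ℝ) ≤ d * (2 * |s|) ^ 2 := by positivity
    linarith, fun u j => ?_⟩
  have h := sum_norm_lineDeriv_sq_le s u
  have h1 : ‖(inner ℂ (toL s u) (toL s (Δ u)) : ℂ)‖ ≤ ‖toL s u‖ * ‖toL s (Δ u)‖ :=
    norm_inner_le_norm _ _
  have h2 : ∑ j : Fin d, 2 * |s| * ‖toL s u‖ * ‖toL s (∂_{ev j} u)‖ ≤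
      ∑ j : Fin d, ((2 * |s|) ^ 2 * ‖toL s u‖ ^ 2 / 2 + ‖toL s (∂_{ev j} u)‖ ^ 2 / 2) :=
    Finset.sum_le_sum fun j _ => by
      nlinarith [sq_nonneg (2 * |s| * ‖toL s u‖ - ‖toL s (∂_{ev j} u)‖)]
  rw [Finset.sum_add_distrib, ← Finset.sum_div, ← Finset.sum_div, Finset.sum_const,
    Finset.card_univ, Fintype.card_fin, nsmul_eq_mul] at h2
  have h3 : ‖toL s (∂_{ev j} u)‖ ^ 2 ≤ ∑ j : Fin d, ‖toL s (∂_{ev j} u)‖ ^ 2 :=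
    Finset.single_le_sum (f := fun j : Fin d => ‖toL s (∂_{ev j} u)‖ ^ 2)
      (fun _ _ => sq_nonneg _) (Finset.mem_univ j)
  have ha := norm_nonneg (toL s u)
  have hb := norm_nonneg (toL s (Δ u))
  generalize ‖toL s u‖ = a at *
  generalize ‖toL s (Δ u)‖ = b at *
  generalize ‖toL s (∂_{ev j} u)‖ = x at *
  generalize ∑ j : Fin d, ‖toL s (∂_{ev j} u)‖ ^ 2 = S at *
  have hc : (0 : ℝ) ≤ d * (2 * |s|) ^ 2 := by positivity
  have hc' : (d : ℝ) * ((2 * |s|) ^ 2 * a ^ 2) = d * (2 * |s|) ^ 2 * a ^ 2 := by ring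
  rw [hc'] at h2
  generalize (d : ℝ) * (2 * |s|) ^ 2 = c at *
  have h4 : x ^ 2 ≤ (1 + c) * (a + b) ^ 2 := by
    have h5 : a ^ 2 ≤ (a + b) ^ 2 := by nlinarith
    have h6 := mul_le_mul_of_nonneg_left h5 hc
    nlinarith [sq_nonneg a, sq_nonneg b]
  refine le_of_sq_le_sq (h4.trans ?_) (by positivity)
  rw [mul_pow]
  gcongr
  nlinarith

/-- The gradient estimate is applied to `w = ∂_k u`. Third derivatives in `⟨w, Δw⟩` are avoided by
moving `∂_k` off `∂_k Δu`, which leaves `Δu` against `∂_k w`. Two absorptions of a quarter each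
leave half of the squared gradient, whence the factor `2`. -/
lemma norm_lineDeriv_lineDeriv_le {d : ℕ} (s : ℝ) : ∃ C : ℝ, ∀ (u : 𝓢(E d, ℂ)) (j k : Fin d),
    ‖toL s (∂_{ev j} (∂_{(ev k : E d)} u))‖ ≤ C * (‖toL s u‖ + ‖toL s (Δ u)‖) := by
  obtain ⟨C, hC1, hC⟩ := norm_lineDeriv_le (d := d) s
  refine ⟨(2 * (1 + 2 * |s| + d * (2 * |s|) ^ 2)) * C, fun u j k => ?_⟩
  set w := ∂_{(ev k : E d)} u with hw
  have h := sum_norm_lineDeriv_sq_le s w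
  have hy := hC u k
  rw [← hw] at hy
  have h1 : ‖(inner ℂ (toL s w) (toL s (Δ w)) : ℂ)‖ ≤
      ‖toL s (Δ u)‖ * ‖toL s (∂_{(ev k : E d)} w)‖ +
        ‖toL s (Δ u)‖ * (2 * |s| * ‖toL s w‖) := by
    rw [hw, ← lineDeriv_laplacian, ← hw, ← inner_conj_symm, RCLike.norm_conj, inner_lineDeriv]
    refine (norm_sub_le _ _).trans (add_le_add ?_ ?_)
    · rw [norm_neg]; exact norm_inner_le_norm _ _
    · exact (norm_inner_le_norm _ _).trans
        (mul_le_mul_of_nonneg_left (mulS_logw_le s k w) (norm_nonneg _))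
  have h2 : ∑ j : Fin d, 2 * |s| * ‖toL s w‖ * ‖toL s (∂_{ev j} w)‖ ≤
      ∑ j : Fin d, ((2 * |s|) ^ 2 * ‖toL s w‖ ^ 2 + ‖toL s (∂_{ev j} w)‖ ^ 2 / 4) :=
    Finset.sum_le_sum fun j _ => by
      nlinarith [sq_nonneg (2 * |s| * ‖toL s w‖ - ‖toL s (∂_{ev j} w)‖ / 2)]
  rw [Finset.sum_add_distrib, ← Finset.sum_div, Finset.sum_const,
    Finset.card_univ, Fintype.card_fin, nsmul_eq_mul] at h2
  have h3 : ∀ j, ‖toL s (∂_{ev j} w)‖ ^ 2 ≤ ∑ j : Fin d, ‖toL s (∂_{ev j} w)‖ ^ 2 := fun j =>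
    Finset.single_le_sum (f := fun j : Fin d => ‖toL s (∂_{ev j} w)‖ ^ 2)
      (fun _ _ => sq_nonneg _) (Finset.mem_univ j)
  have hk := h3 k
  have hj := h3 j
  have ha := norm_nonneg (toL s u)
  have hb := norm_nonneg (toL s (Δ u))
  have hyn := norm_nonneg (toL s w)
  have hbD : ‖toL s (Δ u)‖ ≤ C * (‖toL s u‖ + ‖toL s (Δ u)‖) := by nlinarith
  rw [mul_assoc]
  generalize C * (‖toL s u‖ + ‖toL s (Δ u)‖) = D at *
  generalize ‖toL s (Δ u)‖ = b at *
  generalize ‖toL s w‖ = y at *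
  generalize ‖toL s (∂_{ev j} w)‖ = x at *
  generalize ‖toL s (∂_{(ev k : E d)} w)‖ = z at *
  generalize ∑ j : Fin d, ‖toL s (∂_{ev j} w)‖ ^ 2 = S at *
  have hs0 : 0 ≤ 2 * |s| := by positivity
  have hc : (0 : ℝ) ≤ d * (2 * |s|) ^ 2 := by positivity
  have hc' : (d : ℝ) * ((2 * |s|) ^ 2 * y ^ 2) = d * (2 * |s|) ^ 2 * y ^ 2 := by ring
  rw [hc'] at h2
  generalize (d : ℝ) * (2 * |s|) ^ 2 = c at *
  generalize 2 * |s| = r at *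
  have hD : 0 ≤ D := hyn.trans hy
  have hyD : y ^ 2 ≤ D ^ 2 := by gcongr
  have hbD2 : b ^ 2 ≤ D ^ 2 := by gcongr
  have hby : b * y ≤ D ^ 2 := by rw [sq]; gcongr
  have h4 : x ^ 2 ≤ 2 * (1 + r + c) * D ^ 2 := by
    have h5 := mul_le_mul_of_nonneg_left hyD hc
    have h6 := mul_le_mul_of_nonneg_left hby hs0
    have h7 : b * z ≤ b ^ 2 + z ^ 2 / 4 := by nlinarith [sq_nonneg (b - z / 2)]
    nlinarith
  refine le_of_sq_le_sq (h4.trans ?_) (by positivity)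
  rw [mul_pow]
  gcongr
  nlinarith

/-- The identity for `Δ m(D)` bounds the Laplacian by the data, and the elliptic estimates recover
all derivatives of order at most two from it. -/
lemma listDeriv_mSym_bound {d : ℕ} {ω : ℝ} (hω : 0 < ω) (s : ℝ) (L : List (Fin d))
    (hL : L.length ≤ 2) : ∃ C : ℝ, ∀ φ : 𝓢(E d, ℂ),
      ‖toL s (listDeriv L (op (mSym ω) φ))‖ ≤ C * ‖toL s φ‖ := by
  obtain ⟨K, hK0, hK⟩ := (mSym_bounded (d := d) hω).bound s
  obtain ⟨N, hN0, hN⟩ := (sSym_bounded (d := d) hω).bound s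
  have h1 : ∀ φ : 𝓢(E d, ℂ), ‖toL s (op (mSym ω) φ)‖ + ‖toL s (Δ (op (mSym ω) φ))‖ ≤
      (K + (1 + N + ω ^ 2 * K)) * ‖toL s φ‖ := fun φ => by
    rw [laplacian_op_mSym hω, map_sub, map_sub, map_smul, add_mul]
    refine add_le_add (hK φ) ?_
    refine (norm_sub_le _ _).trans ((add_le_add (norm_sub_le _ _) le_rfl).trans ?_)
    rw [norm_smul, Complex.norm_real, Real.norm_of_nonneg (by positivity)]
    have h2 := hN φ
    have h3 := mul_le_mul_of_nonneg_left (hK φ) (sq_nonneg ω)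
    linarith
  rcases L with _ | ⟨i, _ | ⟨j, _ | ⟨k, L⟩⟩⟩
  · exact ⟨K, hK⟩
  · obtain ⟨C, hC1, hC⟩ := norm_lineDeriv_le (d := d) s
    refine ⟨C * (K + (1 + N + ω ^ 2 * K)), fun φ => (hC _ i).trans ?_⟩
    rw [mul_assoc]
    exact mul_le_mul_of_nonneg_left (h1 φ) (by linarith)
  · obtain ⟨C, hC⟩ := norm_lineDeriv_lineDeriv_le (d := d) s
    refine ⟨|C| * (K + (1 + N + ω ^ 2 * K)), fun φ => (hC _ i j).trans ?_⟩
    rw [mul_assoc]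
    refine (mul_le_mul_of_nonneg_right (le_abs_self C) (by positivity)).trans ?_
    exact mul_le_mul_of_nonneg_left (h1 φ) (abs_nonneg C)
  · simp at hL

/-- The response of `Π` to the forcing, as a map `L²_t → H²_t`. -/
def forcingH {d : ℕ} (ω t : ℝ) : L2s d t →L[ℂ] Hps d 2 t := extToH 2 t (op (mSym ω))

lemma toL2s_forcingH {d : ℕ} {ω : ℝ} (hω : 0 < ω) (t : ℝ) (f : L2s d t) :
    (forcingH ω t f).toL2s = ext t (mSym ω) f :=
  toL2s_extToH (mSym_bounded hω) (fun L hL => listDeriv_mSym_bound hω t L hL) f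

/-! ### Fourier multipliers on `L²` -/

lemma toL2_dense {d : ℕ} : DenseRange (toL2 : 𝓢(E d, ℂ) → Lp ℂ 2 (volume : Measure (E d))) := by
  rw [toL2]
  exact SchwartzMap.denseRange_toLpCLM (F := ℂ) (μ := volume) ENNReal.ofNat_ne_top

lemma L2_ext_of_inner {d : ℕ} {F G : Lp ℂ 2 (volume : Measure (E d))}
    (h : ∀ φ : 𝓢(E d, ℂ), inner ℂ (toL2 φ) F = inner ℂ (toL2 φ) G) : F = G := by
  refine ext_inner_left ℂ fun v => ?_
  have h1 : Continuous fun v : Lp ℂ 2 (volume : Measure (E d)) => (inner ℂ v F : ℂ) := by fun_prop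
  have h2 : Continuous fun v : Lp ℂ 2 (volume : Measure (E d)) => (inner ℂ v G : ℂ) := by fun_prop
  exact congrFun (DenseRange.equalizer toL2_dense h1 h2 (funext h)) v

lemma inner_toL2 {d : ℕ} (φ : 𝓢(E d, ℂ)) (F : Lp ℂ 2 (volume : Measure (E d))) :
    inner ℂ (toL2 φ) F = ∫ x, F x * conjS φ x := by
  rw [L2.inner_def]
  refine integral_congr_ae ?_
  filter_upwards [toL2_coe φ] with x hx
  rw [hx, conjS_apply]
  rfl

lemma conjS_conjS {d : ℕ} (φ : 𝓢(E d, ℂ)) : conjS (conjS φ) = φ := by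
  ext x; simp [conjS_apply]

lemma laplacian_conjS {d : ℕ} (φ : 𝓢(E d, ℂ)) : Δ (conjS φ) = conjS (Δ φ) := by
  simp only [laplacian_eq_sum_lineDeriv, lineDeriv_conjS]
  ext x
  simp only [sum_apply, conjS_apply, map_sum]

lemma fourier_toL2 {d : ℕ} (φ : 𝓢(E d, ℂ)) :
    𝓕 (toL2 φ) = toL2 (𝓕 φ : 𝓢(E d, ℂ)) := by
  rw [toL2]
  exact SchwartzMap.toLp_fourier_eq φ

lemma memLp_mul_fourier {d : ℕ} {m : E d → ℝ} {C : ℝ} (hm : Continuous m) (hC : ∀ ξ, |m ξ| ≤ C)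
    (F : Lp ℂ 2 (volume : Measure (E d))) :
    MemLp (fun ξ => (m ξ : ℂ) * (𝓕 F : Lp ℂ 2 (volume : Measure (E d))) ξ) 2 volume := by
  refine MemLp.of_le_mul (c := C) (Lp.memLp (𝓕 F : Lp ℂ 2 (volume : Measure (E d)))) ?_ ?_
  · exact (Complex.continuous_ofReal.comp hm).aestronglyMeasurable.mul
      (Lp.aestronglyMeasurable _)
  · refine ae_of_all _ fun ξ => ?_
    rw [norm_mul, Complex.norm_real]
    exact mul_le_mul_of_nonneg_right (hC ξ) (norm_nonneg _)

open Classical in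
/-- The Fourier multiplier `m(D)` applied to `F ∈ L²`. -/
def fourierMul {d : ℕ} (m : E d → ℝ) (F : Lp ℂ 2 (volume : Measure (E d))) :
    Lp ℂ 2 (volume : Measure (E d)) :=
  FourierTransform.fourierInvCLM ℂ (Lp ℂ 2 (volume : Measure (E d)))
    -- The default value plays no role for bounded continuous symbols, for which the product always
    -- lies in `L²`.
    (if h : MemLp (fun ξ => (m ξ : ℂ) * (𝓕 F : Lp ℂ 2 (volume : Measure (E d))) ξ) 2 volume
      then h.toLp else 0)

lemma fourier_fourierMul {d : ℕ} {m : E d → ℝ} {F : Lp ℂ 2 (volume : Measure (E d))}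
    (h : MemLp (fun ξ => (m ξ : ℂ) * (𝓕 F : Lp ℂ 2 (volume : Measure (E d))) ξ) 2 volume) :
    (𝓕 (fourierMul m F) : Lp ℂ 2 (volume : Measure (E d))) =ᵐ[volume]
      fun ξ => (m ξ : ℂ) * (𝓕 F : Lp ℂ 2 (volume : Measure (E d))) ξ := by
  rw [fourierMul, dif_pos h]
  change (𝓕 (𝓕⁻ h.toLp : Lp ℂ 2 (volume : Measure (E d))) :
    Lp ℂ 2 (volume : Measure (E d))) =ᵐ[volume] _
  rw [FourierTransform.fourier_fourierInv_eq]
  exact h.coeFn_toLp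

lemma L2_ext_fourier {d : ℕ} {F G : Lp ℂ 2 (volume : Measure (E d))}
    (h : (𝓕 F : Lp ℂ 2 (volume : Measure (E d))) =ᵐ[volume]
      (𝓕 G : Lp ℂ 2 (volume : Measure (E d)))) : F = G := by
  have h1 := congrArg (𝓕⁻ : Lp ℂ 2 (volume : Measure (E d)) → Lp ℂ 2 (volume : Measure (E d)))
    (Lp.ext h)
  rwa [FourierTransform.fourierInv_fourier_eq, FourierTransform.fourierInv_fourier_eq] at h1

lemma inner_fourierMul {d : ℕ} {m : E d → ℝ} (hm : m.HasTemperateGrowth) {C : ℝ}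
    (hC : ∀ ξ, |m ξ| ≤ C) (ψ : 𝓢(E d, ℂ)) (F : Lp ℂ 2 (volume : Measure (E d))) :
    inner ℂ (toL2 ψ) (fourierMul m F) = inner ℂ (toL2 (op m ψ)) F := by
  rw [← Lp.inner_fourier_eq, ← Lp.inner_fourier_eq (toL2 (op m ψ)), fourier_toL2, fourier_toL2,
    L2.inner_def, L2.inner_def]
  refine integral_congr_ae ?_
  filter_upwards [fourier_fourierMul (memLp_mul_fourier hm.1.continuous hC F),
    toL2_coe (𝓕 ψ : 𝓢(E d, ℂ)), toL2_coe (𝓕 (op m ψ) : 𝓢(E d, ℂ))] with ξ h1 h2 h3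
  rw [h1, h2, h3, fourier_op hm]
  simp only [RCLike.inner_apply, map_mul, Complex.conj_ofReal]
  ring

lemma fourierMul_toL2 {d : ℕ} {m : E d → ℝ} (hm : m.HasTemperateGrowth) {C : ℝ}
    (hC : ∀ ξ, |m ξ| ≤ C) (φ : 𝓢(E d, ℂ)) : fourierMul m (toL2 φ) = toL2 (op m φ) := by
  refine L2_ext_fourier ?_
  rw [fourier_toL2]
  filter_upwards [fourier_fourierMul (memLp_mul_fourier hm.1.continuous hC (toL2 φ)),
    toL2_coe (𝓕 φ : 𝓢(E d, ℂ)), toL2_coe (𝓕 (op m φ) : 𝓢(E d, ℂ))] with ξ h1 h2 h3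
  rw [h1, h3, fourier_toL2, h2, fourier_op hm]

lemma fourierMul_congr {d : ℕ} {m n : E d → ℝ} (h : m =ᵐ[volume] n)
    {F : Lp ℂ 2 (volume : Measure (E d))}
    (hm : MemLp (fun ξ => (m ξ : ℂ) * (𝓕 F : Lp ℂ 2 (volume : Measure (E d))) ξ) 2 volume)
    (hn : MemLp (fun ξ => (n ξ : ℂ) * (𝓕 F : Lp ℂ 2 (volume : Measure (E d))) ξ) 2 volume) :
    fourierMul m F = fourierMul n F := by
  refine L2_ext_fourier ?_
  filter_upwards [fourier_fourierMul hm, fourier_fourierMul hn, h] with ξ h1 h2 h3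
  rw [h1, h2, h3]

lemma fourierMul_const_mul {d : ℕ} {m : E d → ℝ} {C : ℝ} (hm : Continuous m)
    (hC : ∀ ξ, |m ξ| ≤ C) (c : ℝ) (F : Lp ℂ 2 (volume : Measure (E d))) :
    fourierMul (fun ξ => c * m ξ) F = (c : ℂ) • fourierMul m F := by
  refine L2_ext_fourier ?_
  rw [FourierTransform.fourier_smul]
  have hc : Continuous fun ξ => c * m ξ := by fun_prop
  have hcC : ∀ ξ, |c * m ξ| ≤ |c| * C := fun ξ => by
    rw [abs_mul]; exact mul_le_mul_of_nonneg_left (hC ξ) (abs_nonneg c)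
  filter_upwards [fourier_fourierMul (memLp_mul_fourier hm hC F),
    fourier_fourierMul (memLp_mul_fourier hc hcC F),
    Lp.coeFn_smul (c : ℂ) (𝓕 (fourierMul m F) : Lp ℂ 2 (volume : Measure (E d)))] with ξ h1 h2 h3
  rw [h2, h3, Pi.smul_apply, h1]
  push_cast
  rw [smul_eq_mul]
  ring

lemma hasDerivWithinAt_fourierMul {d : ℕ} {s : Set ℝ} (hs : Convex ℝ s) {m m' : ℝ → E d → ℝ}
    {C C' : ℝ} (hm : ∀ t ∈ s, Continuous (m t)) (hC : ∀ t ∈ s, ∀ ξ, |m t ξ| ≤ C)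
    (hm' : ∀ t ∈ s, Continuous (m' t)) (hC' : ∀ t ∈ s, ∀ ξ, |m' t ξ| ≤ C')
    (hd : ∀ ξ, ∀ t ∈ s, HasDerivWithinAt (fun t => m t ξ) (m' t ξ) s t)
    (F : Lp ℂ 2 (volume : Measure (E d))) {t : ℝ} (ht : t ∈ s) :
    HasDerivWithinAt (fun t => fourierMul (m t) F) (fourierMul (m' t) F) s t := by
  set G : Lp ℂ 2 (volume : Measure (E d)) := 𝓕 F with hG
  have hb : MemLp (fun ξ => C' * ‖G ξ‖) 2 volume := (Lp.memLp G).norm.const_mul C'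
  have h1 : HasDerivWithinAt
      (fun t => (𝓕 (fourierMul (m t) F) : Lp ℂ 2 (volume : Measure (E d))))
      (𝓕 (fourierMul (m' t) F) : Lp ℂ 2 (volume : Measure (E d))) s t := by
    refine hasDerivWithinAt_Lp hs (a := fun t ξ => m t ξ * G ξ) (a' := fun t ξ => m' t ξ * G ξ)
      hb ht ?_ ?_ ?_ ?_
    · exact fun u hu => fourier_fourierMul (memLp_mul_fourier (hm u hu) (hC u hu) F)
    · exact fourier_fourierMul (memLp_mul_fourier (hm' t ht) (hC' t ht) F)
    · exact fun ξ u hu => (hd ξ u hu).ofReal_comp.mul_const _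
    · intro u hu ξ
      rw [norm_mul, Complex.norm_real]
      exact mul_le_mul_of_nonneg_right (hC' u hu ξ) (norm_nonneg _)
  have h2 := clm_comp_hasDerivWithinAt
    (FourierTransform.fourierInvCLM ℂ (Lp ℂ 2 (volume : Measure (E d)))) h1
  simpa only [FourierTransform.fourierInvCLM_apply, FourierTransform.fourierInv_fourier_eq] using h2

lemma continuousOn_fourierMul {d : ℕ} {s : Set ℝ} {m : ℝ → E d → ℝ}
    {C : ℝ} (hm : ∀ t ∈ s, Continuous (m t)) (hC : ∀ t ∈ s, ∀ ξ, |m t ξ| ≤ C)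
    (hd : ∀ ξ, ContinuousOn (fun t => m t ξ) s) (F : Lp ℂ 2 (volume : Measure (E d))) :
    ContinuousOn (fun t => fourierMul (m t) F) s := by
  intro t ht
  set G : Lp ℂ 2 (volume : Measure (E d)) := 𝓕 F with hG
  have hb : MemLp (fun ξ => C * ‖G ξ‖) 2 volume := (Lp.memLp G).norm.const_mul C
  have hmem : ∀ᶠ u in 𝓝[s] t, u ∈ s := self_mem_nhdsWithin
  have h1 : Tendsto (fun t => (𝓕 (fourierMul (m t) F) : Lp ℂ 2 (volume : Measure (E d))))
      (𝓝[s] t) (𝓝 (𝓕 (fourierMul (m t) F) : Lp ℂ 2 (volume : Measure (E d)))) := by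
    refine tendsto_Lp_of_dominated (a := fun t ξ => m t ξ * G ξ) hb ?_
      (fourier_fourierMul (memLp_mul_fourier (hm t ht) (hC t ht) F)) ?_ ?_
    · exact hmem.mono fun u hu => fourier_fourierMul (memLp_mul_fourier (hm u hu) (hC u hu) F)
    · refine hmem.mono fun u hu ξ => ?_
      rw [norm_mul, Complex.norm_real]
      exact mul_le_mul_of_nonneg_right (hC u hu ξ) (norm_nonneg _)
    · exact fun ξ => ((Complex.continuous_ofReal.tendsto _).comp (hd ξ t ht)).mul_const _
  have h2 := ((FourierTransform.fourierInvCLM ℂ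
    (Lp ℂ 2 (volume : Measure (E d)))).continuous.tendsto _).comp h1
  simpa only [ContinuousWithinAt, Function.comp_def, FourierTransform.fourierInvCLM_apply,
    FourierTransform.fourierInv_fourier_eq] using h2

/-- On `L²_s`, `s ≥ 0`, the extension of a bounded multiplier is the Fourier multiplier on `L²`. -/
lemma ext_eq_fourierMul {d : ℕ} {s : ℝ} (hs : 0 ≤ s) {g : E d → ℝ} (hg : BoundedSymbol g) {C : ℝ}
    (hC : ∀ ξ, |g ξ| ≤ C) (f : L2s d s) :
    lpMono (volume_le_weightMeasure hs) (ext s g f) =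
      fourierMul g (lpMono (volume_le_weightMeasure hs) f) := by
  have hL : ∀ φ : 𝓢(E d, ℂ), lpMono (volume_le_weightMeasure hs) (toL s φ) = toL2 φ := fun φ =>
    Lp.ext ((lpMono_coe (volume_le_weightMeasure hs) _).trans ((toL_coe s φ).trans
      (toL2_coe φ).symm))
  refine L2_ext_of_inner fun ψ => ?_
  rw [inner_fourierMul hg.temperate hC]
  refine congrFun (L2s_clm_ext
    (f := fun f => inner ℂ (toL2 ψ) (lpMono (volume_le_weightMeasure hs) (ext s g f)))
    (g := fun f => inner ℂ (toL2 (op g ψ)) (lpMono (volume_le_weightMeasure hs) f))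
    (by fun_prop) (by fun_prop) fun φ => ?_) f
  rw [ext_toL s hg, hL, hL, ← fourierMul_toL2 hg.temperate hC, inner_fourierMul hg.temperate hC]

/-! ### The forced wave equation -/

/-- The symbol `(cos(λt) - cos(ωt)) / (λ² - ω²)`, `λ = 2π|ξ|`, of the solution of the wave equation
with forcing and zero data. -/
def forcedSym {d : ℕ} (ω t : ℝ) (ξ : E d) : ℝ :=
  -(1 / ω) * (Real.sin (ω * t) * cosInt (fun a => Real.cos (ω * a)) t ξ -
    Real.cos (ω * t) * cosInt (fun a => Real.sin (ω * a)) t ξ)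

/-- The time derivative of `forcedSym`. -/
def forcedSym' {d : ℕ} (ω t : ℝ) (ξ : E d) : ℝ :=
  -(Real.cos (ω * t) * cosInt (fun a => Real.cos (ω * a)) t ξ +
    Real.sin (ω * t) * cosInt (fun a => Real.sin (ω * a)) t ξ)

lemma hasDerivAt_forcedSym {d : ℕ} {ω : ℝ} (hω : 0 < ω) (t : ℝ) (ξ : E d) :
    HasDerivAt (fun t => forcedSym ω t ξ) (forcedSym' ω t ξ) t := by
  have hw : HasDerivAt (fun a => ω * a) ω t := by simpa using (hasDerivAt_id t).const_mul ω
  have hC := hasDerivAt_cosInt (h := fun a => Real.cos (ω * a)) (by fun_prop) ξ t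
  have hD := hasDerivAt_cosInt (h := fun a => Real.sin (ω * a)) (by fun_prop) ξ t
  refine (((hw.sin.mul hC).sub (hw.cos.mul hD)).const_mul (-(1 / ω))).congr_deriv ?_
  rw [forcedSym']
  field_simp
  ring

/-- In this form the second derivative is visibly bounded in `ξ`, so the forced part is `C²` in time
with values in `L²` for forcing merely in `L²`. By `forcedSym_eq` it equals `-λ² y - cos(ωt)`, as
the wave equation demands. -/
lemma hasDerivAt_forcedSym' {d : ℕ} (ω t : ℝ) (ξ : E d) :
    HasDerivAt (fun t => forcedSym' ω t ξ) (-cosSym t ξ - ω ^ 2 * forcedSym ω t ξ) t := by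
  have hw : HasDerivAt (fun a => ω * a) ω t := by simpa using (hasDerivAt_id t).const_mul ω
  have hC := hasDerivAt_cosInt (h := fun a => Real.cos (ω * a)) (by fun_prop) ξ t
  have hD := hasDerivAt_cosInt (h := fun a => Real.sin (ω * a)) (by fun_prop) ξ t
  refine ((hw.cos.mul hC).add (hw.sin.mul hD)).neg.congr_deriv ?_
  rw [forcedSym]
  field_simp
  linear_combination (-cosSym t ξ) * Real.sin_sq_add_cos_sq (ω * t)

/-- By the addition formula `forcedSym` is `-(1/ω) ∫₀^t sin(ω(t - a)) cos(λa) da`, an expression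
without division by `λ² - ω²`. The two integrals are evaluated by explicit antiderivatives. -/
lemma forcedSym_eq {d : ℕ} {ω : ℝ} (hω : 0 < ω) (t : ℝ) (ξ : E d) :
    (lapSym ξ - ω ^ 2) * forcedSym ω t ξ = cosSym t ξ - Real.cos (ω * t) := by
  set l := 2 * Real.pi * ‖ξ‖ with hl
  have hw : ∀ a, HasDerivAt (fun a => ω * a) ω a := fun a => by
    simpa using (hasDerivAt_id a).const_mul ω
  have hla : ∀ a, HasDerivAt (fun a => l * a) l a := fun a => by
    simpa using (hasDerivAt_id a).const_mul l
  have hC : (l ^ 2 - ω ^ 2) * cosInt (fun a => Real.cos (ω * a)) t ξ =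
      l * Real.cos (ω * t) * Real.sin (l * t) - ω * Real.sin (ω * t) * Real.cos (l * t) := by
    have h : ∀ a ∈ uIcc (0 : ℝ) t, HasDerivAt
        (fun a => l * Real.cos (ω * a) * Real.sin (l * a) -
          ω * Real.sin (ω * a) * Real.cos (l * a))
        ((l ^ 2 - ω ^ 2) * (Real.cos (ω * a) * Real.cos (l * a))) a := fun a _ => by
      refine ((((hw a).cos.const_mul l).mul (hla a).sin).sub
        (((hw a).sin.const_mul ω).mul (hla a).cos)).congr_deriv ?_
      ring
    rw [cosInt, ← intervalIntegral.integral_const_mul,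
      intervalIntegral.integral_eq_sub_of_hasDerivAt h
        (Continuous.intervalIntegrable (by fun_prop) _ _)]
    simp
  have hD : (l ^ 2 - ω ^ 2) * cosInt (fun a => Real.sin (ω * a)) t ξ =
      l * Real.sin (ω * t) * Real.sin (l * t) + ω * Real.cos (ω * t) * Real.cos (l * t) - ω := by
    have h : ∀ a ∈ uIcc (0 : ℝ) t, HasDerivAt
        (fun a => l * Real.sin (ω * a) * Real.sin (l * a) +
          ω * Real.cos (ω * a) * Real.cos (l * a))
        ((l ^ 2 - ω ^ 2) * (Real.sin (ω * a) * Real.cos (l * a))) a := fun a _ => by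
      refine ((((hw a).sin.const_mul l).mul (hla a).sin).add
        (((hw a).cos.const_mul ω).mul (hla a).cos)).congr_deriv ?_
      ring
    rw [cosInt, ← intervalIntegral.integral_const_mul,
      intervalIntegral.integral_eq_sub_of_hasDerivAt h
        (Continuous.intervalIntegrable (by fun_prop) _ _)]
    simp
  have h1 : cosSym t ξ = Real.cos (l * t) := rfl
  rw [lapSym, ← hl, forcedSym, h1]
  field_simp
  linear_combination (-Real.sin (ω * t)) * hC + Real.cos (ω * t) * hD +
    ω * Real.cos (l * t) * Real.sin_sq_add_cos_sq (ω * t)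

lemma forcedSym_temperate {d : ℕ} (ω : ℝ) {t : ℝ} (ht : 0 ≤ t) :
    (forcedSym ω t : E d → ℝ).HasTemperateGrowth := by
  have h1 : (cosInt (fun a => Real.cos (ω * a)) t : E d → ℝ).HasTemperateGrowth :=
    cosInt_temperate (by fun_prop) ht
  have h2 : (cosInt (fun a => Real.sin (ω * a)) t : E d → ℝ).HasTemperateGrowth :=
    cosInt_temperate (by fun_prop) ht
  exact (Function.HasTemperateGrowth.const _).mul
    (((Function.HasTemperateGrowth.const _).mul h1).sub
      ((Function.HasTemperateGrowth.const _).mul h2))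

lemma forcedSym'_temperate {d : ℕ} (ω : ℝ) {t : ℝ} (ht : 0 ≤ t) :
    (forcedSym' ω t : E d → ℝ).HasTemperateGrowth := by
  have h1 : (cosInt (fun a => Real.cos (ω * a)) t : E d → ℝ).HasTemperateGrowth :=
    cosInt_temperate (by fun_prop) ht
  have h2 : (cosInt (fun a => Real.sin (ω * a)) t : E d → ℝ).HasTemperateGrowth :=
    cosInt_temperate (by fun_prop) ht
  exact (((Function.HasTemperateGrowth.const _).mul h1).add
      ((Function.HasTemperateGrowth.const _).mul h2)).neg

lemma abs_cosInt_le_of_le_one {d : ℕ} {h : ℝ → ℝ} (hh : Continuous h) (h1 : ∀ a, |h a| ≤ 1) {A : ℝ}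
    {t : ℝ} (ht : t ∈ Icc 0 A) (ξ : E d) : |cosInt h t ξ| ≤ A := by
  refine (abs_cosInt_le hh ht.1 ξ).trans (le_trans ?_ ht.2)
  have := intervalIntegral.integral_mono_on (μ := volume) ht.1 (hh.abs.intervalIntegrable 0 t)
    (continuous_const.intervalIntegrable (μ := volume) 0 t) (fun a _ => h1 a)
  simpa using this

lemma abs_forcedSym_le {d : ℕ} {ω A : ℝ} (hω : 0 < ω) {t : ℝ} (ht : t ∈ Icc 0 A) (ξ : E d) :
    |forcedSym ω t ξ| ≤ 1 / ω * (A + A) := by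
  have h1 := abs_cosInt_le_of_le_one (h := fun a => Real.cos (ω * a)) (by fun_prop)
    (fun a => Real.abs_cos_le_one _) ht ξ
  have h2 := abs_cosInt_le_of_le_one (h := fun a => Real.sin (ω * a)) (by fun_prop)
    (fun a => Real.abs_sin_le_one _) ht ξ
  rw [forcedSym, abs_mul, abs_neg, abs_of_pos (by positivity : 0 < 1 / ω)]
  refine mul_le_mul_of_nonneg_left ((abs_sub _ _).trans (add_le_add ?_ ?_)) (by positivity)
  · rw [abs_mul]
    exact (mul_le_of_le_one_left (abs_nonneg _) (Real.abs_sin_le_one _)).trans h1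
  · rw [abs_mul]
    exact (mul_le_of_le_one_left (abs_nonneg _) (Real.abs_cos_le_one _)).trans h2

lemma abs_forcedSym'_le {d : ℕ} {ω A : ℝ} {t : ℝ} (ht : t ∈ Icc 0 A) (ξ : E d) :
    |forcedSym' ω t ξ| ≤ A + A := by
  have h1 := abs_cosInt_le_of_le_one (h := fun a => Real.cos (ω * a)) (by fun_prop)
    (fun a => Real.abs_cos_le_one _) ht ξ
  have h2 := abs_cosInt_le_of_le_one (h := fun a => Real.sin (ω * a)) (by fun_prop)
    (fun a => Real.abs_sin_le_one _) ht ξ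
  rw [forcedSym', abs_neg]
  refine (abs_add_le _ _).trans (add_le_add ?_ ?_)
  · rw [abs_mul]
    exact (mul_le_of_le_one_left (abs_nonneg _) (Real.abs_cos_le_one _)).trans h1
  · rw [abs_mul]
    exact (mul_le_of_le_one_left (abs_nonneg _) (Real.abs_sin_le_one _)).trans h2

lemma abs_forcedSym''_le {d : ℕ} {ω A : ℝ} (hω : 0 < ω) {t : ℝ} (ht : t ∈ Icc 0 A) (ξ : E d) :
    |-cosSym t ξ - ω ^ 2 * forcedSym ω t ξ| ≤ 1 + ω ^ 2 * (1 / ω * (A + A)) := by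
  refine (abs_sub _ _).trans (add_le_add ?_ ?_)
  · rw [abs_neg]; exact Real.abs_cos_le_one _
  · rw [abs_mul, abs_of_nonneg (sq_nonneg ω)]
    exact mul_le_mul_of_nonneg_left (abs_forcedSym_le hω ht ξ) (sq_nonneg ω)

lemma op_forcedSym'' {d : ℕ} {ω : ℝ} (hω : 0 < ω) {t : ℝ} (ht : 0 ≤ t) (φ : 𝓢(E d, ℂ)) :
    op (fun ξ => -cosSym t ξ - ω ^ 2 * forcedSym ω t ξ) φ =
      op (forcedSym ω t) (Δ φ) - (Real.cos (ω * t) : ℂ) • φ := by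
  have h1 := forcedSym_temperate (d := d) ω ht
  have h2 : (fun ξ : E d => -cosSym t ξ - ω ^ 2 * forcedSym ω t ξ).HasTemperateGrowth :=
    (cosSym_temperate ht).neg.sub ((Function.HasTemperateGrowth.const _).mul h1)
  refine schwartz_ext_fourier fun ξ => ?_
  have h4 : (𝓕 (op (forcedSym ω t) (Δ φ) - (Real.cos (ω * t) : ℂ) • φ) : 𝓢(E d, ℂ)) =
      𝓕 (op (forcedSym ω t) (Δ φ)) - (Real.cos (ω * t) : ℂ) • 𝓕 φ := by
    simp only [← FourierTransform.fourierCLM_apply (R := ℂ), map_sub, map_smul]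
  rw [h4, sub_apply, smul_apply, fourier_op h2, fourier_op h1, fourier_laplacian]
  have h3 : ((lapSym ξ : ℂ) - (ω : ℂ) ^ 2) * (forcedSym ω t ξ : ℂ) =
      (cosSym t ξ : ℂ) - (Real.cos (ω * t) : ℂ) := by exact_mod_cast forcedSym_eq hω t ξ
  push_cast at h3 ⊢
  rw [smul_eq_mul]
  linear_combination (𝓕 φ : 𝓢(E d, ℂ)) ξ * h3

/-- The solution of the forced wave equation with data `(φ, 0)`. -/
def waveSol {d : ℕ} (ω : ℝ) (F : Lp ℂ 2 (volume : Measure (E d))) (φ : 𝓢(E d, ℂ)) (t : ℝ) :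
    Lp ℂ 2 (volume : Measure (E d)) :=
  toL2 (op (cosSym t) φ) + fourierMul (forcedSym ω t) F

lemma isWaveSolution_waveSol {d : ℕ} {ω : ℝ} (hω : 0 < ω) {f : E d → ℂ}
    {F : Lp ℂ 2 (volume : Measure (E d))} (hF : F =ᵐ[volume] f) (φ : 𝓢(E d, ℂ)) :
    IsWaveSolution ω f φ (waveSol ω F φ) := by
  set T := period ω with hT
  have hT0 : 0 ≤ T := (period_pos hω).le
  have hc : ∀ t ∈ Icc 0 T, Continuous (forcedSym ω t : E d → ℝ) := fun t ht =>
    (forcedSym_temperate ω ht.1).1.continuous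
  have hc' : ∀ t ∈ Icc 0 T, Continuous (forcedSym' ω t : E d → ℝ) := fun t ht =>
    (forcedSym'_temperate ω ht.1).1.continuous
  have hg : ∀ t ∈ Icc 0 T,
      (fun ξ : E d => -cosSym t ξ - ω ^ 2 * forcedSym ω t ξ).HasTemperateGrowth := fun t ht =>
    (cosSym_temperate ht.1).neg.sub
      ((Function.HasTemperateGrowth.const _).mul (forcedSym_temperate ω ht.1))
  have hc'' : ∀ t ∈ Icc 0 T, Continuous fun ξ : E d => -cosSym t ξ - ω ^ 2 * forcedSym ω t ξ :=
    fun t ht => (hg t ht).1.continuous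
  refine ⟨fun t => toL2 (Δ (op (sinSym t) φ)) + fourierMul (forcedSym' ω t) F,
    fun t => toL2 (op (cosSym t) (Δ φ)) +
      fourierMul (fun ξ => -cosSym t ξ - ω ^ 2 * forcedSym ω t ξ) F, ?_, ?_, ?_, ?_, ?_, ?_⟩
  · intro t ht
    exact (hasDerivWithinAt_cos_op T φ ht).add (hasDerivWithinAt_fourierMul (convex_Icc 0 T) hc
      (fun t ht ξ => abs_forcedSym_le hω ht ξ) hc' (fun t ht ξ => abs_forcedSym'_le ht ξ)
      (fun ξ t _ => (hasDerivAt_forcedSym hω t ξ).hasDerivWithinAt) F ht)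
  · intro t ht
    have h1 : HasDerivWithinAt (fun t => toL2 (Δ (op (sinSym t) φ))) (toL2 (op (cosSym t) (Δ φ)))
        (Icc 0 T) t := by
      refine (hasDerivWithinAt_sin_op T (Δ φ) ht).congr (fun u hu => ?_) ?_
      · rw [op_laplacian (sinSym_temperate hu.1)]
      · rw [op_laplacian (sinSym_temperate ht.1)]
    exact h1.add (hasDerivWithinAt_fourierMul (convex_Icc 0 T) hc'
      (fun t ht ξ => abs_forcedSym'_le ht ξ) hc'' (fun t ht ξ => abs_forcedSym''_le hω ht ξ)
      (fun ξ t _ => (hasDerivAt_forcedSym' ω t ξ).hasDerivWithinAt) F ht)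
  · refine ContinuousOn.add (fun t ht => (hasDerivWithinAt_cos_op T (Δ φ) ht).continuousWithinAt)
      (continuousOn_fourierMul hc'' (fun t ht ξ => abs_forcedSym''_le hω ht ξ) (fun ξ t _ => ?_) F)
    exact ((hasDerivAt_cosSym ξ t).neg.sub ((hasDerivAt_forcedSym hω t ξ).const_mul
      (ω ^ 2))).continuousAt.continuousWithinAt
  · have h1 : fourierMul (forcedSym ω 0) F = 0 := by
      -- The symbol vanishes at time `0`; writing it as `0 * 0` lets homogeneity of `fourierMul` in
      -- the symbol give zero.
      have h0 : (forcedSym ω 0 : E d → ℝ) = fun ξ => 0 * (0 : ℝ) := by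
        ext ξ; simp [forcedSym, cosInt]
      rw [h0, fourierMul_const_mul continuous_const (C := 0) (fun _ => by simp)]
      simp
    simp only [waveSol, h1, op_cosSym_zero, add_zero]
    exact toL2_coe φ
  · have h1 : fourierMul (forcedSym' ω 0) F = 0 := by
      have h0 : (forcedSym' ω 0 : E d → ℝ) = fun ξ => 0 * (0 : ℝ) := by
        ext ξ; simp [forcedSym', cosInt]
      rw [h0, fourierMul_const_mul continuous_const (C := 0) (fun _ => by simp)]
      simp
    simp only [h1, add_zero]
    rw [← op_laplacian (sinSym_temperate le_rfl), op_sinSym_zero, map_zero]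
  · intro t ht ψ
    have hf : ∫ x, f x * ψ x = inner ℂ (toL2 (conjS ψ)) F := by
      rw [inner_toL2, conjS_conjS]
      refine integral_congr_ae ?_
      filter_upwards [hF] with x hx
      rw [hx]
    have hcos : ∀ ψ φ : 𝓢(E d, ℂ), inner ℂ (toL2 (op (cosSym t) ψ)) (toL2 φ) =
        inner ℂ (toL2 ψ) (toL2 (op (cosSym t) φ)) := fun ψ φ => by
      rw [← fourierMul_toL2 (cosSym_temperate ht.1) (fun ξ => Real.abs_cos_le_one _) φ,
        inner_fourierMul (cosSym_temperate ht.1) (fun ξ => Real.abs_cos_le_one _)]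
    have hlap : inner ℂ (toL2 (conjS ψ)) (toL2 (Δ (op (cosSym t) φ))) =
        inner ℂ (toL2 (Δ (conjS ψ))) (toL2 (op (cosSym t) φ)) := by
      rw [inner_toL2, inner_toL2, laplacian_conjS, conjS_conjS, conjS_conjS]
      refine (integral_congr_ae ?_).trans ((integral_mul_laplacian (op (cosSym t) φ) ψ).symm.trans
        (integral_congr_ae ?_))
      · filter_upwards [toL2_coe (Δ (op (cosSym t) φ))] with x hx
        rw [hx]
      · filter_upwards [toL2_coe (op (cosSym t) φ)] with x hx
        rw [hx]
    have e1 : ∀ (G : Lp ℂ 2 (volume : Measure (E d))) (χ : 𝓢(E d, ℂ)),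
        ∫ x, G x * χ x = inner ℂ (toL2 (conjS χ)) G := fun G χ => by
      rw [inner_toL2, conjS_conjS]
    -- All multipliers acting on `F` are moved onto the test function; there the equation is an
    -- identity between symbols, with no regularity of `F` needed.
    rw [hf, e1, e1, waveSol, inner_add_right, inner_add_right,
      inner_fourierMul (hg t ht) (fun ξ => abs_forcedSym''_le hω ht ξ), op_forcedSym'' hω ht.1,
      inner_fourierMul (forcedSym_temperate ω ht.1) (fun ξ => abs_forcedSym_le hω ht ξ), map_sub,
      map_smul, inner_sub_left, inner_smul_left, Complex.conj_ofReal,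
      op_laplacian (cosSym_temperate ht.1), hlap, laplacian_conjS]
    ring

/-! ### The time average of the solution -/

/-- The resonance `β(ω) = 1`, which fixes the normalisation of `K`. Averaging the term `cos(ωt)` of
the forced solution against `K` therefore gives `1`. -/
lemma integral_kernel_mul_cos {ω : ℝ} (hω : 0 < ω) :
    ∫ t in (0 : ℝ)..period ω, kernel ω t * Real.cos (ω * t) = 1 := by
  have hT := period_pos hω
  have hw : ∀ a, HasDerivAt (fun a => ω * a) ω a := fun a => by
    simpa using (hasDerivAt_id a).const_mul ω
  have h : ∀ a ∈ uIcc (0 : ℝ) (period ω), HasDerivAt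
      (fun a => 2 / period ω * (a / 2 + Real.sin (ω * a) * Real.cos (ω * a) / (2 * ω) -
        Real.sin (ω * a) / (4 * ω))) (kernel ω a * Real.cos (ω * a)) a := fun a _ => by
    refine ((((hasDerivAt_id a).div_const 2).add (((hw a).sin.mul (hw a).cos).div_const
      (2 * ω))).sub ((hw a).sin.div_const (4 * ω))).const_mul (2 / period ω) |>.congr_deriv ?_
    rw [kernel]
    field_simp
    linear_combination -4 * Real.sin_sq_add_cos_sq (ω * a)
  have hc := continuous_kernel ω
  rw [intervalIntegral.integral_eq_sub_of_hasDerivAt h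
    (Continuous.intervalIntegrable (by fun_prop) _ _), omega_mul_period hω]
  simp [hT.ne']

/-- The symbol `∫₀^τ K(t) (cos(λt) - cos(ωt)) / (λ² - ω²) dt`. -/
def forcedAvgSym {d : ℕ} (ω τ : ℝ) (ξ : E d) : ℝ :=
  ∫ t in (0 : ℝ)..τ, kernel ω t * forcedSym ω t ξ

lemma continuous_cosInt_uncurry {d : ℕ} {h : ℝ → ℝ} (hh : Continuous h) :
    Continuous fun p : E d × ℝ => cosInt h p.2 p.1 := by
  unfold cosInt
  have h1 : Continuous (Function.uncurry fun (ξ : E d) (τ : ℝ) =>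
      h τ * Real.cos (2 * Real.pi * ‖ξ‖ * τ)) := by
    simp only [Function.uncurry_def]
    fun_prop
  exact intervalIntegral.continuous_parametric_primitive_of_continuous h1

lemma continuous_forcedSym_uncurry {d : ℕ} (ω : ℝ) :
    Continuous fun p : E d × ℝ => forcedSym ω p.2 p.1 := by
  have h1 := continuous_cosInt_uncurry (d := d) (h := fun a => Real.cos (ω * a)) (by fun_prop)
  have h2 := continuous_cosInt_uncurry (d := d) (h := fun a => Real.sin (ω * a)) (by fun_prop)
  have h3 : Continuous fun p : E d × ℝ => Real.sin (ω * p.2) := by fun_prop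
  have h4 : Continuous fun p : E d × ℝ => Real.cos (ω * p.2) := by fun_prop
  exact continuous_const.mul ((h3.mul h1).sub (h4.mul h2))

lemma continuous_kernel_mul_forcedSym {d : ℕ} (ω : ℝ) :
    Continuous fun p : E d × ℝ => kernel ω p.2 * forcedSym ω p.2 p.1 :=
  ((continuous_kernel ω).comp continuous_snd).mul (continuous_forcedSym_uncurry ω)

lemma continuous_forcedAvgSym {d : ℕ} (ω τ : ℝ) : Continuous (forcedAvgSym ω τ : E d → ℝ) :=
  intervalIntegral.continuous_parametric_intervalIntegral_of_continuous'
    (continuous_kernel_mul_forcedSym ω) 0 τ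

lemma hasDerivAt_forcedAvgSym {d : ℕ} {ω : ℝ} (hω : 0 < ω) (τ : ℝ) (ξ : E d) :
    HasDerivAt (fun τ => forcedAvgSym ω τ ξ) (kernel ω τ * forcedSym ω τ ξ) τ := by
  have h1 : Continuous fun t => forcedSym ω t ξ :=
    continuous_iff_continuousAt.2 fun t => (hasDerivAt_forcedSym hω t ξ).continuousAt
  have hc : Continuous fun t => kernel ω t * forcedSym ω t ξ := (continuous_kernel ω).mul h1
  exact (hc.integral_hasStrictDerivAt 0 τ).hasDerivAt

/-- Both sides agree after multiplication by `λ² - ω²`, which vanishes only on a sphere, a null set.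
Equality almost everywhere is enough for multipliers on `L²`. -/
lemma forcedAvgSym_period_ae {d : ℕ} {ω : ℝ} (hω : 0 < ω) :
    (forcedAvgSym ω (period ω) : E d → ℝ) =ᵐ[volume] mSym ω := by
  have hpi := Real.pi_pos
  have hnull : (volume : Measure (E d)) (Metric.sphere 0 (ω / (2 * Real.pi))) = 0 :=
    Measure.addHaar_sphere_of_ne_zero volume 0 (by positivity)
  filter_upwards [measure_eq_zero_iff_ae_notMem.1 hnull] with ξ hξ
  have h1 : lapSym ξ - ω ^ 2 ≠ 0 := by
    intro h
    refine hξ ?_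
    rw [mem_sphere_zero_iff_norm, eq_div_iff (by positivity)]
    have h2 : (2 * Real.pi * ‖ξ‖) ^ 2 = ω ^ 2 := by rw [lapSym] at h; linarith
    rw [mul_comm]
    exact (pow_left_inj₀ (by positivity) hω.le two_ne_zero).1 h2
  refine mul_left_cancel₀ h1 ?_
  rw [mSym_eq hω, forcedAvgSym, ← intervalIntegral.integral_const_mul,
    ← integral_kernel_mul_cos hω, sSym, cosInt, ← intervalIntegral.integral_sub]
  · refine intervalIntegral.integral_congr fun t _ => ?_
    have h2 := forcedSym_eq hω t ξ
    simp only [cosSym] at h2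
    linear_combination kernel ω t * h2
  · have := continuous_kernel ω
    exact Continuous.intervalIntegrable (by fun_prop) _ _
  · have := continuous_kernel ω
    exact Continuous.intervalIntegrable (by fun_prop) _ _

lemma exists_abs_kernel_le (ω A : ℝ) : ∃ M : ℝ, ∀ t ∈ Icc 0 A, |kernel ω t| ≤ M :=
  isCompact_Icc.exists_bound_of_continuousOn (continuous_kernel ω).continuousOn

lemma exists_abs_forcedAvgSym_le {d : ℕ} {ω : ℝ} (hω : 0 < ω) (A : ℝ) :
    ∃ M : ℝ, ∀ t ∈ Icc 0 A, ∀ ξ : E d, |forcedAvgSym ω t ξ| ≤ M := by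
  obtain ⟨M, hM⟩ := exists_abs_kernel_le ω A
  refine ⟨M * (1 / ω * (A + A)) * A, fun t ht ξ => ?_⟩
  have h1 := intervalIntegral.norm_integral_le_of_norm_le_const (a := 0) (b := t)
    (C := M * (1 / ω * (A + A))) (f := fun t => kernel ω t * forcedSym ω t ξ) fun u hu => ?_
  · refine h1.trans ?_
    rw [sub_zero, abs_of_nonneg ht.1]
    have hA : 0 ≤ A := ht.1.trans ht.2
    have hM0 : 0 ≤ M := (abs_nonneg _).trans (hM t ht)
    exact mul_le_mul_of_nonneg_left ht.2 (by positivity)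
  · rw [uIoc_of_le ht.1] at hu
    have hu' : u ∈ Icc 0 A := ⟨hu.1.le, hu.2.trans ht.2⟩
    rw [norm_mul]
    exact mul_le_mul (hM u hu') (abs_forcedSym_le hω hu' ξ) (abs_nonneg _)
      ((abs_nonneg _).trans (hM u hu'))

lemma abs_sSym_le {d : ℕ} {ω : ℝ} (hω : 0 < ω) :
    ∃ C : ℝ, ∀ ξ : E d, |sSym ω ξ| ≤ C :=
  ⟨_, abs_cosInt_le (continuous_kernel ω) (period_pos hω).le⟩

lemma abs_mSym_le {d : ℕ} {ω : ℝ} (hω : 0 < ω) :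
    ∃ C : ℝ, ∀ ξ : E d, |mSym ω ξ| ≤ C :=
  ⟨_, abs_cosInt_le (by unfold forcingKernel; fun_prop) (period_pos hω).le⟩

/-- The integrand has an explicit antiderivative in `L²`, obtained by integrating the symbols up to
a variable time; the fundamental theorem of calculus then replaces any interchange of the vector
integral with the Fourier transform. -/
lemma integral_kernel_smul_waveSol {d : ℕ} {ω : ℝ} (hω : 0 < ω)
    (F : Lp ℂ 2 (volume : Measure (E d))) (φ : 𝓢(E d, ℂ)) :
    ∫ t in (0 : ℝ)..period ω, kernel ω t • waveSol ω F φ t =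
      toL2 (op (sSym ω) φ) + fourierMul (mSym ω) F := by
  set T := period ω with hT
  have hT0 : 0 ≤ T := (period_pos hω).le
  have hK := continuous_kernel ω
  obtain ⟨M, hM⟩ := exists_abs_kernel_le ω T
  obtain ⟨N, hN⟩ := exists_abs_forcedAvgSym_le (d := d) hω T
  have hfc : ∀ t ∈ Icc 0 T, Continuous (forcedSym ω t : E d → ℝ) := fun t ht =>
    (forcedSym_temperate ω ht.1).1.continuous
  have h1 : ∀ t ∈ Icc 0 T, HasDerivWithinAt (fun t => toL2 (op (cosInt (kernel ω) t) φ))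
      (kernel ω t • toL2 (op (cosSym t) φ)) (Icc 0 T) t := by
    intro t ht
    have h := hasDerivWithinAt_toL2_op (convex_Icc 0 T) (g := fun t => cosInt (kernel ω) t)
      (g' := fun t ξ => kernel ω t * cosSym t ξ) (B := fun _ => M)
      (Function.HasTemperateGrowth.const M) (fun _ ht => cosInt_temperate hK ht.1)
      (fun t ht => (Function.HasTemperateGrowth.const (kernel ω t)).mul (cosSym_temperate ht.1))
      (fun ξ t _ => (hasDerivAt_cosInt hK ξ t).hasDerivWithinAt) (fun t ht ξ => ?_) φ ht
    · rwa [op_const_mul (cosSym_temperate ht.1), map_smul, Complex.coe_smul] at h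
    · rw [abs_mul]
      exact (mul_le_of_le_one_right (abs_nonneg _) (Real.abs_cos_le_one _)).trans (hM t ht)
  have h2 : ∀ t ∈ Icc 0 T, HasDerivWithinAt (fun t => fourierMul (forcedAvgSym ω t) F)
      (kernel ω t • fourierMul (forcedSym ω t) F) (Icc 0 T) t := by
    intro t ht
    have h := hasDerivWithinAt_fourierMul (convex_Icc 0 T) (m := fun t => forcedAvgSym ω t)
      (m' := fun t ξ => kernel ω t * forcedSym ω t ξ) (C' := M * (1 / ω * (T + T)))
      (fun t _ => continuous_forcedAvgSym ω t) hN (fun t ht => (hfc t ht).const_mul (kernel ω t))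
      (fun t ht ξ => ?_) (fun ξ t _ => (hasDerivAt_forcedAvgSym hω t ξ).hasDerivWithinAt) F ht
    · rwa [fourierMul_const_mul (hfc t ht) (abs_forcedSym_le hω ht), Complex.coe_smul] at h
    · rw [abs_mul]
      exact mul_le_mul (hM t ht) (abs_forcedSym_le hω ht ξ) (abs_nonneg _)
        ((abs_nonneg _).trans (hM t ht))
  have h3 : ∀ t ∈ Icc 0 T, HasDerivWithinAt
      (fun t => toL2 (op (cosInt (kernel ω) t) φ) + fourierMul (forcedAvgSym ω t) F)
      (kernel ω t • waveSol ω F φ t) (Icc 0 T) t := fun t ht => by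
    rw [waveSol, smul_add]
    exact (h1 t ht).add (h2 t ht)
  have hw : ContinuousOn (waveSol ω F φ) (Icc 0 T) := by
    refine ContinuousOn.add (fun t ht => (hasDerivWithinAt_cos_op T φ ht).continuousWithinAt)
      (continuousOn_fourierMul hfc (fun t ht ξ => abs_forcedSym_le hω ht ξ) (fun ξ t _ => ?_) F)
    exact (hasDerivAt_forcedSym hω t ξ).continuousAt.continuousWithinAt
  rw [intervalIntegral.integral_eq_sub_of_hasDerivAt_of_le hT0
    (fun t ht => (h3 t ht).continuousWithinAt)
    (fun t ht => (h3 t ⟨ht.1.le, ht.2.le⟩).hasDerivAt (Icc_mem_nhds ht.1 ht.2))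
    (ContinuousOn.intervalIntegrable_of_Icc hT0 (hK.continuousOn.smul hw))]
  have e1 : (cosInt (kernel ω) 0 : E d → ℝ) = fun _ => 0 := by ext; simp [cosInt]
  have e2 : (forcedAvgSym ω 0 : E d → ℝ) = fun ξ => 0 * (0 : ℝ) := by
    ext; simp [forcedAvgSym]
  obtain ⟨C, hC⟩ := abs_mSym_le (d := d) hω
  rw [e1, e2, op_zero_sym, fourierMul_const_mul continuous_const (C := 0) (fun _ => by simp),
    fourierMul_congr (forcedAvgSym_period_ae hω)
      (memLp_mul_fourier (continuous_forcedAvgSym ω T) (hN T ⟨hT0, le_rfl⟩) F)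
      (memLp_mul_fourier (mSym_bounded hω).temperate.1.continuous hC F)]
  simp [sSym, ← hT]

/-! ### Uniqueness for the wave equation -/

/-- The difference `D` of two solutions is paired with the backward wave that vanishes at `t₀` and
has velocity `-φ` there. The expression `I(u) = ⟨sin((t₀-u)√-Δ)/√-Δ φ, D'⟩ + ⟨cos((t₀-u)√-Δ) φ, D⟩`
has zero derivative, is `0` at `u = 0`, and is `⟨φ, D(t₀)⟩` at `u = t₀`. The backward wave is
Schwartz at each time, so the weak equation for `D` suffices. -/
lemma IsWaveSolution.eqOn {d : ℕ} {ω : ℝ} (hω : 0 < ω) {f v : E d → ℂ}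
    {w₁ w₂ : ℝ → Lp ℂ 2 (volume : Measure (E d))} (h₁ : IsWaveSolution ω f v w₁)
    (h₂ : IsWaveSolution ω f v w₂) : EqOn w₁ w₂ (Icc 0 (period ω)) := by
  set T := period ω with hT
  have hT0 : 0 ≤ T := (period_pos hω).le
  obtain ⟨w₁', w₁'', a1, a2, -, a4, a5, a6⟩ := h₁
  obtain ⟨w₂', w₂'', b1, b2, -, b4, b5, b6⟩ := h₂
  set D : ℝ → Lp ℂ 2 (volume : Measure (E d)) := fun t => w₁ t - w₂ t with hD
  set D' : ℝ → Lp ℂ 2 (volume : Measure (E d)) := fun t => w₁' t - w₂' t with hD'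
  have hD1 : ∀ t ∈ Icc 0 T, HasDerivWithinAt D (D' t) (Icc 0 T) t := fun t ht =>
    (a1 t ht).sub (b1 t ht)
  have hD2 : ∀ t ∈ Icc 0 T, HasDerivWithinAt D' (w₁'' t - w₂'' t) (Icc 0 T) t := fun t ht =>
    (a2 t ht).sub (b2 t ht)
  have hD0 : D 0 = 0 := sub_eq_zero.2 (Lp.ext (a4.trans b4.symm))
  have hD'0 : D' 0 = 0 := by simp only [hD', a5, b5, sub_zero]
  have e1 : ∀ (G : Lp ℂ 2 (volume : Measure (E d))) (χ : 𝓢(E d, ℂ)),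
      ∫ x, G x * χ x = inner ℂ (toL2 (conjS χ)) G := fun G χ => by
    rw [inner_toL2, conjS_conjS]
  have hweak : ∀ t ∈ Icc 0 T, ∀ ψ : 𝓢(E d, ℂ),
      inner ℂ (toL2 ψ) (w₁'' t - w₂'' t) = inner ℂ (toL2 (Δ ψ)) (D t) := by
    intro t ht ψ
    have h1 := a6 t ht (conjS ψ)
    have h2 := b6 t ht (conjS ψ)
    rw [e1, e1, laplacian_conjS, conjS_conjS, conjS_conjS] at h1 h2
    rw [inner_sub_right, inner_sub_right, h1, h2]
    ring
  intro t₀ ht₀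
  rw [← sub_eq_zero]
  change D t₀ = 0
  refine L2_ext_of_inner fun φ => ?_
  rw [inner_zero_right]
  have hsub : Icc 0 t₀ ⊆ Icc 0 T := Icc_subset_Icc_right ht₀.2
  have hmaps : MapsTo (fun u => t₀ - u) (Icc 0 t₀) (Icc 0 t₀) := fun u hu =>
    ⟨by linarith [hu.2], by linarith [hu.1]⟩
  have hr : ∀ u ∈ Icc 0 t₀, HasDerivWithinAt (fun u => t₀ - u) (-1) (Icc 0 t₀) u := fun u _ => by
    simpa using (hasDerivWithinAt_id u (Icc 0 t₀)).const_sub t₀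
  set I : ℝ → ℂ := fun u => inner ℂ (toL2 (op (sinSym (t₀ - u)) φ)) (D' u) +
    inner ℂ (toL2 (op (cosSym (t₀ - u)) φ)) (D u) with hI
  have hI' : ∀ u ∈ Icc 0 t₀, HasDerivWithinAt I 0 (Icc 0 t₀) u := by
    intro u hu
    have h1 : HasDerivWithinAt (fun u => toL2 (op (sinSym (t₀ - u)) φ))
        ((-1 : ℝ) • toL2 (op (cosSym (t₀ - u)) φ)) (Icc 0 t₀) u :=
      (hasDerivWithinAt_sin_op t₀ φ (hmaps hu)).scomp u (hr u hu) hmaps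
    have h2 : HasDerivWithinAt (fun u => toL2 (op (cosSym (t₀ - u)) φ))
        ((-1 : ℝ) • toL2 (Δ (op (sinSym (t₀ - u)) φ))) (Icc 0 t₀) u :=
      (hasDerivWithinAt_cos_op t₀ φ (hmaps hu)).scomp u (hr u hu) hmaps
    refine ((h1.inner ℂ ((hD2 u (hsub hu)).mono hsub)).add
      (h2.inner ℂ ((hD1 u (hsub hu)).mono hsub))).congr_deriv ?_
    rw [hweak u (hsub hu), neg_one_smul, neg_one_smul, inner_neg_left, inner_neg_left]
    ring
  have hconst : I t₀ = I 0 :=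
    constant_of_derivWithin_zero (fun u hu => (hI' u hu).differentiableWithinAt)
      (fun u hu => (hI' u ⟨hu.1, hu.2.le⟩).derivWithin
        (uniqueDiffOn_Icc (hu.1.trans_lt hu.2) u ⟨hu.1, hu.2.le⟩)) t₀ ⟨ht₀.1, le_rfl⟩
  have h0 : I 0 = 0 := by simp only [hI, hD0, hD'0, inner_zero_right, add_zero]
  have ht : I t₀ = inner ℂ (toL2 φ) (D t₀) := by
    simp only [hI, sub_self, op_sinSym_zero, op_cosSym_zero, map_zero, inner_zero_left, zero_add]
  rw [← ht, hconst, h0]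

lemma IsPi.ae_eq {d : ℕ} {ω : ℝ} (hω : 0 < ω) {f v g₁ g₂ : E d → ℂ} (h₁ : IsPi ω f v g₁)
    (h₂ : IsPi ω f v g₂) : g₁ =ᵐ[volume] g₂ := by
  obtain ⟨w₁, hw₁, e₁⟩ := h₁
  obtain ⟨w₂, hw₂, e₂⟩ := h₂
  have h : (∫ t in (0 : ℝ)..period ω, kernel ω t • w₁ t : Lp ℂ 2 (volume : Measure (E d))) =
      ∫ t in (0 : ℝ)..period ω, kernel ω t • w₂ t := by
    refine intervalIntegral.integral_congr fun t ht => ?_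
    rw [uIcc_of_le (period_pos hω).le] at ht
    simp only [hw₁.eqOn hω hw₂ ht]
  rw [h] at e₁
  exact e₁.trans e₂.symm

lemma isPi_of_ae_eq {d : ℕ} {ω : ℝ} (hω : 0 < ω) {f g : E d → ℂ}
    {F : Lp ℂ 2 (volume : Measure (E d))} (hF : F =ᵐ[volume] f) (φ : 𝓢(E d, ℂ))
    (hg : ∀ᵐ x, g x = op (sSym ω) φ x + fourierMul (mSym ω) F x) : IsPi ω f φ g := by
  refine ⟨waveSol ω F φ, isWaveSolution_waveSol hω hF φ, ?_⟩
  rw [integral_kernel_smul_waveSol hω]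
  filter_upwards [hg, Lp.coeFn_add (toL2 (op (sSym ω) φ)) (fourierMul (mSym ω) F),
    toL2_coe (op (sSym ω) φ)] with x h1 h2 h3
  rw [h1, h2, Pi.add_apply, h3]

/-! ### The Waveholtz operators -/

lemma fourierMul_zero {d : ℕ} {m : E d → ℝ} (hm : m.HasTemperateGrowth) {C : ℝ}
    (hC : ∀ ξ, |m ξ| ≤ C) : fourierMul m (0 : Lp ℂ 2 (volume : Measure (E d))) = 0 :=
  L2_ext_of_inner fun φ => by
    rw [inner_fourierMul hm hC, inner_zero_right, inner_zero_right]

lemma isPi_zero_toL {d : ℕ} {ω : ℝ} (hω : 0 < ω) (s : ℝ) (φ : 𝓢(E d, ℂ)) :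
    IsPi ω 0 φ (ext s (sSym ω) (toL s φ)) := by
  obtain ⟨C, hC⟩ := abs_mSym_le (d := d) hω
  refine isPi_of_ae_eq hω (Lp.coeFn_zero ℂ 2 volume) φ ?_
  rw [ext_toL s (sSym_bounded hω), fourierMul_zero (mSym_bounded hω).temperate hC]
  filter_upwards [toL_coe s (op (sSym ω) φ), Lp.coeFn_zero ℂ 2 (volume : Measure (E d))] with x h1 h2
  rw [h1, h2]
  simp

lemma isPi_toL {d : ℕ} {ω : ℝ} (hω : 0 < ω) {t : ℝ} (ht : 0 ≤ t) (f : L2s d t) (s : ℝ)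
    (φ : 𝓢(E d, ℂ)) {g : E d → ℂ}
    (hg : ∀ᵐ x, g x = ext s (sSym ω) (toL s φ) x + ext t (mSym ω) f x) : IsPi ω f φ g := by
  obtain ⟨C, hC⟩ := abs_mSym_le (d := d) hω
  refine isPi_of_ae_eq hω (lpMono_coe (volume_le_weightMeasure ht) f) φ ?_
  rw [← ext_eq_fourierMul ht (mSym_bounded hω) hC]
  rw [ext_toL s (sSym_bounded hω)] at hg
  filter_upwards [hg, toL_coe s (op (sSym ω) φ),
    lpMono_coe (volume_le_weightMeasure ht) (ext t (mSym ω) f)] with x h1 h2 h3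
  rw [h1, h2, h3]

lemma dense_toL_testFunctions (d : ℕ) (s : ℝ) :
    Dense (toL (d := d) s '' {φ | HasCompactSupport φ}) := by
  have hsub : range (toL (d := d) s) ⊆ closure (toL (d := d) s '' {φ | HasCompactSupport φ}) := by
    rintro _ ⟨φ, rfl⟩
    rw [← toL2s_toH 0 s φ, ← comp_zero]
    refine map_mem_closure (comp (MultiIndex.zero d 0)).continuous
      (dense_testFunctions d 0 s (toH 0 s φ)) ?_
    rintro _ ⟨ψ, hψ, rfl⟩
    exact ⟨ψ, hψ, by rw [comp_zero, toL2s_toH]⟩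
  exact dense_closure.1 ((toL_dense s).mono hsub)

/-- Two extensions of `Π`, continuous on a space in which the test functions are dense, agree. -/
lemma ExtendsPi.eq {d : ℕ} {ω : ℝ} (hω : 0 < ω) {f : E d → ℂ} {X Y : Type} [TopologicalSpace X]
    [TopologicalSpace Y] [T2Space Y] {fX : X → E d → ℂ} {fY : Y → E d → ℂ}
    (hX : ∀ V W, fX V =ᵐ[volume] fX W → V = W) (hY : ∀ V W, fY V =ᵐ[volume] fY W → V = W)
    {j : 𝓢(E d, ℂ) → X} (hj : ∀ φ, fX (j φ) =ᵐ[volume] φ)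
    (hd : Dense (j '' {φ | HasCompactSupport φ})) {A B : X → Y} (hA : Continuous A)
    (hB : Continuous B) (hA' : ExtendsPi ω f fX fY A) (hB' : ExtendsPi ω f fX fY B) : A = B := by
  refine Continuous.ext_on hd hA hB ?_
  rintro _ ⟨φ, hφ, rfl⟩
  obtain ⟨V, hV, h1⟩ := hA' φ (φ.smooth ⊤) hφ
  obtain ⟨W, hW, h2⟩ := hB' φ (φ.smooth ⊤) hφ
  obtain rfl : V = j φ := hX _ _ (hV.trans (hj φ).symm)
  obtain rfl : W = j φ := hX _ _ (hW.trans (hj φ).symm)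
  exact hY _ _ (h1.ae_eq hω h2)

lemma extendsPi_of_toSchwartz {d : ℕ} {ω : ℝ} {f : E d → ℂ} {X Y : Type} {fX : X → E d → ℂ}
    {fY : Y → E d → ℂ} {j : 𝓢(E d, ℂ) → X} (hj : ∀ φ, fX (j φ) =ᵐ[volume] φ) {A : X → Y}
    (h : ∀ φ : 𝓢(E d, ℂ), IsPi ω f φ (fY (A (j φ)))) : ExtendsPi ω f fX fY A := by
  intro v hv hc
  exact ⟨j (hc.toSchwartzMap hv), hj _, h (hc.toSchwartzMap hv)⟩

/-! ### Outgoing solutions -/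

/-- Formally `m(D) f = m(D)(Δ + ω²)u = u - 𝒮u`. To justify it, the equation of `u_z` is tested with
`χ = m(D)ψ`, for which `(Δ + z)χ = ψ - 𝒮ψ + (z - ω²)χ`; as `z → ω²` the last term disappears, since
the pairings of `u_z` with `χ` converge. -/
lemma IsOutgoing.incl_ext_mSym {d : ℕ} {ω t : ℝ} (hω : 0 < ω) (ht : -t ≤ t) {f : L2s d t}
    {u : Hps d 2 (-t)} (hu : IsOutgoing ω t f u) :
    incl ht (ext t (mSym ω) f) = u.toL2s - ext (-t) (sSym ω) u.toL2s := by
  obtain ⟨U, hU, hlim⟩ := hu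
  refine L2s_ext_of_pair fun ψ => ?_
  have hs := sSym_bounded (d := d) hω
  have hm := mSym_bounded (d := d) hω
  rw [pair_congr ψ (incl_coe ht _), pair_ext t hm, map_sub, pair_ext _ hs]
  set χ := op (mSym ω) ψ with hχ
  have key : ∀ z : ℂ, 0 < z.im → pair t χ f = pair (-t) ψ (U z).toL2s -
      pair (-t) (op (sSym ω) ψ) (U z).toL2s + (z - (ω : ℂ) ^ 2) * pair (-t) χ (U z).toL2s := by
    intro z hz
    have hi : Integrable fun x => (U z).toL2s x * ψ x - (U z).toL2s x * op (sSym ω) ψ x :=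
      (integrable_mul_schwartz _ _).sub (integrable_mul_schwartz _ _)
    rw [pair_apply, ← (hU z hz).2 χ, pair_apply, pair_apply, pair_apply, ← integral_const_mul,
      ← integral_sub (integrable_mul_schwartz _ _) (integrable_mul_schwartz _ _),
      ← integral_add hi ((integrable_mul_schwartz _ _).const_mul _)]
    refine integral_congr_ae (ae_of_all _ fun x => ?_)
    simp only [hχ, laplacian_op_mSym hω, sub_apply, smul_apply, smul_eq_mul]
    push_cast
    ring
  have hcont : ∀ η : 𝓢(E d, ℂ), Tendsto (fun z => pair (-t) η (U z).toL2s)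
      (𝓝[{z : ℂ | 0 < z.im}] ((ω : ℂ) ^ 2)) (𝓝 (pair (-t) η u.toL2s)) := fun η => by
    have hc := (((pair (-t) η) ∘L comp (MultiIndex.zero d 2)).continuous.tendsto u).comp hlim
    exact hc
  -- The point `ω²` lies on the boundary of the half-plane, so the filter is nontrivial and limits
  -- along it are unique.
  have hne : (𝓝[{z : ℂ | 0 < z.im}] ((ω : ℂ) ^ 2)).NeBot := by
    rw [← mem_closure_iff_nhdsWithin_neBot, Complex.closure_setOfPred_lt_im]
    change (0 : ℝ) ≤ ((ω : ℂ) ^ 2).im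
    rw [← Complex.ofReal_pow, Complex.ofReal_im]
  have hz : Tendsto (fun z : ℂ => z - (ω : ℂ) ^ 2) (𝓝[{z : ℂ | 0 < z.im}] ((ω : ℂ) ^ 2))
      (𝓝 0) := by
    have h1 : Tendsto (fun z : ℂ => z - (ω : ℂ) ^ 2) (𝓝 ((ω : ℂ) ^ 2)) (𝓝 0) := by
      have hc : Continuous fun z : ℂ => z - (ω : ℂ) ^ 2 := by fun_prop
      have h := hc.tendsto ((ω : ℂ) ^ 2)
      rwa [sub_self] at h
    exact h1.mono_left nhdsWithin_le_nhds
  have h2 := ((hcont ψ).sub (hcont (op (sSym ω) ψ))).add (hz.mul (hcont χ))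
  rw [zero_mul, add_zero] at h2
  refine tendsto_nhds_unique (f := fun _ => pair t χ f)
    (l := 𝓝[{z : ℂ | 0 < z.im}] ((ω : ℂ) ^ 2)) tendsto_const_nhds (h2.congr' ?_)
  filter_upwards [self_mem_nhdsWithin] with z hz
  exact (key z hz).symm

end Waveholtz

end

/-! ### Assembly of the proposition -/

open Waveholtz

theorem proposition3p2 (d : ℕ) (hd : 1 ≤ d) (ω : ℝ) (hω : 0 < ω) :
    ∃ (S : ∀ s : ℝ, L2s d s →L[ℂ] L2s d s)
      (SH : ∀ (p : ℕ) (s : ℝ), Hps d p s →L[ℂ] Hps d p s),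
      -- unique bounded extension to `L²_s`
      (∀ s : ℝ, ExtendsPi ω 0 (fun V : L2s d s => V) (fun V : L2s d s => V) (S s) ∧
        ∀ A : L2s d s →L[ℂ] L2s d s,
          ExtendsPi ω 0 (fun V : L2s d s => V) (fun V : L2s d s => V) A → A = S s) ∧
      -- unique bounded extension to `H^p_s`
      (∀ (p : ℕ) (s : ℝ),
        ExtendsPi ω 0 (fun V : Hps d p s => V.toL2s) (fun V : Hps d p s => V.toL2s) (SH p s) ∧
        (∀ A : Hps d p s →L[ℂ] Hps d p s,
          ExtendsPi ω 0 (fun V : Hps d p s => V.toL2s) (fun V : Hps d p s => V.toL2s) A →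
            A = SH p s) ∧
        ∀ V : Hps d p s, (SH p s V).toL2s = S s V.toL2s) ∧
      -- the Fourier multiplier on `L²`
      (∀ v : Lp ℂ 2 (volume : Measure (E d)),
        ∃ (V : L2s d 0) (g : Lp ℂ 2 (volume : Measure (E d))),
          V =ᵐ[volume] v ∧ S 0 V =ᵐ[volume] g ∧
          (𝓕 g : Lp ℂ 2 (volume : Measure (E d))) =ᵐ[volume]
            fun ξ => (beta ω (2 * Real.pi * ‖ξ‖) : ℂ) *
              (𝓕 v : Lp ℂ 2 (volume : Measure (E d))) ξ) ∧
      -- the affine operator `Π`, defined on all of `H^p_s`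
      (∀ (t : ℝ), 1 / 2 < t → ∀ f : L2s d t, ∀ (p q : ℕ) (s r : ℝ),
        q ≤ p → q ≤ 2 → r ≤ s → r ≤ t →
        ∃ P : Hps d p s →ᴬ[ℂ] Hps d q r,
          ExtendsPi ω f (fun V : Hps d p s => V.toL2s) (fun V : Hps d q r => V.toL2s) P ∧
          (∀ Q : Hps d p s → Hps d q r, Continuous Q →
            ExtendsPi ω f (fun V : Hps d p s => V.toL2s) (fun V : Hps d q r => V.toL2s) Q →
              ∀ V : Hps d p s, Q V = P V) ∧
          ∀ u : Hps d 2 (-t), IsOutgoing ω t f u →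
            ∀ (V : Hps d p s) (σ : ℝ), σ ≤ s → σ ≤ -t →
              ∃ W : L2s d σ, (W =ᵐ[volume] fun x => V.toL2s x - u.toL2s x) ∧
                (P V).toL2s =ᵐ[volume] fun x => S σ W x + u.toL2s x) := by
  have hb := sSym_bounded (d := d) hω
  have hL : ∀ {s : ℝ} (V W : L2s d s), V =ᵐ[volume] W → V = W := fun V W h => L2s_ext h
  have hH : ∀ {p : ℕ} {s : ℝ} (V W : Hps d p s), V.toL2s =ᵐ[volume] W.toL2s → V = W :=
    fun V W h => Hps_ext (L2s_ext h)
  have hjH : ∀ (p : ℕ) (s : ℝ) (φ : 𝓢(E d, ℂ)), (toH p s φ).toL2s =ᵐ[volume] φ := fun p s φ => by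
    rw [toL2s_toH]
    exact toL_coe s φ
  refine ⟨fun s => ext s (sSym ω), fun p s => extH p s hb, fun s => ?_, fun p s => ?_, fun v => ?_,
    fun t ht f p q s r hqp hq2 hrs hrt => ?_⟩
  · have hS : ExtendsPi ω 0 (fun V : L2s d s => V) (fun V : L2s d s => V) (ext s (sSym ω)) :=
      extendsPi_of_toSchwartz (j := toL s) (toL_coe s) fun φ => isPi_zero_toL hω s φ
    exact ⟨hS, fun A hA => DFunLike.coe_injective (ExtendsPi.eq hω hL hL (toL_coe s)
      (dense_toL_testFunctions d s) A.continuous (ext s (sSym ω)).continuous hA hS)⟩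
  · have hS : ExtendsPi ω 0 (fun V : Hps d p s => V.toL2s) (fun V : Hps d p s => V.toL2s)
        (extH p s hb) := extendsPi_of_toSchwartz (j := toH p s) (hjH p s) fun φ => by
      rw [toL2s_extH, toL2s_toH]
      exact isPi_zero_toL hω s φ
    exact ⟨hS, fun A hA => DFunLike.coe_injective (ExtendsPi.eq hω hH hH (hjH p s)
      (dense_testFunctions d p s) A.continuous (extH p s hb).continuous hA hS),
      fun V => toL2s_extH p s hb V⟩
  · obtain ⟨C, hC⟩ := abs_sSym_le (d := d) hω
    -- The measure with weight exponent `0` equals Lebesgue measure but is not the same expression,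
    -- so `v` is carried between the two `L²` spaces by inclusions in both directions.
    have hV := ae_volume_of_ae_weightMeasure (lpMono_coe (weightMeasure_le_volume (le_refl 0)) v)
    refine ⟨lpMono (weightMeasure_le_volume le_rfl) v, fourierMul (sSym ω) v, hV, ?_, ?_⟩
    · have h1 := ext_eq_fourierMul le_rfl hb hC (lpMono (weightMeasure_le_volume (le_refl 0)) v)
      have h2 : lpMono (volume_le_weightMeasure le_rfl)
          (lpMono (weightMeasure_le_volume (le_refl 0)) v) = v :=
        Lp.ext ((lpMono_coe _ _).trans hV)
      rw [h2] at h1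
      rw [← h1]
      exact (lpMono_coe _ _).symm
    -- `sSym ω ξ` unfolds to `β(2π|ξ|)`.
    · exact fourier_fourierMul (memLp_mul_fourier hb.temperate.1.continuous hC v)
  · have ht0 : 0 ≤ t := by linarith
    -- The linear part is `𝒮` and needs only `q ≤ p`, `r ≤ s`. The constant `m(D) f` lies in `H²_t`,
    -- which is where `q ≤ 2` and `r ≤ t` come from.
    let P : Hps d p s →ᴬ[ℂ] Hps d q r :=
      (extH q r hb ∘L restr hqp hrs).toContinuousAffineMap +
        ContinuousAffineMap.const ℂ (Hps d p s) (restr hq2 hrt (forcingH ω t f))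
    have hP : ∀ V, (P V).toL2s = ext r (sSym ω) (incl hrs V.toL2s) +
        incl hrt (ext t (mSym ω) f) := fun V => by
      rw [← toL2s_forcingH hω, ← toL2s_restr hqp, ← toL2s_restr hq2, ← toL2s_extH q r hb]
      rfl
    have hPi : ExtendsPi ω f (fun V : Hps d p s => V.toL2s) (fun V : Hps d q r => V.toL2s) P :=
      extendsPi_of_toSchwartz (j := toH p s) (hjH p s) fun φ => by
        refine isPi_toL hω ht0 f r φ ?_
        rw [hP, toL2s_toH, incl_toL]
        filter_upwards [ae_volume_of_ae_weightMeasure (Lp.coeFn_add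
          (ext r (sSym ω) (toL r φ)) (incl hrt (ext t (mSym ω) f))),
          incl_coe hrt (ext t (mSym ω) f)] with x h1 h2
        rw [h1, Pi.add_apply, h2]
    refine ⟨P, hPi, fun Q hQ hQ' V => ?_, fun u hu V σ hσs hσt => ?_⟩
    · exact congrFun (ExtendsPi.eq hω hH hH (hjH p s) (dense_testFunctions d p s) hQ
        P.continuous hQ' hPi) V
    · have htt : -t ≤ t := by linarith
      have hout := hu.incl_ext_mSym hω htt
      refine ⟨incl hσs V.toL2s - incl hσt u.toL2s, ?_, ?_⟩
      · filter_upwards [ae_volume_of_ae_weightMeasure (Lp.coeFn_sub (incl hσs V.toL2s)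
          (incl hσt u.toL2s)), incl_coe hσs V.toL2s, incl_coe hσt u.toL2s] with x h1 h2 h3
        rw [h1, Pi.sub_apply, h2, h3]
      · rw [hP, map_sub]
        -- Here `𝒮` acts in three spaces, of weights `σ`, `r` and `-t`. These actions agree almost
        -- everywhere on common functions, so that `𝒮V + (u - 𝒮u)` may be read as `𝒮(V - u) + u`
        -- pointwise.
        have e1 : ext σ (sSym ω) (incl hσs V.toL2s) =ᵐ[volume]
            ext r (sSym ω) (incl hrs V.toL2s) :=
          ext_congr hb ((incl_coe hσs _).trans (incl_coe hrs _).symm)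
        have e2 : ext σ (sSym ω) (incl hσt u.toL2s) =ᵐ[volume] ext (-t) (sSym ω) u.toL2s :=
          ext_congr hb (incl_coe hσt _)
        have e3 := incl_coe htt (ext t (mSym ω) f)
        rw [hout] at e3
        filter_upwards [ae_volume_of_ae_weightMeasure (Lp.coeFn_add
            (ext r (sSym ω) (incl hrs V.toL2s)) (incl hrt (ext t (mSym ω) f))),
          ae_volume_of_ae_weightMeasure (Lp.coeFn_sub (ext σ (sSym ω) (incl hσs V.toL2s))
            (ext σ (sSym ω) (incl hσt u.toL2s))),
          ae_volume_of_ae_weightMeasure (Lp.coeFn_sub u.toL2s (ext (-t) (sSym ω) u.toL2s)),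
          incl_coe hrt (ext t (mSym ω) f), e1, e2, e3] with x h1 h2 h3 h4 h5 h6 h7
        rw [h1, h2, Pi.add_apply, Pi.sub_apply, h4, ← h7, h3, Pi.sub_apply, h5, h6]
        ring
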